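/- Throughout, a *space* is a Kan complex, a weak equivalence of spaces is a (simplicial) homotopy equivalence, and all limits of spaces are homotopy limits (in the Bousfield–Kan form). Let $S:\mathbb{\Delta}^{op}\to \mathrm{Spaces}$ be a simplicial space, and for a simplicial set $K$ let $$S^{ext}(K)=\operatorname{holim}_{(\Delta^m\to K)} S_m ,$$ the homotopy limit being taken over the category of simplices of $K$; this is a contravariant functor of $K$ with $S^{ext}(\Delta^n)\simeq S_n$. *2-Segal.* Let $P=(P_1,\dots,P_k)$ be a polygonal decomposition of the convex $(n+1)$-gon with vertices $0,\dots,n$ (cut along a set of pairwise non-crossing diagonals), and let $\Delta^P=\Delta^{P_1}\cup\dots\cup\Delta^{P_k}\subseteq\Delta^n$, where $\Delta^{P_i}$ is the face spanned by the vertices of $P_i$. Put $S_P=S^{ext}(\Delta^P)$ (equivalently, the homotopy fibre product of the spaces $S_{P_i}$ over the spaces of the common diagonals). $S$ is *2-Segal* if for all $n\ge 3$ and all polygonal decompositions $P$ of the $(n+1)$-gon the canonical map $S_n\to S_P$ is a weak equivalence. *Cubes of correspondences.* An $m$-cube of correspondences in a category $\mathcal D$ is a functor $(0\leftarrow M\to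 1)^m\to\mathcal D$. For a vertex $v\in\{0,1\}^m$, its corner cube at $v$ is the ordinary $m$-cube obtained by restriction to the positions $p$ with $p_i\in\{M,v_i\}$ for all $i$; its initial vertex is the value at $(M,\dots,M)$. An $m$-cube of spaces is a *pullback cube* if the map from its initial vertex to the homotopy limit of the rest of the cube is a weak equivalence. A cube of correspondences of spaces *commutes* if its corner cubes at $(1,0,1,0,\dots)$ and at $(0,1,0,1,\dots)$ are pullback cubes. *The functor $H_{geo}$.* Let $\mathbb{\Delta}_+$ be the category of finite, possibly empty, totally ordered sets. For $X\in\mathbb{\Delta}_+$ let $X^*$ be the standard simplex with ordered set of vertices $\operatorname{Hom}(X,\{0<1\})$. For $f:X\to Y$ in $\mathbb{\Delta}_+$ let $H_{comb}(f)\subseteq X^*$ be the union over $y\in Y$ of the faces spanned by those $\varphi$ with $\varphi(x)=0$ whenever $f(x)<y$ and $\varphi(x)=1$ whenever $f(x)>y$ (for $X=\emptyset$ put $H_{comb}(f)=X^*=\Delta^0$). For an $m$-cube $c$ in $\mathbb{\Delta}_+$, i.e. a functor $c:\{0<1\}^m\to\mathbb{\Delta}_+$, let $H_{comb}(c)$ be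 the $m$-cube of correspondences in $\mathrm{SSet}^{op}$ whose value at a position $p$ is $H_{comb}(c(s(p))\to c(t(p)))$, where $s(p)$ and $t(p)$ are obtained from $p$ by replacing each coordinate $M$ by $0$, respectively by $1$. Let $H_{geo}(c)=S^{ext}\circ H_{comb}(c)$, an $m$-cube of correspondences of spaces. *Associativity cubes.* For $n\ge 3$ the $n$-associativity cube is the $(n-1)$-cube in $\mathbb{\Delta}_+$ with initial vertex an $n$-element ordered set $x_0<\dots<x_{n-1}$, whose vertex $a\in\{0,1\}^{n-1}$ is the quotient obtained by identifying the neighbours $x_{i-1}$ and $x_i$ for all $1\le i\le n-1$ with $a_i=1$, and whose edges are the quotient maps. **Theorem.** A simplicial space $S$ is 2-Segal if and only if, for every $n\ge 3$, $H_{geo}$ sends the $n$-associativity cube to a commutative cube of correspondences of spaces. -/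

import Mathlib

open CategoryTheory MonoidalCategory Opposite

universe v u

namespace HigherHall

/-! ### Homotopy limits of diagrams of spaces

A *space* is a Kan complex. -/

/-- Homotopy equivalences of simplicial sets. Between Kan complexes these are exactly the weak
equivalences. -/
def IsHomotopyEquiv {X Y : SSet.{u}} (f : X ⟶ Y) : Prop :=
  ∃ g : Y ⟶ X, Nonempty (SSet.Homotopy (f ≫ g) (𝟙 X)) ∧ Nonempty (SSet.Homotopy (g ≫ f) (𝟙 Y))

section Holim

/-- The Bousfield–Kan weight `j ↦ N(J / j)`. -/
def weight (J : Type u) [Category.{v} J] : J ⥤ SSet.{max u v} :=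
  Over.mapFunctor J ⋙ nerveFunctor

/-- The Bousfield–Kan homotopy limit of a diagram `F` of spaces: the simplicial set of natural
transformations `N(J / -) ⟶ F`, whose `q`-simplices are the natural transformations
`N(J / -) × Δ[q] ⟶ F`. -/
def holim {J : Type u} [Category.{v} J] (F : J ⥤ SSet.{max u v}) : SSet.{max u v} :=
  (SSet.stdSimplex ⋙ Functor.const J ⋙ tensorLeft (weight J)).op ⋙ yoneda.obj F

/-- A cone over `F` with apex `X` induces a map from `X` to the homotopy limit of `F`
(the map to the limit, followed by the canonical map from the limit to the homotopy limit). -/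
def toHolim {J : Type u} [Category.{v} J] {F : J ⥤ SSet.{max u v}} {X : SSet.{max u v}}
    (c : (Functor.const J).obj X ⟶ F) : X ⟶ holim F where
  app q := ↾fun x ↦ (SemiCartesianMonoidalCategory.snd (weight J) _) ≫
    (Functor.const J).map (SSet.yonedaEquiv.symm x) ≫ c
  naturality q r f := by
    ext x
    change SemiCartesianMonoidalCategory.snd (weight J) _ ≫
        (Functor.const J).map (SSet.yonedaEquiv.symm (X.map f x)) ≫ c =
      (weight J ◁ (Functor.const J).map (SSet.stdSimplex.map f.unop)) ≫
        SemiCartesianMonoidalCategory.snd (weight J) _ ≫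
          (Functor.const J).map (SSet.yonedaEquiv.symm x) ≫ c
    have h : SSet.yonedaEquiv.symm (X.map f x) =
        SSet.stdSimplex.map f.unop ≫ SSet.yonedaEquiv.symm x :=
      (SSet.yonedaEquiv_symm_naturality_left f.unop x).symm
    rw [h, Functor.map_comp]
    simp

/-- The functors `I / i ⥤ J / φ i` induce a map of weights. -/
def weightMap {I : Type u} [Category.{v} I] {J : Type u} [Category.{v} J] (φ : I ⥤ J) :
    weight I ⟶ φ ⋙ weight J where
  app i := nerveMap (Over.post φ)
  naturality i i' f := by
    have h : Over.map f ⋙ Over.post φ = Over.post φ ⋙ Over.map (φ.map f) := by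
      refine CategoryTheory.Functor.ext (fun X ↦ ?_) (fun X Y g ↦ ?_)
      · change Over.mk (φ.map (X.hom ≫ f)) = Over.mk (φ.map X.hom ≫ φ.map f)
        rw [φ.map_comp]
      · ext
        simp only [Over.comp_left, Over.eqToHom_left]
        change φ.map g.left = 𝟙 _ ≫ φ.map g.left ≫ 𝟙 _
        simp
    exact congrArg (fun F ↦ nerveMap F) h

/-- Restriction of homotopy limits along a functor of index categories. -/
def holimPre {I : Type u} [Category.{v} I] {J : Type u} [Category.{v} J] (φ : I ⥤ J)
    (F : J ⥤ SSet.{max u v}) : holim F ⟶ holim (φ ⋙ F) where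
  app q := ↾fun (x : _ ⟶ _) ↦ (weightMap φ ▷ _) ≫ Functor.whiskerLeft φ x
  naturality q r f := by
    ext x
    rfl

end Holim

/-! ### The extended Waldhausen construction -/

section Waldhausen

variable (S : SimplexCategoryᵒᵖ ⥤ SSet.{u})

/-- The diagram of spaces `([m], σ ∈ K_m) ↦ S_m` indexed by the category of simplices of `K`. -/
abbrev simplexDiagram (K : SSet.{u}) : K.Elements ⥤ SSet.{u} :=
  CategoryOfElements.π K ⋙ S

/-- The extension of a simplicial space `S` to simplicial sets: the homotopy right Kan extension
of `S` along the Yoneda embedding, that is, `S^ext(K)` is the homotopy limit of the spaces `S_m`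
over all simplices `Δ[m] ⟶ K`. -/
def Sext : SSet.{u}ᵒᵖ ⥤ SSet.{u} where
  obj K := holim (simplexDiagram S K.unop)
  map f := holimPre (CategoryOfElements.map f.unop) (simplexDiagram S _)
  map_id K := by
    ext q x
    rfl
  map_comp f g := by
    ext q x
    rfl

open scoped Simplicial in
/-- The canonical map `S_n ⟶ S^ext(K)` for a simplicial subset `K` of the standard simplex
`Δ[n]`: its component at a simplex `σ : Δ[m] ⟶ K ⊆ Δ[n]` is `σ^* : S_n ⟶ S_m`. -/
def restrict {n : ℕ} (K : (Δ[n] : SSet.{u}).Subcomplex) :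
    S.obj (op ⦋n⦌) ⟶ (Sext S).obj (op K.toSSet) :=
  toHolim (F := simplexDiagram S K.toSSet)
    { app := fun σ ↦ S.map (SSet.stdSimplex.objEquiv σ.2.1).op
      naturality := fun σ τ f ↦ by
        have h : SSet.stdSimplex.objEquiv τ.2.1 =
            f.1.unop ≫ SSet.stdSimplex.objEquiv σ.2.1 :=
          congrArg (fun ρ : K.toSSet.obj τ.1 ↦ SSet.stdSimplex.objEquiv ρ.1) f.2.symm
        change 𝟙 _ ≫ S.map (SSet.stdSimplex.objEquiv τ.2.1).op =
          S.map (SSet.stdSimplex.objEquiv σ.2.1).op ≫ S.map f.1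
        rw [h, Category.id_comp, op_comp, S.map_comp]
        rfl }

end Waldhausen

/-! ### The 2-Segal conditions -/

/-- A polygonal decomposition of the convex `(n+1)`-gon with vertices `0, …, n` in cyclic order,
given by a set of pairwise non-crossing diagonals. -/
structure PolygonalDecomposition (n : ℕ) where
  /-- The diagonals, recorded as pairs of endpoints in increasing order. -/
  diagonals : Set (Fin (n + 1) × Fin (n + 1))
  /-- A diagonal joins two different vertices that are not neighbours in the cyclic order. -/
  isDiagonal : ∀ d ∈ diagonals, (d.1 : ℕ) + 1 < d.2 ∧ ¬ ((d.1 : ℕ) = 0 ∧ (d.2 : ℕ) = n)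
  noncrossing : ∀ d ∈ diagonals, ∀ e ∈ diagonals, ¬ (d.1 < e.1 ∧ e.1 < d.2 ∧ d.2 < e.2)

namespace PolygonalDecomposition

variable {n : ℕ} (P : PolygonalDecomposition n)

/-- No diagonal of the decomposition has two of the vertices in `Q` strictly on different sides. -/
def Unseparated (Q : Finset (Fin (n + 1))) : Prop :=
  ∀ d ∈ P.diagonals, ∀ x ∈ Q, ∀ y ∈ Q, ¬ ((d.1 < x ∧ x < d.2) ∧ (y < d.1 ∨ d.2 < y))

/-- The vertex sets of the polygons `P_1, …, P_k` into which the diagonals cut the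
`(n+1)`-gon. -/
def polygons : Set (Finset (Fin (n + 1))) :=
  {Q | Maximal P.Unseparated Q}

open scoped Simplicial in
/-- The simplicial subset `Δ^P = Δ^{P_1} ∪ … ∪ Δ^{P_k}` of `Δ[n]`. -/
def complex : (Δ[n] : SSet.{u}).Subcomplex :=
  ⨆ Q ∈ P.polygons, SSet.stdSimplex.face Q

end PolygonalDecomposition

/-- A simplicial space `S` is 2-Segal if for all `n ≥ 3` and all polygonal decompositions `P` of
the `(n+1)`-gon the map `S_n ⟶ S_P` is a weak equivalence. Here `S_P = S^ext(Δ^P)` is the space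
of derived membranes, i.e. the homotopy fibre product of the `S_{P_i}` over the spaces `S_1` of
the diagonals along which the polygons `P_i` are glued. -/
def IsTwoSegal (S : SimplexCategoryᵒᵖ ⥤ SSet.{u}) : Prop :=
  ∀ n : ℕ, 3 ≤ n → ∀ P : PolygonalDecomposition n, IsHomotopyEquiv (restrict S P.complex)

/-! ### Cubes and cubes of correspondences -/

/-- The ordered set `0 → 1`. -/
inductive Two : Type u where
  | zero
  | one

instance : PartialOrder Two.{u} where
  le a b := a = .zero ∨ b = .one
  le_refl a := by cases a <;> simp
  le_trans a b c := by cases a <;> cases b <;> cases c <;> simp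
  le_antisymm a b := by cases a <;> cases b <;> simp

/-- The vertices of the `m`-cube: sequences of `0`'s and `1`'s, ordered coordinatewise. -/
def Vertex (m : ℕ) : Type u := Fin m → Two.{u}

instance (m : ℕ) : PartialOrder (Vertex.{u} m) := inferInstanceAs (PartialOrder (Fin m → Two.{u}))

/-- The initial vertex `000…`. -/
def Vertex.init (m : ℕ) : Vertex.{u} m := fun _ ↦ .zero

lemma Vertex.init_le {m : ℕ} (a : Vertex.{u} m) : init m ≤ a := fun _ ↦ Or.inl rfl

/-- Commutative `m`-cubes in a category. -/
abbrev Cube (D : Type*) [Category* D] (m : ℕ) :=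
  Vertex.{u} m ⥤ D

/-- The vertices of the `m`-cube other than the initial vertex `000…`. -/
abbrev Punctured (m : ℕ) : Type u :=
  {a : Vertex.{u} m // a ≠ Vertex.init m}

/-- A cube of spaces without its initial vertex. -/
abbrev Cube.punctured {m : ℕ} (Q : Cube.{u} SSet.{u} m) : Punctured.{u} m ⥤ SSet.{u} :=
  (Subtype.mono_coe (fun a : Vertex.{u} m ↦ a ≠ Vertex.init m)).functor ⋙ Q

/-- The map from the initial vertex of a cube of spaces to the homotopy limit of the rest. -/
def Cube.comparison {m : ℕ} (Q : Cube.{u} SSet.{u} m) :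
    Q.obj (Vertex.init m) ⟶ holim Q.punctured :=
  toHolim
    { app := fun a ↦ Q.map (homOfLE a.1.init_le)
      naturality := fun a b f ↦ by
        change 𝟙 _ ≫ Q.map _ = Q.map _ ≫ Q.map _
        rw [Category.id_comp, ← Q.map_comp]
        rfl }

/-- A cube of spaces is a pullback cube if it presents its initial vertex as the (homotopy) limit
of the rest of the cube. -/
def Cube.IsPullback {m : ℕ} (Q : Cube.{u} SSet.{u} m) : Prop :=
  IsHomotopyEquiv Q.comparison

/-- The shape `0 ← M → 1` of a correspondence. -/
inductive Leg : Type u where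
  | mid
  | zero
  | one

instance : PartialOrder Leg.{u} where
  le a b := a = .mid ∨ a = b
  le_refl a := by simp
  le_trans a b c := by cases a <;> cases b <;> cases c <;> simp
  le_antisymm a b := by cases a <;> cases b <;> simp

/-- The inclusion of the two end points into the shape `0 ← M → 1`. -/
def Two.toLeg : Two.{u} → Leg.{u}
  | .zero => .zero
  | .one => .one

/-- The shape of an `m`-cube of correspondences: the `m`-fold power of the shape `0 ← M → 1`. -/
def Position (m : ℕ) : Type u := Fin m → Leg.{u}

instance (m : ℕ) : PartialOrder (Position.{u} m) :=
  inferInstanceAs (PartialOrder (Fin m → Leg.{u}))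

/-- `m`-cubes of correspondences in `D`, i.e. the `m`-cubes of the cubical set `Corr(D)`: for
`m = 0` these are the objects of `D`, for `m = 1` the spans `A ← E → B` in `D`. -/
abbrev CorrCube (D : Type*) [Category* D] (m : ℕ) :=
  Position.{u} m ⥤ D

/-- For a vertex `v`, the map from the `m`-cube to the shape of `m`-cubes of correspondences with
image the corner cube at `v`: the initial vertex of the cube goes to the center `(M, …, M)`, the
final vertex to `v`. -/
def cornerMap {m : ℕ} (v a : Vertex.{u} m) : Position.{u} m :=
  fun i ↦ match a i with
    | .zero => .mid
    | .one => (v i).toLeg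

lemma cornerMap_mono {m : ℕ} (v : Vertex.{u} m) : Monotone (cornerMap v) := by
  intro a b h i
  have hi := h i
  simp only [cornerMap]
  revert hi
  cases a i <;> cases b i <;> intro hi
  · exact Or.inl rfl
  · exact Or.inl rfl
  · rcases hi with hi | hi <;> cases hi
  · exact Or.inr rfl

/-- The corner cube at the vertex `v` of a cube of correspondences, generated by the faces
(between the center and the boundary) that contain the vertex `v`. -/
def CorrCube.corner {D : Type*} [Category* D] {m : ℕ} (G : CorrCube.{u} D m)
    (v : Vertex.{u} m) : Cube.{u} D m :=
  (cornerMap_mono v).functor ⋙ G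

/-- The alternating vertex `(1,0,1,0,…)`. -/
def altOne (m : ℕ) : Vertex.{u} m :=
  fun i ↦ if Even (i : ℕ) then .one else .zero

/-- The alternating vertex `(0,1,0,1,…)`. -/
def altZero (m : ℕ) : Vertex.{u} m :=
  fun i ↦ if Even (i : ℕ) then .zero else .one

/-- A cube of correspondences of spaces commutes if its corner cubes at the vertices
`(1,0,1,0,…)` and `(0,1,0,1,…)` are pullback cubes. -/
def CorrCube.Commutes {m : ℕ} (G : CorrCube.{u} SSet.{u} m) : Prop :=
  (G.corner (altOne m)).IsPullback ∧ (G.corner (altZero m)).IsPullback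

/-! ### The combinatorial and the geometric construction -/

/-- The category `Δ_+` of finite (possibly empty) totally ordered sets and monotone maps. -/
abbrev FinOrd := ObjectProperty.FullSubcategory (fun X : LinOrd.{0} ↦ Finite X)

/-- The totally ordered set `Hom(X, 0 → 1)`. -/
abbrev Aug (X : Type) [LinearOrder X] : Type u := X →o Two.{u}

/-- The augmentation of `X`: the standard simplex whose ordered set of vertices is
`Hom(X, 0 → 1)`. -/
def aug (X : Type) [LinearOrder X] : SSet.{u} := nerve (Aug.{u} X)

/-- The augmentation is contravariant in `X`. -/
def augMap {X Y : Type} [LinearOrder X] [LinearOrder Y] (f : X →o Y) :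
    aug.{u} Y ⟶ aug.{u} X :=
  nerveMap (Monotone.functor (f := fun φ : Aug.{u} Y ↦ φ.comp f) fun _ _ h x ↦ h (f x))

/-- The vertices of the image of the embedding of the augmentation of the fibre `X_y = f ⁻¹ {y}`
in the augmentation of `X`: maps `X_y ⟶ (0 → 1)` are extended to `X` by `0` below the fibre and
by `1` above it. -/
def fibreVertices {X Y : Type} [LinearOrder X] [LinearOrder Y] (f : X →o Y) (y : Y) :
    Set (Aug.{u} X) :=
  {φ | ∀ x, (f x < y → φ x = .zero) ∧ (y < f x → φ x = .one)}

/-- `H_comb(f)`: the simplicial subset of the augmentation of `X` generated by the embedded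
augmentations of all the fibres of `f : X ⟶ Y`. (For `X = ∅` it is all of `aug ∅ = Δ[0]`, also if
`Y = ∅` and there are no fibres.) -/
def Hcomb {X Y : Type} [LinearOrder X] [LinearOrder Y] (f : X →o Y) :
    (aug.{u} X).Subcomplex where
  obj k := {s : ComposableArrows (Aug.{u} X) k.unop.len |
    IsEmpty X ∨ ∃ y, ∀ i, s.obj i ∈ fibreVertices f y}
  map θ s hs := by
    rcases hs with hs | ⟨y, hy⟩
    · exact Or.inl hs
    · exact Or.inr ⟨y, fun i ↦ hy _⟩

/-- Functoriality of `H_comb`: a commutative square `f = t ∘ f' ∘ s` gives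
`H_comb(f') ⟶ H_comb(f)`. -/
def HcombMap {X Y X' Y' : Type} [LinearOrder X] [LinearOrder Y] [LinearOrder X'] [LinearOrder Y']
    (f : X →o Y) (f' : X' →o Y') (s : X →o X') (t : Y' →o Y)
    (h : ∀ x, f x = t (f' (s x))) :
    (Hcomb.{u} f').toSSet ⟶ (Hcomb.{u} f).toSSet :=
  SSet.Subcomplex.lift ((Hcomb.{u} f').ι ≫ augMap s) (by
    rintro k _ ⟨⟨σ, hσ⟩, -, rfl⟩
    rcases hσ with hX | ⟨y, hy⟩
    · exact Or.inl ⟨fun x ↦ hX.false (s x)⟩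
    · refine Or.inr ⟨t y, fun i x ↦ ⟨fun hx ↦ (hy i (s x)).1 ?_, fun hx ↦ (hy i (s x)).2 ?_⟩⟩
      · rw [h] at hx
        exact t.monotone.reflect_lt hx
      · rw [h] at hx
        exact t.monotone.reflect_lt hx)

/-- The source vertex of a position in the cube of correspondences: `0, M ↦ 0` and `1 ↦ 1`. -/
def Leg.src : Leg.{u} → Two.{u}
  | .mid => .zero
  | .zero => .zero
  | .one => .one

/-- The target vertex of a position in the cube of correspondences: `0 ↦ 0` and `M, 1 ↦ 1`. -/
def Leg.tgt : Leg.{u} → Two.{u}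
  | .mid => .one
  | .zero => .zero
  | .one => .one

/-- The source vertex of a position: each coordinate is replaced by its source. -/
def Position.src {m : ℕ} (p : Position.{u} m) : Vertex.{u} m := fun i ↦ (p i).src

/-- The target vertex of a position: each coordinate is replaced by its target. -/
def Position.tgt {m : ℕ} (p : Position.{u} m) : Vertex.{u} m := fun i ↦ (p i).tgt

lemma Position.src_le_tgt {m : ℕ} (p : Position.{u} m) : p.src ≤ p.tgt := by
  intro i
  change (p i).src ≤ (p i).tgt
  cases p i
  · exact Or.inl rfl
  · exact le_rfl
  · exact le_rfl

lemma Position.src_mono {m : ℕ} {p q : Position.{u} m} (h : p ≤ q) : p.src ≤ q.src := by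
  intro i
  change (p i).src ≤ (q i).src
  rcases h i with h | h
  · rw [h]
    exact Or.inl rfl
  · rw [h]

lemma Position.tgt_anti {m : ℕ} {p q : Position.{u} m} (h : p ≤ q) : q.tgt ≤ p.tgt := by
  intro i
  change (q i).tgt ≤ (p i).tgt
  rcases h i with h | h
  · rw [h]
    exact Or.inr rfl
  · rw [h]

/-- The monotone map underlying the arrow `c(a) ⟶ c(b)` of a cube `c` in `Δ_+`. -/
def arrow {m : ℕ} (c : Cube.{u} FinOrd m) {a b : Vertex.{u} m} (h : a ≤ b) :
    (c.obj a).obj →o (c.obj b).obj :=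
  (c.map (homOfLE h)).hom.hom

lemma arrow_comp {m : ℕ} (c : Cube.{u} FinOrd m) {a b d : Vertex.{u} m} (h : a ≤ b) (h' : b ≤ d)
    (x : (c.obj a).obj) : arrow c h' (arrow c h x) = arrow c (h.trans h') x := by
  have := c.map_comp (homOfLE h) (homOfLE h')
  exact (congrArg (fun g : c.obj a ⟶ c.obj d ↦ g.hom.hom x) this).symm

lemma arrow_refl {m : ℕ} (c : Cube.{u} FinOrd m) {a : Vertex.{u} m} (h : a ≤ a)
    (x : (c.obj a).obj) : arrow c h x = x :=
  congrArg (fun g : c.obj a ⟶ c.obj a ↦ g.hom.hom x) (c.map_id a)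

lemma composableArrows_ext {A : Type u} [PartialOrder A] {k : ℕ} {s t : ComposableArrows A k}
    (h : ∀ i, s.obj i = t.obj i) : s = t :=
  CategoryTheory.Functor.ext h fun _ _ _ ↦ Subsingleton.elim _ _

/-- The functor `H_comb` on `m`-cubes: an `m`-cube `c` in `Δ_+` is sent to the `m`-cube of
correspondences in `SSetᵒᵖ` which at the position `p` is `H_comb` of the arrow
`c(p.src) ⟶ c(p.tgt)`. In particular, at a vertex `v` it is `H_comb` of the identity of `c(v)`,
and on an edge `f : X ⟶ Y` of `c` it is `H_comb(X) ⟶ H_comb(f) ⟵ H_comb(Y)`. -/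
def HcombCube {m : ℕ} (c : Cube.{u} FinOrd m) : CorrCube.{u} SSet.{u}ᵒᵖ m where
  obj p := op (Hcomb.{u} (arrow c p.src_le_tgt)).toSSet
  map {p q} h := Quiver.Hom.op (HcombMap (arrow c p.src_le_tgt) (arrow c q.src_le_tgt)
    (arrow c (Position.src_mono (leOfHom h))) (arrow c (Position.tgt_anti (leOfHom h)))
    (fun x ↦ by rw [arrow_comp, arrow_comp]))
  map_id p := by
    apply Quiver.Hom.unop_inj
    ext k s
    refine Subtype.ext (composableArrows_ext fun i ↦ OrderHom.ext _ _ (funext fun x ↦ ?_))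
    exact congrArg (s.1.obj i) (arrow_refl c _ x)
  map_comp {p q r} h h' := by
    apply Quiver.Hom.unop_inj
    ext k s
    refine Subtype.ext (composableArrows_ext fun i ↦ OrderHom.ext _ _ (funext fun x ↦ ?_))
    exact congrArg (s.1.obj i) (arrow_comp c _ _ x).symm

/-- The functor `H_geo : Δ_+ ⟶ Corr(Spaces)` on `m`-cubes: `H_comb` followed by `S^ext`. -/
def HgeoCube (S : SimplexCategoryᵒᵖ ⥤ SSet.{u}) {m : ℕ} (c : Cube.{u} FinOrd m) :
    CorrCube.{u} SSet.{u} m :=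
  HcombCube c ⋙ Sext S

/-! ### The higher associativity cubes -/

/-- The elements of `{0, …, m}` that are the smallest element of their block, when for all `i`
with `a i = 1` the neighbours `i` and `i + 1` are put into the same block. -/
def IsBlockStart {m : ℕ} (a : Vertex.{u} m) (x : Fin (m + 1)) : Prop :=
  ∀ i : Fin m, x = i.succ → a i = .zero

open Classical in
/-- The smallest element of the block containing `x`. -/
noncomputable def blockStart {m : ℕ} (a : Vertex.{u} m) (x : Fin (m + 1)) : Fin (m + 1) :=
  (Finset.univ.filter fun y ↦ IsBlockStart a y ∧ y ≤ x).max' ⟨0, by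
    refine Finset.mem_filter.2 ⟨Finset.mem_univ 0, fun i hi ↦ ?_, Fin.zero_le x⟩
    exact absurd hi.symm (Fin.succ_ne_zero i)⟩

lemma blockStart_spec {m : ℕ} (a : Vertex.{u} m) (x : Fin (m + 1)) :
    IsBlockStart a (blockStart a x) ∧ blockStart a x ≤ x := by
  classical
  exact (Finset.mem_filter.1 (Finset.max'_mem
    (Finset.univ.filter fun y ↦ IsBlockStart a y ∧ y ≤ x) _)).2

lemma le_blockStart {m : ℕ} (a : Vertex.{u} m) {x y : Fin (m + 1)} (hy : IsBlockStart a y)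
    (h : y ≤ x) : y ≤ blockStart a x := by
  classical
  exact Finset.le_max' (Finset.univ.filter fun y ↦ IsBlockStart a y ∧ y ≤ x) y
    (Finset.mem_filter.2 ⟨Finset.mem_univ y, hy, h⟩)

lemma IsBlockStart.anti {m : ℕ} {a b : Vertex.{u} m} (h : a ≤ b) {x : Fin (m + 1)}
    (hx : IsBlockStart b x) : IsBlockStart a x := by
  intro i hi
  rcases h i with h | h
  · exact h
  · rw [hx i hi] at h
    cases h

lemma blockStart_mono {m : ℕ} (a : Vertex.{u} m) : Monotone (blockStart a) := fun x _ h ↦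
  le_blockStart a (blockStart_spec a x).1 ((blockStart_spec a x).2.trans h)

lemma blockStart_eq {m : ℕ} (a : Vertex.{u} m) {x : Fin (m + 1)} (hx : IsBlockStart a x) :
    blockStart a x = x :=
  le_antisymm (blockStart_spec a x).2 (le_blockStart a hx le_rfl)

lemma blockStart_blockStart {m : ℕ} {a b : Vertex.{u} m} (h : a ≤ b) (x : Fin (m + 1)) :
    blockStart b (blockStart a x) = blockStart b x :=
  le_antisymm (blockStart_mono b (blockStart_spec a x).2)
    (le_blockStart b (blockStart_spec b x).1
      (le_blockStart a ((blockStart_spec b x).1.anti h) (blockStart_spec b x).2))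

/-- The map of ordered sets of blocks (represented by their smallest elements) which sends a block
to the block containing it. -/
noncomputable def blockMap {m : ℕ} (a b : Vertex.{u} m) :
    {x : Fin (m + 1) // IsBlockStart a x} →o {x : Fin (m + 1) // IsBlockStart b x} where
  toFun x := ⟨blockStart b x.1, (blockStart_spec b x.1).1⟩
  monotone' _ _ h := blockStart_mono b h

lemma blockMap_self {m : ℕ} (a : Vertex.{u} m) : blockMap a a = OrderHom.id :=
  OrderHom.ext _ _ (funext fun x ↦ Subtype.ext (blockStart_eq a x.2))

lemma blockMap_comp {m : ℕ} {a b d : Vertex.{u} m} (h : b ≤ d) :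
    blockMap a d = (blockMap b d).comp (blockMap a b) :=
  OrderHom.ext _ _ (funext fun x ↦ Subtype.ext (blockStart_blockStart h x.1).symm)

/-- The `(m+1)`-associativity cube, an `m`-cube in `Δ_+`. Its initial vertex is the ordered set
`{0, …, m}` with `m + 1` elements, the step in the `i`-th direction is the surjection that merges
the neighbours `i` and `i + 1`, and its final vertex has one element. The vertex `a` is the ordered
set of blocks, each represented by its smallest element. -/
noncomputable def assocCube (m : ℕ) : Cube.{u} FinOrd m where
  obj a := ⟨LinOrd.of {x : Fin (m + 1) // IsBlockStart a x},
    inferInstanceAs (Finite {x : Fin (m + 1) // IsBlockStart a x})⟩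
  map {a b} _ := ObjectProperty.homMk (LinOrd.ofHom (blockMap a b))
  map_id a := by
    rw [blockMap_self]
    rfl
  map_comp {a b d} _ h := by
    rw [blockMap_comp (leOfHom h)]
    rfl

end HigherHall

universe w

namespace HigherHall
-- Homotopies, homotopy equivalences and trivial fibrations of Kan complexes.
section Homotopy

open SSet modelCategoryQuillen HomotopicalAlgebra Simplicial CartesianMonoidalCategory
  MonoidalClosed

variable {X Y Z E B : SSet.{u}}

/-! Call an inclusion `K ≤ L` of simplicial subsets local (`Loc`) if restriction from `Sext L` to
`Sext K` is a homotopy equivalence. Both sides of the theorem become locality statements about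
subcomplexes of `Δ[n]`, and these are compared by induction on the number of vertices.

The calculus of local inclusions rests on two facts. Restriction maps of `Sext` are Kan fibrations,
because a family defined on a subcategory extends over the whole index category (`relNerveMap_rlp`,
`fibration_holimPre`). And `Sext` turns unions into strict limits, because a chain of simplices of a
union lies in one piece (`exists_Sext_glue`). Hence local inclusions satisfy excision (`Loc.sup`),
and inclusion-exclusion lets locality be checked on the pieces of a cover closed under intersection
(`loc_inf_of_cover`). The same fibrancy makes the strict limit over a finite poset of subcomplexes a
homotopy limit (`isHomotopyEquiv_toHolim_SextCone`), so a cube of such values is a pullback cube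
exactly when the union of the non-initial pieces is local in the initial one.

On the Segal side, diagonals can be inserted one at a time, so 2-Segal means that cutting along any
single diagonal is local (`isTwoSegal_iff`).

On the cube side, the corner cubes of the associativity cube are identified with cubes of
subcomplexes of `Δ[n]`. A direction of the corner asks that a set of vertices omit one particular
vertex, or that it lie on one side of one. For the alternating corners the union over all directions
is the union of the faces that omit some vertex of a fixed parity (`missing`), one parity for each
corner (`commutes_assocCube_iff`).

The two meet in `allDiagonalsLoc_iff`. Assuming the diagonal condition for all smaller polygons, the
condition for one diagonal passes to every diagonal not crossing it, and the two `missing` complexes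
are equivalent to the diagonals `(1, 3)` and `(0, 2)`. Every other diagonal is reached from `(0, 2)`
through non-crossing ones. -/

lemma whiskerLeft_δ_zero (X : SSet.{u}) :
    X ◁ stdSimplex.δ (0 : Fin 2) = fst X _ ≫ ι₁ := by
  refine CartesianMonoidalCategory.hom_ext _ _ (by simp) ?_
  rw [whiskerLeft_snd, Category.assoc, ι₁_snd]
  ext k ⟨x, y⟩
  apply stdSimplex.objEquiv.injective
  ext i
  have h : ∀ z : Fin 1, (0 : Fin 2).succAbove z = 1 := by decide
  exact congrArg Fin.val (h _)

lemma whiskerLeft_δ_one (X : SSet.{u}) :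
    X ◁ stdSimplex.δ (1 : Fin 2) = fst X _ ≫ ι₀ := by
  refine CartesianMonoidalCategory.hom_ext _ _ (by simp) ?_
  rw [whiskerLeft_snd, Category.assoc, ι₀_snd]
  ext k ⟨x, y⟩
  apply stdSimplex.objEquiv.injective
  ext i
  have h : ∀ z : Fin 1, (1 : Fin 2).succAbove z = 0 := by decide
  exact congrArg Fin.val (h _)

/-- The edge from vertex `0` to vertex `1` of a fibrewise filler of a horn with missing face `2`. -/
lemma exists_homotopy_of_horn (p : E ⟶ B) [Fibration p] (h₀₂ h₁₂ : X ⊗ Δ[1] ⟶ E)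
    (h : ι₁ ≫ h₀₂ = ι₁ ≫ h₁₂) (hp : h₀₂ ≫ p = h₁₂ ≫ p) :
    ∃ h₀₁ : X ⊗ Δ[1] ⟶ E, ι₀ ≫ h₀₁ = ι₀ ≫ h₀₂ ∧ ι₁ ≫ h₀₁ = ι₀ ≫ h₁₂ ∧
      h₀₁ ≫ p = fst _ _ ≫ ι₀ ≫ h₀₂ ≫ p := by
  let f : ∀ (j : Fin 3) (_ : j ≠ 2), Δ[1] ⟶ (ihom X).obj E :=
    fun j _ ↦ if j = 0 then curry h₁₂ else curry h₀₂
  have hf : horn.IsCompatible f := by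
    rw [horn.isCompatible_iff]
    intro j k hj hk hjk
    obtain rfl : j = 0 := by grind
    obtain rfl : k = 1 := by grind
    change stdSimplex.δ 0 ≫ curry h₁₂ = stdSimplex.δ 0 ≫ curry h₀₂
    rw [← curry_natural_left, ← curry_natural_left, whiskerLeft_δ_zero,
      Category.assoc, Category.assoc, h]
  -- The triangle in the base is degenerate along `σ 0`, so its edge from 0 to 1 is constant: the
  -- homotopy obtained is vertical over `B`.
  obtain ⟨φ, hφ, hφp⟩ := hf.exists_lift ((ihom X).map p)
    (stdSimplex.σ 0 ≫ curry (h₀₂ ≫ p)) (by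
      intro j hj
      have : j = 0 ∨ j = 1 := by grind
      rcases this with rfl | rfl
      · change curry h₁₂ ≫ _ = _
        rw [← Category.assoc]
        erw [stdSimplex.δ_comp_σ_self (i := (0 : Fin 2))]
        rw [Category.id_comp, ← curry_natural_right, hp]
      · change curry h₀₂ ≫ _ = _
        rw [← Category.assoc]
        erw [stdSimplex.δ_comp_σ_succ (i := (0 : Fin 2))]
        rw [Category.id_comp, ← curry_natural_right])
  have h1 : stdSimplex.δ 1 ≫ φ = curry h₀₂ := hφ 1 (by decide)
  have h0 : stdSimplex.δ 0 ≫ φ = curry h₁₂ := hφ 0 (by decide)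
  have key : ∀ (a b : X ⟶ E), fst X Δ[0] ≫ a = fst X Δ[0] ≫ b → a = b := by
    intro a b hab
    have := congrArg (fun g ↦ lift (𝟙 X) (SSet.const (stdSimplex.obj₀Equiv.symm 0)) ≫ g) hab
    simpa using this
  have e1 : X ◁ stdSimplex.δ 1 ≫ uncurry φ = h₀₂ := by
    rw [← uncurry_natural_left, h1, uncurry_curry]
  have e0 : X ◁ stdSimplex.δ 0 ≫ uncurry φ = h₁₂ := by
    rw [← uncurry_natural_left, h0, uncurry_curry]
  let d : Fin 3 → ((Δ[1] : SSet.{u}) ⟶ Δ[2]) := fun i ↦ stdSimplex.δ i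
  let e : Fin 2 → ((Δ[0] : SSet.{u}) ⟶ Δ[1]) := fun i ↦ stdSimplex.δ i
  have hA : X ◁ e 1 ≫ X ◁ d 2 = X ◁ e 1 ≫ X ◁ d 1 := by
    rw [← whiskerLeft_comp, ← whiskerLeft_comp]
    exact congrArg (X ◁ ·) (stdSimplex.δ_comp_δ (i := (1 : Fin 2)) (j := 1) le_rfl)
  have hB : X ◁ e 0 ≫ X ◁ d 2 = X ◁ e 1 ≫ X ◁ d 0 := by
    rw [← whiskerLeft_comp, ← whiskerLeft_comp]
    exact congrArg (X ◁ ·) (stdSimplex.δ_comp_δ (i := (0 : Fin 2)) (j := 1) (by decide))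
  have hC : d 2 ≫ stdSimplex.σ 0 = stdSimplex.σ 0 ≫ e 1 :=
    stdSimplex.δ_comp_σ_of_gt (i := (1 : Fin 2)) (j := 0) (by decide)
  have he1 : X ◁ e 1 = fst X _ ≫ ι₀ := whiskerLeft_δ_one X
  have he0 : X ◁ e 0 = fst X _ ≫ ι₁ := whiskerLeft_δ_zero X
  refine ⟨X ◁ d 2 ≫ uncurry φ, key _ _ ?_, key _ _ ?_, ?_⟩
  · rw [← Category.assoc, ← Category.assoc, ← he1, ← Category.assoc, hA, Category.assoc]
    exact (congrArg (X ◁ e 1 ≫ ·) e1).trans (by rw [he1])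
  · rw [← Category.assoc, ← Category.assoc, ← he0, ← Category.assoc, hB, Category.assoc]
    exact (congrArg (X ◁ e 1 ≫ ·) e0).trans (by rw [he1])
  · rw [Category.assoc, ← uncurry_natural_right, hφp]
    change X ◁ d 2 ≫ uncurry ((stdSimplex.σ 0 : Δ[2] ⟶ Δ[1]) ≫ curry (h₀₂ ≫ p)) = _
    rw [← uncurry_natural_left, ← Category.assoc, hC, Category.assoc, uncurry_natural_left,
      uncurry_natural_left, uncurry_curry, he1]
    simp

/-- The homotopy relation between maps of simplicial sets. -/
def Homotopic (f g : X ⟶ Y) : Prop := ∃ h : X ⊗ Δ[1] ⟶ Y, ι₀ ≫ h = f ∧ ι₁ ≫ h = g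

lemma nonempty_homotopy_iff {f g : X ⟶ Y} : Nonempty (SSet.Homotopy f g) ↔ Homotopic f g :=
  ⟨fun ⟨H⟩ ↦ ⟨H.h, H.h₀, H.h₁⟩, fun ⟨h, h₀, h₁⟩ ↦ ⟨{
    h := h
    h₀ := h₀
    h₁ := h₁
    rel := by
      ext k ⟨⟨x, hx⟩, -⟩
      exact hx.elim }⟩⟩

lemma isHomotopyEquiv_iff {f : X ⟶ Y} :
    IsHomotopyEquiv f ↔ ∃ g : Y ⟶ X, Homotopic (f ≫ g) (𝟙 X) ∧ Homotopic (g ≫ f) (𝟙 Y) := by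
  simp only [IsHomotopyEquiv, nonempty_homotopy_iff]

namespace Homotopic

lemma refl (f : X ⟶ Y) : Homotopic f f := ⟨fst _ _ ≫ f, by simp, by simp⟩

lemma of_eq {f g : X ⟶ Y} (h : f = g) : Homotopic f g := h ▸ refl f

lemma postcomp {f g : X ⟶ Y} (h : Homotopic f g) (k : Y ⟶ Z) : Homotopic (f ≫ k) (g ≫ k) := by
  obtain ⟨H, rfl, rfl⟩ := h
  exact ⟨H ≫ k, by simp, by simp⟩

lemma precomp {f g : Y ⟶ Z} (h : Homotopic f g) (k : X ⟶ Y) : Homotopic (k ≫ f) (k ≫ g) := by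
  obtain ⟨H, rfl, rfl⟩ := h
  exact ⟨k ▷ _ ≫ H, by rw [ι₀_comp_assoc], by rw [ι₁_comp_assoc]⟩

lemma trans_symm [KanComplex Y] {f g k : X ⟶ Y} (h : Homotopic f g) (h' : Homotopic k g) :
    Homotopic f k := by
  obtain ⟨H, h₀, h₁⟩ := h
  obtain ⟨H', h'₀, h'₁⟩ := h'
  obtain ⟨K, k₀, k₁, -⟩ := exists_homotopy_of_horn (Limits.terminal.from Y) H H'
    (h₁.trans h'₁.symm) (by subsingleton)
  exact ⟨K, k₀.trans h₀, k₁.trans h'₀⟩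

lemma symm [KanComplex Y] {f g : X ⟶ Y} (h : Homotopic f g) : Homotopic g f :=
  trans_symm (refl g) h

lemma trans [KanComplex Y] {f g k : X ⟶ Y} (h : Homotopic f g) (h' : Homotopic g k) :
    Homotopic f k :=
  h.trans_symm h'.symm

end Homotopic

namespace IsHomotopyEquiv

lemma of_isIso (f : X ⟶ Y) [IsIso f] : IsHomotopyEquiv f :=
  isHomotopyEquiv_iff.2 ⟨inv f, .of_eq (by simp), .of_eq (by simp)⟩

lemma comp [KanComplex X] [KanComplex Z] {f : X ⟶ Y} {g : Y ⟶ Z} (hf : IsHomotopyEquiv f)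
    (hg : IsHomotopyEquiv g) : IsHomotopyEquiv (f ≫ g) := by
  rw [isHomotopyEquiv_iff] at *
  obtain ⟨f', h₁, h₂⟩ := hf
  obtain ⟨g', k₁, k₂⟩ := hg
  refine ⟨g' ≫ f', .trans ?_ h₁, .trans ?_ k₂⟩
  · simpa using (k₁.postcomp f').precomp f
  · simpa using (h₂.postcomp g).precomp g'

/-- A map with a left and a right homotopy inverse. -/
lemma of_inverses [KanComplex X] [KanComplex Y] {f : X ⟶ Y} {g g' : Y ⟶ X}
    (h : Homotopic (f ≫ g) (𝟙 X)) (h' : Homotopic (g' ≫ f) (𝟙 Y)) : IsHomotopyEquiv f := by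
  rw [isHomotopyEquiv_iff]
  refine ⟨g, h, .trans ?_ h'⟩
  refine .trans (g := g' ≫ f ≫ g ≫ f) ?_ ?_
  · simpa using (h'.precomp (𝟙 _)).symm.postcomp (g ≫ f)
  · simpa using (h.postcomp f).precomp g'

lemma of_comp_left [KanComplex X] [KanComplex Y] [KanComplex Z] {f : X ⟶ Y} {g : Y ⟶ Z}
    (hf : IsHomotopyEquiv f) (hfg : IsHomotopyEquiv (f ≫ g)) : IsHomotopyEquiv g := by
  rw [isHomotopyEquiv_iff] at hf hfg
  obtain ⟨f', h₁, h₂⟩ := hf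
  obtain ⟨k, k₁, k₂⟩ := hfg
  refine of_inverses (g := k ≫ f) (g' := k ≫ f) ?_ (by simpa using k₂)
  refine .trans (g := f' ≫ f ≫ g ≫ k ≫ f) ?_ (.trans ?_ h₂)
  · simpa using h₂.symm.postcomp (g ≫ k ≫ f)
  · simpa using (k₁.postcomp f).precomp f'

lemma of_comp_right [KanComplex X] [KanComplex Y] [KanComplex Z] {f : X ⟶ Y} {g : Y ⟶ Z}
    (hg : IsHomotopyEquiv g) (hfg : IsHomotopyEquiv (f ≫ g)) : IsHomotopyEquiv f := by
  rw [isHomotopyEquiv_iff] at hg hfg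
  obtain ⟨g', h₁, h₂⟩ := hg
  obtain ⟨k, k₁, k₂⟩ := hfg
  refine of_inverses (g := g ≫ k) (g' := g ≫ k) (by simpa using k₁) ?_
  refine .trans (g := g ≫ k ≫ f ≫ g ≫ g') ?_ (.trans ?_ h₁)
  · simpa using (h₁.symm.precomp (g ≫ k ≫ f))
  · simpa using (k₂.postcomp g').precomp g

lemma comp_iff_right [KanComplex X] [KanComplex Y] [KanComplex Z] {f : X ⟶ Y} {g : Y ⟶ Z}
    (hf : IsHomotopyEquiv f) : IsHomotopyEquiv (f ≫ g) ↔ IsHomotopyEquiv g :=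
  ⟨hf.of_comp_left, hf.comp⟩

lemma comp_iff_left [KanComplex X] [KanComplex Y] [KanComplex Z] {f : X ⟶ Y} {g : Y ⟶ Z}
    (hg : IsHomotopyEquiv g) : IsHomotopyEquiv (f ≫ g) ↔ IsHomotopyEquiv f :=
  ⟨hg.of_comp_right, fun hf ↦ hf.comp hg⟩

end IsHomotopyEquiv

/-- Extension along the pushout product of a monomorphism and an anodyne extension, against a
fibration. -/
lemma exists_extension {A X B' Y E M : SSet.{u}} (i : A ⟶ X) [Mono i] {j : B' ⟶ Y}
    (hj : anodyneExtensions j) (p : E ⟶ M) [hp : Fibration p] (f : X ⊗ B' ⟶ E) (g : A ⊗ Y ⟶ E)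
    (h : X ⊗ Y ⟶ M) (hfg : i ▷ B' ≫ f = A ◁ j ≫ g) (hf : f ≫ p = X ◁ j ≫ h)
    (hg : g ≫ p = i ▷ Y ≫ h) :
    ∃ l : X ⊗ Y ⟶ E, X ◁ j ≫ l = f ∧ i ▷ Y ≫ l = g ∧ l ≫ p = h := by
  let sq := Functor.PushoutObjObj.ofHasPushout (curriedTensor SSet.{u}) i j
  have := anodyneExtensions_pushoutObjObjι sq hj p ((HomotopicalAlgebra.fibration_iff p).1 hp)
  have w : sq.isPushout.desc f g hfg ≫ p = sq.ι ≫ h := by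
    apply sq.isPushout.hom_ext
    · simpa using hf
    · simpa using hg
  have sq' : CommSq (sq.isPushout.desc f g hfg) sq.ι p h := ⟨w⟩
  refine ⟨sq'.lift, ?_, ?_, sq'.fac_right⟩
  · have h₁ : sq.inl ≫ sq.ι ≫ sq'.lift = sq.inl ≫ sq.isPushout.desc f g hfg := by
      rw [sq'.fac_left]
    rwa [sq.isPushout.inl_desc, ← Category.assoc, sq.inl_ι] at h₁
  · have h₁ : sq.inr ≫ sq.ι ≫ sq'.lift = sq.inr ≫ sq.isPushout.desc f g hfg := by
      rw [sq'.fac_left]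
    rwa [sq.isPushout.inr_desc, ← Category.assoc, sq.inr_ι] at h₁

/-- The inclusion of a vertex of `Δ[1]` is the inclusion of a one-dimensional horn, whose
compatibility condition is empty. -/
lemma anodyneExtensions_δ (j : Fin 2) : anodyneExtensions (stdSimplex.{u}.δ j) := by
  intro E B p hp
  rw [← HomotopicalAlgebra.fibration_iff] at hp
  refine ⟨fun {t b} sq ↦ ?_⟩
  obtain ⟨i, hi⟩ : ∃ i : Fin 2, j ≠ i := ⟨j + 1, by fin_cases j <;> decide⟩
  have hc : horn.IsCompatible (n := 0) (i := i) (fun _ _ ↦ t) := by simp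
  obtain ⟨φ, hφ, hφp⟩ := hc.exists_lift p b (fun k hk ↦ by
    obtain rfl : k = j := by grind
    exact sq.w)
  exact ⟨⟨{ l := φ, fac_left := hφ j hi, fac_right := hφp }⟩⟩

lemma exists_homotopy_lift_one {A : SSet.{u}} (i : A ⟶ X) [Mono i] (p : E ⟶ B) [Fibration p]
    (f : X ⟶ E) (g : A ⊗ Δ[1] ⟶ E) (h : X ⊗ Δ[1] ⟶ B) (hfg : i ≫ f = ι₁ ≫ g)
    (hf : f ≫ p = ι₁ ≫ h) (hg : g ≫ p = i ▷ _ ≫ h) :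
    ∃ l : X ⊗ Δ[1] ⟶ E, ι₁ ≫ l = f ∧ i ▷ _ ≫ l = g ∧ l ≫ p = h := by
  obtain ⟨l, hl, hl', hlp⟩ := exists_extension i (anodyneExtensions_δ 0) p (fst _ _ ≫ f) g h
    (by rw [whiskerRight_fst_assoc, hfg]; erw [whiskerLeft_δ_zero]; simp)
    (by rw [Category.assoc, hf]; erw [whiskerLeft_δ_zero]; rw [Category.assoc]) hg
  refine ⟨l, ?_, hl', hlp⟩
  have h2 : (fst X Δ[0] ≫ ι₁) ≫ l = fst X Δ[0] ≫ f := by rw [← hl, ← whiskerLeft_δ_zero]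
  simpa using congrArg (fun k ↦ lift (𝟙 X) (SSet.const (stdSimplex.obj₀Equiv.symm 0)) ≫ k) h2

lemma exists_homotopy_lift_zero (p : E ⟶ B) [Fibration p]
    (f : X ⟶ E) (h : X ⊗ Δ[1] ⟶ B) (hf : f ≫ p = ι₀ ≫ h) :
    ∃ l : X ⊗ Δ[1] ⟶ E, ι₀ ≫ l = f ∧ l ≫ p = h := by
  have sq : CommSq (fst _ _ ≫ f) (X ◁ stdSimplex.δ 1) p h :=
    ⟨by rw [Category.assoc, hf]; erw [whiskerLeft_δ_one]; rw [Category.assoc]⟩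
  have := (anodyneExtensions_δ 1).whiskerLeft X p ((HomotopicalAlgebra.fibration_iff p).1 ‹_›)
  refine ⟨sq.lift, ?_, sq.fac_right⟩
  have h2 : (fst X Δ[0] ≫ ι₀) ≫ sq.lift = fst X Δ[0] ≫ f := by
    refine Eq.trans ?_ sq.fac_left
    rw [← whiskerLeft_δ_one]
  simpa using congrArg (fun k ↦ lift (𝟙 X) (SSet.const (stdSimplex.obj₀Equiv.symm 0)) ≫ k) h2

/-- A Kan fibration between Kan complexes which is a homotopy equivalence is a trivial
fibration. -/
lemma IsHomotopyEquiv.rlp_monomorphisms [KanComplex E] [KanComplex B] {p : E ⟶ B} [Fibration p]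
    (hp : IsHomotopyEquiv p) : (MorphismProperty.monomorphisms SSet.{u}).rlp p := by
  obtain ⟨g, h₁, L, hL₀, hL₁⟩ := isHomotopyEquiv_iff.1 hp
  -- Lifting the homotopy from `g ≫ p` to the identity replaces the homotopy inverse `g` by a strict
  -- section `s`.
  obtain ⟨L', hL'₀, hL'p⟩ := exists_homotopy_lift_zero p g L hL₀.symm
  have hs : (ι₁ ≫ L') ≫ p = 𝟙 B := by rw [Category.assoc, hL'p, hL₁]
  have hgs : Homotopic g (ι₁ ≫ L') := ⟨L', hL'₀, rfl⟩
  set s := ι₁ ≫ L'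
  obtain ⟨H, hH₀, hH₁⟩ : Homotopic (𝟙 E) (p ≫ s) := h₁.symm.trans (hgs.precomp p)
  -- `H` need not be vertical, but it has the same image in `B` as `H ≫ p ≫ s`; following the first
  -- and then the reverse of the second gives a vertical homotopy from the identity to `p ≫ s`.
  obtain ⟨K, hK₀, hK₁, hKp⟩ := exists_homotopy_of_horn p H (H ≫ p ≫ s)
    (by rw [← Category.assoc ι₁, hH₁, Category.assoc, ← Category.assoc s, hs, Category.id_comp])
    (by simp [hs])
  rw [hH₀] at hK₀
  rw [← Category.assoc, hH₀, Category.id_comp] at hK₁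
  rw [← Category.assoc ι₀, hH₀, Category.id_comp] at hKp
  intro A X i hi
  have : Mono i := hi
  refine ⟨fun {a b} sq ↦ ?_⟩
  -- The candidate `b ≫ s` agrees with `a` on `A` only up to the vertical homotopy `K`. Extending
  -- `K` over `X` from time 1, over the constant homotopy of `b`, and reading off time 0 gives the
  -- strict filler.
  obtain ⟨l, hl₁, hli, hlp⟩ := exists_homotopy_lift_one i p (b ≫ s) (a ▷ _ ≫ K) (fst _ _ ≫ b)
    (by rw [ι₁_comp_assoc, hK₁, ← Category.assoc, ← sq.w, Category.assoc])
    (by simp [hs])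
    (by rw [Category.assoc, hKp, whiskerRight_fst_assoc, whiskerRight_fst_assoc, sq.w])
  exact ⟨⟨{
    l := ι₀ ≫ l
    fac_left := by rw [← ι₀_comp_assoc, hli, ι₀_comp_assoc, hK₀, Category.comp_id]
    fac_right := by rw [Category.assoc, hlp, ← Category.assoc, ι₀_fst, Category.id_comp] }⟩⟩

/-- The subcomplex `X × ∂Δ[1]` of `X × Δ[1]`. -/
def cylinderEnds (X : SSet.{u}) : (X ⊗ Δ[1]).Subcomplex where
  obj _ := {x | (∀ i, stdSimplex.objEquiv x.2 i = 0) ∨ ∀ i, stdSimplex.objEquiv x.2 i = 1}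
  map _ _ hx := hx.imp (fun h _ ↦ h _) (fun h _ ↦ h _)

open Classical in
/-- The map on `X × ∂Δ[1]` given by a pair of maps. -/
noncomputable def cylinderEndsDesc (f g : X ⟶ Y) : (cylinderEnds X).toSSet ⟶ Y where
  app k := ↾fun x ↦ if stdSimplex.objEquiv x.1.2 0 = 0 then f.app k x.1.1 else g.app k x.1.1
  naturality k k' θ := by
    ext ⟨⟨x, ε⟩, h⟩
    change (if (stdSimplex.objEquiv ε) (θ.unop 0) = 0 then f.app k' (X.map θ x)
      else g.app k' (X.map θ x)) =
      Y.map θ (if (stdSimplex.objEquiv ε) 0 = 0 then f.app k x else g.app k x)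
    rcases h with h | h
    · rw [if_pos (h _), if_pos (h _)]
      exact NatTrans.naturality_apply f θ x
    · have : ∀ i, ¬ stdSimplex.objEquiv ε i = 0 := fun i ↦ by rw [show _ = _ from h i]; decide
      rw [if_neg (this _), if_neg (this _)]
      exact NatTrans.naturality_apply g θ x

/-- The homotopy is a lift of the constant homotopy in `B` along the inclusion of the two ends of
the cylinder. -/
lemma homotopic_of_rlp {p : E ⟶ B} (hp : (MorphismProperty.monomorphisms SSet.{u}).rlp p)
    {f g : X ⟶ E} (h : f ≫ p = g ≫ p) : Homotopic f g := by
  have sq : CommSq (cylinderEndsDesc f g) (cylinderEnds X).ι p (fst _ _ ≫ f ≫ p) := ⟨by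
    ext k ⟨⟨x, ε⟩, hx⟩
    change p.app k (if _ then f.app k x else g.app k x) = p.app k (f.app k x)
    split_ifs
    · rfl
    · exact (ConcreteCategory.congr_hom (congr_app h k) x).symm⟩
  have := hp (cylinderEnds X).ι (inferInstanceAs (Mono _))
  refine ⟨sq.lift, ?_, ?_⟩
  · have h0 := congrArg (Subcomplex.lift (B := cylinderEnds X) ι₀ (by
      rintro k _ ⟨x, rfl⟩; exact Or.inl fun i ↦ rfl) ≫ ·) sq.fac_left
    refine Eq.trans ?_ (h0.trans ?_)
    · rfl
    ext k x
    exact if_pos (e := g.app k x) (show (0 : Fin 2) = 0 from rfl)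
  · have h0 := congrArg (Subcomplex.lift (B := cylinderEnds X) ι₁ (by
      rintro k _ ⟨x, rfl⟩; exact Or.inr fun i ↦ rfl) ≫ ·) sq.fac_left
    refine Eq.trans ?_ (h0.trans ?_)
    · rfl
    ext k x
    exact if_neg (t := f.app k x) (show ¬ (1 : Fin 2) = 0 by decide)

lemma isHomotopyEquiv_of_rlp {p : E ⟶ B}
    (hp : (MorphismProperty.monomorphisms SSet.{u}).rlp p) : IsHomotopyEquiv p := by
  have sq : CommSq (Limits.initial.to E) (Limits.initial.to B) p (𝟙 B) := ⟨by subsingleton⟩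
  have := hp (Limits.initial.to B) (inferInstanceAs (Mono _))
  exact isHomotopyEquiv_iff.2 ⟨sq.lift, homotopic_of_rlp hp (by simp), .of_eq sq.fac_right⟩

end Homotopy
-- Maps into homotopy limits as families indexed by chains.
section Families

open SSet

/-- The restriction of a chain. -/
def restr {J : Type*} [Category* J] {k k' : SimplexCategoryᵒᵖ} (θ : k ⟶ k')
    (c : ComposableArrows J k.unop.len) : ComposableArrows J k'.unop.len :=
  (nerve J).map θ c

/-- The last arrow of the restriction of a chain. -/
def lastHom {J : Type*} [Category* J] {k k' : SimplexCategoryᵒᵖ} (θ : k ⟶ k')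
    (c : ComposableArrows J k.unop.len) :
    (restr θ c).obj (Fin.last _) ⟶ c.obj (Fin.last _) :=
  c.map (homOfLE (Fin.le_last _))

/-- A family of simplices of the values of `F`, indexed by the chains in `J` and the simplices of
`Y`. This is the same as a map from `Y` to the homotopy limit of `F`. -/
@[ext]
structure Fam {J : Type*} [Category* J] (F : J ⥤ SSet.{w}) (Y : SSet.{w}) where
  /-- the value at a chain and a simplex -/
  val (k : SimplexCategoryᵒᵖ) (c : ComposableArrows J k.unop.len) (y : Y.obj k) :
    (F.obj (c.obj (Fin.last _))).obj k
  compat {k k' : SimplexCategoryᵒᵖ} (θ : k ⟶ k') (c : ComposableArrows J k.unop.len)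
    (y : Y.obj k) : (F.obj (c.obj (Fin.last _))).map θ (val k c y) =
      (F.map (lastHom θ c)).app k' (val k' (restr θ c) (Y.map θ y))

namespace Fam

variable {I : Type*} [Category* I] {J : Type*} [Category* J] {F : J ⥤ SSet.{w}} {Y Z : SSet.{w}}

/-- Restriction of families along maps of simplicial sets. -/
@[simps]
def comp (t : Fam F Z) (f : Y ⟶ Z) : Fam F Y where
  val k c y := t.val k c (f.app k y)
  compat θ c y := by
    rw [t.compat, NatTrans.naturality_apply f θ y]

/-- Restriction of families along functors. -/
@[simps]
def pre (t : Fam F Y) (φ : I ⥤ J) : Fam (φ ⋙ F) Y where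
  val k c y := t.val k (c ⋙ φ) y
  compat θ c y := t.compat θ (c ⋙ φ) y

/-- The families given by cones. -/
@[simps]
def ofCone (c : (Functor.const J).obj Y ⟶ F) : Fam F Y where
  val k d y := (c.app (d.obj (Fin.last _))).app k y
  compat {k k'} θ d y := by
    have h := congr_app (c.naturality (lastHom θ d)) k'
    refine (NatTrans.naturality_apply (c.app (d.obj (Fin.last _))) θ y).symm.trans ?_
    exact ConcreteCategory.congr_hom h (Y.map θ y)

end Fam

lemma over_composableArrows_ext {J : Type u} [Category.{v} J] {j : J} {n : ℕ}
    {d d' : ComposableArrows (Over j) n} (h : d ⋙ Over.forget j = d' ⋙ Over.forget j)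
    (hobj : ∀ i, d.obj i = d'.obj i) : d = d' := by
  refine CategoryTheory.Functor.ext hobj fun i i' f ↦ ?_
  ext
  have := Functor.congr_hom h f
  simp only [Over.comp_left, Over.eqToHom_left]
  exact this

/-- A chain as a chain over its last object. -/
@[simps]
def chainOver {J : Type u} [Category.{v} J] {n : ℕ} (c : ComposableArrows J n) :
    ComposableArrows (Over (c.obj (Fin.last n))) n where
  obj i := Over.mk (c.map (homOfLE (Fin.le_last i)))
  map f := Over.homMk (c.map f) (by
    dsimp
    rw [← c.map_comp]
    rfl)

lemma restr_chainOver {J : Type u} [Category.{v} J] {k k' : SimplexCategoryᵒᵖ} (θ : k ⟶ k')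
    (c : ComposableArrows J k.unop.len) :
    restr θ (chainOver c) = chainOver (restr θ c) ⋙ Over.map (lastHom θ c) := by
  refine over_composableArrows_ext rfl fun i ↦ ?_
  refine congrArg Over.mk (?_ : c.map _ = c.map _ ≫ c.map _)
  rw [← c.map_comp]
  rfl

lemma chainOver_map_hom {J : Type u} [Category.{v} J] {j : J} {n : ℕ}
    (d : ComposableArrows (Over j) n) :
    chainOver (d ⋙ Over.forget j) ⋙ Over.map (d.obj (Fin.last _)).hom = d := by
  refine over_composableArrows_ext rfl fun i ↦ ?_
  exact congrArg (Over.mk (Y := (d.obj i).left)) (Over.w (d.map (homOfLE (Fin.le_last i))))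

variable {J : Type u} [Category.{v} J] {F : J ⥤ SSet.{max u v}} {Y Z : SSet.{max u v}}

/-- The component of a simplex of a homotopy limit. -/
def holimApp {k : SimplexCategoryᵒᵖ} (x : (holim F).obj k) (j : J) (l : SimplexCategoryᵒᵖ)
    (d : ComposableArrows (Over j) l.unop.len) (α : l.unop ⟶ k.unop) : (F.obj j).obj l :=
  (NatTrans.app (C := J) (F := weight J ⊗ (Functor.const J).obj (SSet.stdSimplex.obj k.unop))
    (G := F) x j).app l (d, SSet.stdSimplex.objEquiv.symm α)

lemma holimApp_map {k k' : SimplexCategoryᵒᵖ} (θ : k ⟶ k') (x : (holim F).obj k) (j : J)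
    (l : SimplexCategoryᵒᵖ) (d : ComposableArrows (Over j) l.unop.len) (α : l.unop ⟶ k'.unop) :
    holimApp ((holim F).map θ x) j l d α = holimApp x j l d (α ≫ θ.unop) := rfl

lemma holimApp_naturality_left {k : SimplexCategoryᵒᵖ} (x : (holim F).obj k) {j j' : J}
    (f : j ⟶ j') (l : SimplexCategoryᵒᵖ) (d : ComposableArrows (Over j) l.unop.len)
    (α : l.unop ⟶ k.unop) :
    (F.map f).app l (holimApp x j l d α) = holimApp x j' l (d ⋙ Over.map f) α := by
  have h := congr_app (NatTrans.naturality (C := J)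
    (F := weight J ⊗ (Functor.const J).obj (SSet.stdSimplex.obj k.unop)) (G := F) x f) l
  exact (ConcreteCategory.congr_hom h
    (show ((weight J).obj j).obj l × (SSet.stdSimplex.obj k.unop).obj l from
      (d, SSet.stdSimplex.objEquiv.symm α))).symm

lemma holimApp_naturality_right {k : SimplexCategoryᵒᵖ} (x : (holim F).obj k) (j : J)
    {l l' : SimplexCategoryᵒᵖ} (θ : l ⟶ l') (d : ComposableArrows (Over j) l.unop.len)
    (α : l.unop ⟶ k.unop) :
    (F.obj j).map θ (holimApp x j l d α) = holimApp x j l' (restr θ d) (θ.unop ≫ α) := by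
  have h := (NatTrans.app (C := J)
    (F := weight J ⊗ (Functor.const J).obj (SSet.stdSimplex.obj k.unop)) (G := F) x j).naturality θ
  exact (ConcreteCategory.congr_hom h
    (show ((weight J).obj j).obj l × (SSet.stdSimplex.obj k.unop).obj l from
      (d, SSet.stdSimplex.objEquiv.symm α))).symm

lemma holim_ext {k : SimplexCategoryᵒᵖ} {x y : (holim F).obj k}
    (h : ∀ j l d α, holimApp x j l d α = holimApp y j l d α) : x = y := by
  refine NatTrans.ext (C := J)
    (F := weight J ⊗ (Functor.const J).obj (SSet.stdSimplex.obj k.unop)) (G := F) ?_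
  funext j
  ext l ⟨d, α⟩
  exact h j l d (SSet.stdSimplex.objEquiv α)

/-- Constructor for simplices of homotopy limits. -/
def holimMk {k : SimplexCategoryᵒᵖ} (x : ∀ (j : J) (l : SimplexCategoryᵒᵖ)
    (_ : ComposableArrows (Over j) l.unop.len) (_ : l.unop ⟶ k.unop), (F.obj j).obj l)
    (h : ∀ j l l' (θ : l ⟶ l') d α, (F.obj j).map θ (x j l d α) =
      x j l' (restr θ d) (θ.unop ≫ α))
    (h' : ∀ j j' (f : j ⟶ j') l d α, (F.map f).app l (x j l d α) =
      x j' l (d ⋙ Over.map f) α) : (holim F).obj k :=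
  show weight J ⊗ (Functor.const J).obj (SSet.stdSimplex.obj k.unop) ⟶ F from
  { app j := {
      app l := ↾fun d ↦ x j l d.1 (SSet.stdSimplex.objEquiv d.2)
      naturality l l' θ := by
        ext d
        exact (h j l l' θ d.1 (SSet.stdSimplex.objEquiv d.2)).symm }
    naturality j j' f := by
      ext l d
      exact (h' j j' f l d.1 (SSet.stdSimplex.objEquiv d.2)).symm }

namespace Fam

/-- The family given by a map to the homotopy limit. -/
def ofHom (f : Y ⟶ holim F) : Fam F Y where
  val k c y := holimApp (f.app k y) (c.obj (Fin.last _)) k (chainOver c) (𝟙 _)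
  compat {k k'} θ c y := by
    rw [holimApp_naturality_left, holimApp_naturality_right, NatTrans.naturality_apply,
      holimApp_map, Category.comp_id, Category.id_comp, restr_chainOver]

/-- Every chain over `j` is its underlying chain, taken over its own last object and pushed forward
along the structure map of that object. So the values on such universal chains determine all the
others, which is why `Fam` carries the whole map. -/
lemma holimApp_eq (f : Y ⟶ holim F) {k l : SimplexCategoryᵒᵖ} (y : Y.obj k) (j : J)
    (d : ComposableArrows (Over j) l.unop.len) (α : l.unop ⟶ k.unop) :
    holimApp (f.app k y) j l d α =
      (F.map (d.obj (Fin.last _)).hom).app l ((ofHom f).val l (d ⋙ Over.forget j)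
        (Y.map α.op y)) := by
  have h := holimApp_naturality_left (f.app l (Y.map α.op y)) (d.obj (Fin.last _)).hom l
    (chainOver (d ⋙ Over.forget j)) (𝟙 _)
  replace h := h.trans (congrArg (fun e ↦ holimApp _ j l e (𝟙 _)) (chainOver_map_hom d))
  refine Eq.trans ?_ h.symm
  have := NatTrans.naturality_apply f α.op y
  refine Eq.trans ?_ (congrArg (fun x ↦ holimApp x j l d (𝟙 _)) this.symm)
  rw [holimApp_map, Category.id_comp]
  rfl

lemma ofHom_injective {f g : Y ⟶ holim F} (h : ofHom f = ofHom g) : f = g := by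
  ext k y
  refine holim_ext fun j l d α ↦ ?_
  refine (holimApp_eq f y j d α).trans (Eq.trans ?_ (holimApp_eq g y j d α).symm)
  rw [h]

/-- The map to the homotopy limit given by a family. -/
def toHom (t : Fam F Y) : Y ⟶ holim F where
  app k := ↾fun y ↦ holimMk (fun j l d α ↦ (F.map (d.obj (Fin.last _)).hom).app l
      (t.val l (d ⋙ Over.forget j) (Y.map α.op y)))
    (fun j l l' θ d α ↦ by
      have h := t.compat θ (d ⋙ Over.forget j) (Y.map α.op y)
      refine (NatTrans.naturality_apply (F.map (d.obj (Fin.last _)).hom) θ _).symm.trans ?_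
      refine (congrArg ((F.map (d.obj (Fin.last _)).hom).app l') h).trans ?_
      have h₂ := Over.w (d.map (homOfLE (Fin.le_last (θ.unop.toOrderHom (Fin.last _)))))
      have h₃ := congr_app ((F.map_comp _ _).symm.trans (congrArg F.map h₂)) l'
      refine (ConcreteCategory.congr_hom h₃ _).trans ?_
      rw [← Functor.map_comp_apply]
      rfl)
    (fun j j' f l d α ↦ by
      have h₃ := congr_app (F.map_comp (d.obj (Fin.last _)).hom f).symm l
      exact ConcreteCategory.congr_hom h₃ _)
  naturality k k' θ := by
    ext y
    refine holim_ext fun j l d α ↦ ?_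
    refine congrArg (fun z ↦ (F.map (d.obj (Fin.last _)).hom).app l
      (t.val l (d ⋙ Over.forget j) z)) ?_
    exact (Functor.map_comp_apply Y θ α.op y).symm

lemma ofHom_toHom (t : Fam F Y) : ofHom t.toHom = t := by
  ext k c y
  have h : (Over.mk (c.map (homOfLE (Fin.le_last (Fin.last k.unop.len))))).hom = 𝟙 _ := c.map_id _
  refine (ConcreteCategory.congr_hom (congr_app (congrArg F.map h) k) _).trans ?_
  refine (ConcreteCategory.congr_hom (congr_app (F.map_id _) k) _).trans ?_
  exact congrArg (t.val k c) (Functor.map_id_apply Y _ y)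

lemma ofHom_comp (f : Y ⟶ Z) (g : Z ⟶ holim F) : ofHom (f ≫ g) = (ofHom g).comp f := rfl

lemma ofHom_toHolim (c : (Functor.const J).obj Y ⟶ F) : ofHom (toHolim c) = ofCone c := by
  ext k d y
  change (c.app _).app k ((SSet.yonedaEquiv.symm y).app k _) = _
  refine congrArg ((c.app (d.obj (Fin.last _))).app k) ?_
  exact SSet.yonedaEquiv.apply_symm_apply y

lemma ofHom_holimPre {I : Type u} [Category.{v} I] (φ : I ⥤ J) (f : Y ⟶ holim F) :
    ofHom (f ≫ holimPre φ F) = (ofHom f).pre φ := by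
  ext k d y
  rfl

end Fam

end Families
-- The relative nerve, whose sections over the nerve are families.
section RelativeNerve

open SSet Simplicial modelCategoryQuillen

variable {J : Type u} [Category.{v} J] (F : J ⥤ SSet.{max u v}) (Y : SSet.{max u v})

/-- The functor of posets given by a map in the simplex category. -/
abbrev toChain {a b : SimplexCategory} (f : a ⟶ b) : ComposableArrows (Fin (b.len + 1)) a.len :=
  SimplexCategory.homEquivFunctor f

/-- The relative nerve: simplices are chains in `J` together with a family along the chain. -/
def relNerve : SSet.{max u v} where
  obj k := Σ c : ComposableArrows J k.unop.len, Fam (c ⋙ F) Y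
  map θ := ↾fun x ↦ ⟨restr θ x.1, x.2.pre (toChain θ.unop)⟩
  map_id _ := rfl
  map_comp _ _ := rfl

variable {F Y} {Z : SSet.{max u v}}

/-- Restriction of the coefficients of the relative nerve. -/
def relNerveMap (F : J ⥤ SSet.{max u v}) (f : Y ⟶ Z) : relNerve F Z ⟶ relNerve F Y where
  app _ := ↾fun x ↦ ⟨x.1, x.2.comp f⟩
  naturality _ _ _ := rfl

/-- The extension property of a simplicial set with respect to pushout products of `f` with
boundary inclusions. -/
def HasExtensions {Y Z : SSet.{w}} (f : Y ⟶ Z) (E : SSet.{w}) : Prop :=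
  ∀ (n : ℕ) (s : ∂Δ[n].toSSet ⊗ Z ⟶ E) (t : Δ[n] ⊗ Y ⟶ E),
    ∂Δ[n].toSSet ◁ f ≫ s = ∂Δ[n].ι ▷ Y ≫ t → ∃ l : Δ[n] ⊗ Z ⟶ E,
      ∂Δ[n].ι ▷ Z ≫ l = s ∧ Δ[n] ◁ f ≫ l = t

lemma hasExtensions_of_anodyne {Y Z : SSet.{w}} {f : Y ⟶ Z} (hf : anodyneExtensions f) (E : SSet.{w})
    [KanComplex E] : HasExtensions f E := by
  intro n s t h
  obtain ⟨l, h₁, h₂, -⟩ := exists_extension ∂Δ[n].ι hf (Limits.terminal.from E) t s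
    (Limits.terminal.from _) h.symm (by subsingleton) (by subsingleton)
  exact ⟨l, h₂, h₁⟩

/-- The map in the simplex category given by a chain. -/
abbrev ofChain {a b : SimplexCategory} (d : ComposableArrows (Fin (b.len + 1)) a.len) : a ⟶ b :=
  SimplexCategory.homEquivFunctor.symm d

lemma functor_map_app_comp {C : Type*} [Category* C] (G : C ⥤ SSet.{w}) {i j k : C} (f : i ⟶ j)
    (g : j ⟶ k) {l : SimplexCategoryᵒᵖ} (x : (G.obj i).obj l) :
    (G.map g).app l ((G.map f).app l x) = (G.map (f ≫ g)).app l x := by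
  rw [G.map_comp]
  rfl

lemma functor_map_app_self {C : Type*} [Preorder C] (G : C ⥤ SSet.{w}) {i : C} (f : i ⟶ i)
    {l : SimplexCategoryᵒᵖ} (x : (G.obj i).obj l) : (G.map f).app l x = x := by
  obtain rfl : f = 𝟙 i := Subsingleton.elim _ _
  rw [G.map_id]
  rfl

/-- A simplex outside the boundary is surjective on vertices, so it ends at the last vertex. -/
lemma not_mem_boundary_le {n : ℕ} {k : SimplexCategoryᵒᵖ} {a : k.unop ⟶ ⦋n⦌}
    (h : stdSimplex.objEquiv.symm a ∉ (boundary.{w} n).obj k) :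
    Fin.last n ≤ a.toOrderHom (Fin.last _) := by
  obtain ⟨i, hi⟩ := not_not.1 h (Fin.last n)
  exact hi.symm.le.trans (a.toOrderHom.monotone (Fin.le_last i))

/-- Families along `Fin (n + 1)` can be extended from the boundary. -/
lemma exists_fam_extension {Y Z : SSet.{w}} {f : Y ⟶ Z} {n : ℕ} (G : Fin (n + 1) ⥤ SSet.{w})
    (hG : HasExtensions f (G.obj (Fin.last n))) (s : Fam G Y)
    (B : ∀ (k : SimplexCategoryᵒᵖ) (a : k.unop ⟶ ⦋n⦌)
      (_ : stdSimplex.objEquiv.symm a ∈ (boundary.{w} n).obj k) (_ : Z.obj k),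
      (G.obj ((toChain a).obj (Fin.last _))).obj k)
    (hB : ∀ k k' (θ : k ⟶ k') a ha ha' y, (G.obj ((toChain a).obj (Fin.last _))).map θ (B k a ha y) =
      (G.map (lastHom θ (toChain a))).app k' (B k' (θ.unop ≫ a) ha' (Z.map θ y)))
    (hBs : ∀ k a ha y, B k a ha (f.app k y) = s.val k (toChain a) y) :
    ∃ t : Fam G Z, t.comp f = s ∧ ∀ k a ha y, t.val k (toChain a) y = B k a ha y := by
  classical
  have hlast : ∀ {k : SimplexCategoryᵒᵖ} (a : k.unop ⟶ ⦋n⦌),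
      (toChain a).obj (Fin.last _) ≤ Fin.last n := fun _ ↦ Fin.le_last _
  -- All data are pushed forward to the value at the last vertex, where the extension property
  -- applies.
  let p : ∂Δ[n].toSSet ⊗ Z ⟶ G.obj (Fin.last n) := {
    app k := ↾fun x ↦ (G.map (homOfLE (hlast (stdSimplex.objEquiv x.1.1)))).app k
      (B k (stdSimplex.objEquiv x.1.1) x.1.2 x.2)
    naturality k k' θ := by
      ext ⟨⟨a, ha⟩, y⟩
      refine Eq.trans ?_ (NatTrans.naturality_apply
        (G.map (homOfLE (hlast (stdSimplex.objEquiv a)))) θ _)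
      have := hB k k' θ (stdSimplex.objEquiv a) ha (∂Δ[n].map θ ha) y
      refine Eq.trans ?_ (congrArg ((G.map (homOfLE (hlast (stdSimplex.objEquiv a)))).app k')
        this.symm)
      exact Eq.trans (by rfl) (functor_map_app_comp G _ _ _).symm }
  let q : Δ[n] ⊗ Y ⟶ G.obj (Fin.last n) := {
    app k := ↾fun x ↦ (G.map (homOfLE (hlast (stdSimplex.objEquiv x.1)))).app k
      (s.val k (toChain (stdSimplex.objEquiv x.1)) x.2)
    naturality k k' θ := by
      ext ⟨a, y⟩
      refine Eq.trans ?_ (NatTrans.naturality_apply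
        (G.map (homOfLE (hlast (stdSimplex.objEquiv a)))) θ _)
      have := s.compat θ (toChain (stdSimplex.objEquiv a)) y
      refine Eq.trans ?_ (congrArg ((G.map (homOfLE (hlast (stdSimplex.objEquiv a)))).app k')
        this.symm)
      exact Eq.trans (by rfl) (functor_map_app_comp G _ _ _).symm }
  obtain ⟨l, hl₁, hl₂⟩ := hG n p q (by
    ext k ⟨⟨a, ha⟩, y⟩
    exact congrArg ((G.map (homOfLE (hlast (stdSimplex.objEquiv a)))).app k)
      (hBs k (stdSimplex.objEquiv a) ha y))
  have hl₁' : ∀ (k : SimplexCategoryᵒᵖ) (a : k.unop ⟶ ⦋n⦌) (_ : stdSimplex.objEquiv.symm a ∈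
      (boundary.{w} n).obj k) (y : Z.obj k), l.app k (stdSimplex.objEquiv.symm a, y) =
        (G.map (homOfLE (hlast a))).app k (B k a ‹_› y) := by
    intro k a ha y
    have h := congr_app hl₁ k
    exact ConcreteCategory.congr_hom h
      (show (boundary.{w} n).toSSet.obj k × Z.obj k from (⟨stdSimplex.objEquiv.symm a, ha⟩, y))
  have hl₂' : ∀ (k : SimplexCategoryᵒᵖ) (a : k.unop ⟶ ⦋n⦌) (y : Y.obj k),
      l.app k (stdSimplex.objEquiv.symm a, f.app k y) =
        (G.map (homOfLE (hlast a))).app k (s.val k (toChain a) y) := by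
    intro k a y
    have h := congr_app hl₂ k
    exact ConcreteCategory.congr_hom h
      (show (SSet.stdSimplex.{w}.obj ⦋n⦌).obj k × Y.obj k from (stdSimplex.objEquiv.symm a, y))
  have hl : ∀ (k k' : SimplexCategoryᵒᵖ) (θ : k ⟶ k') (a : k.unop ⟶ ⦋n⦌) (y : Z.obj k),
      (G.obj (Fin.last n)).map θ (l.app k (stdSimplex.objEquiv.symm a, y)) =
        l.app k' (stdSimplex.objEquiv.symm (θ.unop ≫ a), Z.map θ y) := by
    intro k k' θ a y
    have h := l.naturality θ
    exact (ConcreteCategory.congr_hom h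
      (show (SSet.stdSimplex.{w}.obj ⦋n⦌).obj k × Z.obj k from (stdSimplex.objEquiv.symm a, y))).symm
  -- Boundary simplices keep their prescribed values. The remaining ones end at the last vertex, so
  -- the filler `l` already takes values in the right space for them.
  have hT₀ : ∀ (k : SimplexCategoryᵒᵖ) (a : k.unop ⟶ ⦋n⦌) (y : Z.obj k),
      ∃ z : (G.obj ((toChain a).obj (Fin.last _))).obj k,
        (∀ ha : stdSimplex.objEquiv.symm a ∈ (boundary.{w} n).obj k, z = B k a ha y) ∧
        (∀ ha : stdSimplex.objEquiv.symm a ∉ (boundary.{w} n).obj k,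
          z = (G.map (homOfLE (not_mem_boundary_le ha))).app k
            (l.app k (stdSimplex.objEquiv.symm a, y))) := by
    intro k a y
    by_cases ha : stdSimplex.objEquiv.symm a ∈ (boundary.{w} n).obj k
    · exact ⟨B k a ha y, fun _ ↦ rfl, fun ha' ↦ (ha' ha).elim⟩
    · exact ⟨(G.map (homOfLE (not_mem_boundary_le ha))).app k
        (l.app k (stdSimplex.objEquiv.symm a, y)), fun ha' ↦ (ha ha').elim, fun _ ↦ rfl⟩
  choose T hTpos hTneg using hT₀
  have hT : ∀ k k' (θ : k ⟶ k') a y, (G.obj ((toChain a).obj (Fin.last _))).map θ (T k a y) =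
      (G.map (lastHom θ (toChain a))).app k' (T k' (θ.unop ≫ a) (Z.map θ y)) := by
    intro k k' θ a y
    by_cases ha : stdSimplex.objEquiv.symm a ∈ (boundary.{w} n).obj k
    · have ha' : stdSimplex.objEquiv.symm (θ.unop ≫ a) ∈ (boundary.{w} n).obj k' :=
        ∂Δ[n].map θ ha
      rw [hTpos _ _ _ ha, hTpos _ _ _ ha']
      exact hB k k' θ a ha ha' y
    · rw [hTneg _ _ _ ha]
      refine (NatTrans.naturality_apply (G.map (homOfLE (not_mem_boundary_le ha))) θ _).symm.trans ?_
      rw [hl]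
      by_cases ha' : stdSimplex.objEquiv.symm (θ.unop ≫ a) ∈ (boundary.{w} n).obj k'
      · rw [hl₁' _ _ ha', functor_map_app_comp, hTpos _ _ _ ha']
        rfl
      · rw [hTneg _ _ _ ha']
        exact Eq.trans (by rfl) (functor_map_app_comp G _ _ _).symm
  refine ⟨⟨fun k d y ↦ T k (ofChain d) y, fun {k k'} θ d y ↦ hT k k' θ (ofChain d) y⟩, ?_, ?_⟩
  · ext k d y
    change T k (ofChain d) (f.app k y) = s.val k d y
    by_cases ha : stdSimplex.objEquiv.symm (ofChain d) ∈ (boundary.{w} n).obj k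
    · rw [hTpos _ _ _ ha]
      exact hBs _ _ _ _
    · rw [hTneg _ _ _ ha]
      rw [hl₂', functor_map_app_comp]
      exact functor_map_app_self G _ _
  · intro k a ha y
    with_unfolding_all exact hTpos k (ofChain (toChain a)) y ha

/-- The bottom of a lifting problem against `∂Δ[n]` is a chain `c` with a family over it, and the
top lies over the faces of `c`. The chain is therefore fixed, and only a family along `Fin (n + 1)`
has to be extended from the boundary. -/
lemma relNerveMap_rlp {f : Y ⟶ Z} (hF : ∀ j, HasExtensions f (F.obj j)) :
    I.rlp (relNerveMap F f) := by
  rintro _ _ _ ⟨n⟩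
  refine ⟨fun {t b} sq ↦ ?_⟩
  obtain ⟨⟨c, s⟩, rfl⟩ := yonedaEquiv.symm.surjective b
  have hsq : ∀ (k : SimplexCategoryᵒᵖ) (a : k.unop ⟶ ⦋n⦌)
      (ha : stdSimplex.objEquiv.symm a ∈ ∂Δ[n].obj k),
      (relNerveMap F f).app k (t.app k ⟨stdSimplex.objEquiv.symm a, ha⟩) =
        ⟨restr a.op c, s.pre (toChain a)⟩ := fun k a ha ↦
    ConcreteCategory.congr_hom (congr_app sq.w k) ⟨stdSimplex.objEquiv.symm a, ha⟩
  have ht : ∀ (k : SimplexCategoryᵒᵖ) (a : k.unop ⟶ ⦋n⦌)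
      (ha : stdSimplex.objEquiv.symm a ∈ ∂Δ[n].obj k),
      ∃ x : Fam (toChain a ⋙ c ⋙ F) Z,
        t.app k ⟨stdSimplex.objEquiv.symm a, ha⟩ = ⟨restr a.op c, x⟩ := by
    intro k a ha
    have h := hsq k a ha
    rcases hxx : t.app k ⟨stdSimplex.objEquiv.symm a, ha⟩ with ⟨c', x⟩
    rw [hxx] at h
    obtain rfl : c' = restr a.op c := congrArg Sigma.fst h
    exact ⟨x, rfl⟩
  choose x hx using ht
  have hxf : ∀ k a ha, (x k a ha).comp f = s.pre (toChain a) := by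
    intro k a ha
    have h := hsq k a ha
    rw [hx] at h
    exact eq_of_heq (Sigma.mk.inj h).2
  have hxθ : ∀ (k k' : SimplexCategoryᵒᵖ) (θ : k ⟶ k') a ha ha',
      x k' (θ.unop ≫ a) ha' = (x k a ha).pre (toChain θ.unop) := by
    intro k k' θ a ha ha'
    have h := NatTrans.naturality_apply t θ ⟨stdSimplex.objEquiv.symm a, ha⟩
    rw [hx] at h
    exact eq_of_heq (Sigma.mk.inj ((hx k' (θ.unop ≫ a) ha').symm.trans h)).2
  obtain ⟨t', ht'f, ht'⟩ := exists_fam_extension (c ⋙ F) (hF _) s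
    (fun k a ha y ↦ (x k a ha).val k (𝟭 _) y)
    (fun k k' θ a ha ha' y ↦ by
      rw [hxθ k k' θ a ha ha']
      exact (x k a ha).compat θ (𝟭 _) y)
    (fun k a ha y ↦ congrArg (fun z ↦ z.val k (𝟭 _) y) (hxf k a ha))
  refine ⟨⟨{ l := yonedaEquiv.symm ⟨c, t'⟩, fac_left := ?_, fac_right := ?_ }⟩⟩
  · ext k ⟨a, ha⟩
    obtain ⟨a, rfl⟩ := stdSimplex.objEquiv.symm.surjective a
    refine Eq.trans ?_ (hx k a ha).symm
    refine Sigma.ext rfl (heq_of_eq ?_)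
    ext k' d y
    have ha' : stdSimplex.objEquiv.symm (ofChain d ≫ a) ∈ (boundary.{max u v} n).obj k' :=
      ∂Δ[n].map (ofChain d).op ha
    refine (ht' k' (ofChain d ≫ a) ha' y).trans ?_
    exact congrArg (fun z ↦ z.val k' (𝟭 _) y) (hxθ k k' (ofChain d).op a ha ha')
  · refine (SSet.yonedaEquiv_symm_comp _ _).trans ?_
    exact congrArg yonedaEquiv.symm (Sigma.ext rfl (heq_of_eq ht'f))

end RelativeNerve
-- Homotopy limits of Kan complexes: fibrancy, restriction, initial objects.
section HolimLemmas

open SSet Simplicial modelCategoryQuillen HomotopicalAlgebra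

lemma mono_iff_app_injective {X Y : SSet.{w}} (f : X ⟶ Y) :
    Mono f ↔ ∀ k, Function.Injective (f.app k) := by
  simp only [NatTrans.mono_iff_mono_app, CategoryTheory.mono_iff_injective]

lemma anodyneExtensions_of_mem_J {X Y : SSet.{w}} {i : X ⟶ Y} (hi : J i) : anodyneExtensions i := by
  rw [anodyneExtensions_eq_llp_rlp]
  exact MorphismProperty.le_llp_rlp _ _ hi

section Extension

variable {I : Type u} [Category.{v} I] {J : Type u} [Category.{v} J] {F : J ⥤ SSet.{max u v}}
  {Y Z : SSet.{max u v}}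

/-- Families can be extended along subcategories. -/
lemma Fam.exists_extension (φ : I ⥤ J) [Mono (nerveMap φ)] {f : Y ⟶ Z}
    (hF : ∀ j, HasExtensions f (F.obj j)) (t : Fam F Y) (s : Fam (φ ⋙ F) Z)
    (h : s.comp f = t.pre φ) : ∃ t' : Fam F Z, t'.comp f = t ∧ t'.pre φ = s := by
  -- `s` and `t` become partial sections of the relative nerve over `nerve I` and `nerve J`; a lift
  -- along `nerveMap φ` is the wanted section.
  let a : nerve I ⟶ relNerve F Z :=
    { app k := ↾fun c ↦ ⟨c ⋙ φ, s.pre (J := I) c⟩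
      naturality _ _ _ := rfl }
  let b : nerve J ⟶ relNerve F Y :=
    { app k := ↾fun c ↦ ⟨c, t.pre (J := J) c⟩
      naturality _ _ _ := rfl }
  have sq : CommSq a (nerveMap φ) (relNerveMap F f) b := ⟨by
    ext k c
    exact Sigma.ext rfl (heq_of_eq (congrArg (fun x ↦ x.pre (J := I) c) h))⟩
  have hp := relNerveMap_rlp hF
  rw [← SSet.rlp_monomorphisms] at hp
  have := hp (nerveMap φ) (MorphismProperty.monomorphisms.infer_property (nerveMap φ))
  have hl : ∀ (k : SimplexCategoryᵒᵖ) (c : ComposableArrows J k.unop.len), ∃ x : Fam (c ⋙ F) Z,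
      sq.lift.app k (show (nerve J).obj k from c) = ⟨c, x⟩ ∧ x.comp f = t.pre c := by
    intro k c
    have h := congr_app sq.fac_right k
    replace h := ConcreteCategory.congr_hom h c
    rcases hx : sq.lift.app k (show (nerve J).obj k from c) with ⟨c', x⟩
    change (relNerveMap F f).app k (sq.lift.app k (show (nerve J).obj k from c)) = _ at h
    rw [hx] at h
    obtain rfl : c' = c := congrArg Sigma.fst h
    exact ⟨x, rfl, eq_of_heq (Sigma.mk.inj h).2⟩
  choose x hx hxf using hl
  have hxθ : ∀ (k k' : SimplexCategoryᵒᵖ) (θ : k ⟶ k') c,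
      x k' (restr θ c) = (x k c).pre (toChain θ.unop) := by
    intro k k' θ c
    have h := NatTrans.naturality_apply sq.lift θ (show (nerve J).obj k from c)
    rw [hx] at h
    exact eq_of_heq (Sigma.mk.inj ((hx k' (restr θ c)).symm.trans h)).2
  refine ⟨⟨fun k c y ↦ (x k c).val k (𝟭 _) y, fun {k k'} θ c y ↦ ?_⟩, ?_, ?_⟩
  · rw [hxθ k k' θ c]
    exact (x k c).compat θ (𝟭 _) y
  · ext k c y
    exact congrArg (fun z ↦ z.val k (𝟭 _) y) (hxf k c)
  · ext k c y
    have h := congr_app sq.fac_left k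
    replace h := ConcreteCategory.congr_hom h c
    change sq.lift.app k (show (nerve J).obj k from c ⋙ φ) = _ at h
    rw [hx] at h
    exact congrArg (fun z ↦ z.val k (𝟭 _) y) (eq_of_heq (Sigma.mk.inj h).2)

lemma Fam.exists_extension_of_hasExtensions {f : Y ⟶ Z} (hF : ∀ j, HasExtensions f (F.obj j))
    (t : Fam F Y) : ∃ t' : Fam F Z, t'.comp f = t := by
  -- The absolute case is the relative one for the empty subcategory.
  let φ := (⊥ : ObjectProperty J).ι
  have hI : ∀ k (_ : ComposableArrows (⊥ : ObjectProperty J).FullSubcategory k), False :=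
    fun _ c ↦ (c.obj 0).property
  have : Mono (nerveMap φ) := (mono_iff_app_injective _).2 fun k c ↦ (hI _ c).elim
  obtain ⟨t', h, -⟩ := Fam.exists_extension φ hF t ⟨fun k c ↦ (hI _ c).elim,
    fun _ c ↦ (hI _ c).elim⟩ (by
      ext k c
      exact (hI _ c).elim)
  exact ⟨t', h⟩

instance kanComplex_holim (F : J ⥤ SSet.{max u v}) [∀ j, KanComplex (F.obj j)] :
    KanComplex (holim F) := by
  refine (HomotopicalAlgebra.isFibrant_iff _).2 ?_
  rw [fibration_iff]
  intro A B i hi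
  refine ⟨fun {a b} sq ↦ ?_⟩
  obtain ⟨t, ht⟩ := Fam.exists_extension_of_hasExtensions (f := i)
    (fun j ↦ hasExtensions_of_anodyne (anodyneExtensions_of_mem_J hi) (F.obj j)) (Fam.ofHom a)
  refine ⟨⟨{ l := t.toHom, fac_left := Fam.ofHom_injective ?_, fac_right := by subsingleton }⟩⟩
  rw [Fam.ofHom_comp, Fam.ofHom_toHom, ht]

/-- A lifting problem against a horn inclusion asks to extend a family that is given over `J` on the
horn and over `I` on the whole simplex. Injectivity on nerves makes the part over `I` a genuine
restriction on subchains. -/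
instance fibration_holimPre (φ : I ⥤ J) [Mono (nerveMap φ)] (F : J ⥤ SSet.{max u v})
    [∀ j, KanComplex (F.obj j)] : Fibration (holimPre φ F) := by
  rw [fibration_iff]
  intro A B i hi
  refine ⟨fun {a b} sq ↦ ?_⟩
  obtain ⟨t, ht, ht'⟩ := Fam.exists_extension φ (f := i)
    (fun j ↦ hasExtensions_of_anodyne (anodyneExtensions_of_mem_J hi) (F.obj j)) (Fam.ofHom a)
      (Fam.ofHom b) (by rw [← Fam.ofHom_holimPre, sq.w, Fam.ofHom_comp])
  refine ⟨⟨{ l := t.toHom, fac_left := Fam.ofHom_injective ?_,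
             fac_right := Fam.ofHom_injective ?_ }⟩⟩
  · rw [Fam.ofHom_comp, Fam.ofHom_toHom, ht]
  · rw [Fam.ofHom_holimPre, Fam.ofHom_toHom, ht']

end Extension

section Initial

variable {J : Type u} [Category.{v} J] {F : J ⥤ SSet.{max u v}} {Y : SSet.{max u v}}

lemma Fam.map_val_congr (t : Fam F Y) {k : SimplexCategoryᵒᵖ}
    {c c' : ComposableArrows J k.unop.len} (h : c = c') {j : J} (f : c.obj (Fin.last _) ⟶ j)
    (f' : c'.obj (Fin.last _) ⟶ j) (hf : HEq f f') (y : Y.obj k) :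
    (F.map f).app k (t.val k c y) = (F.map f').app k (t.val k c' y) := by
  subst h
  rw [eq_of_heq hf]

/-- The functor `Fin 2 × J ⥤ J` given by a natural transformation from a constant functor to the
identity. -/
def contraction {j₀ : J} (α : (Functor.const J).obj j₀ ⟶ 𝟭 J) : Fin 2 × J ⥤ J :=
  Functor.uncurry.obj (ComposableArrows.mk₁ α)

/-- The canonical map from the contraction. -/
def contractionHom {j₀ : J} (α : (Functor.const J).obj j₀ ⟶ 𝟭 J) :
    contraction α ⟶ CategoryTheory.Prod.snd (Fin 2) J where
  app x := (contraction α).map (Y := (1, x.2)) (homOfLE (Fin.le_last x.1), 𝟙 x.2)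
  naturality x y f := by
    have h : (CategoryTheory.Prod.snd (Fin 2) J).map f =
      (contraction α).map (X := ((1 : Fin 2), x.2)) (Y := ((1 : Fin 2), y.2)) (𝟙 _, f.2) := by
      change f.2 = NatTrans.app (𝟙 (𝟭 J)) x.2 ≫ f.2
      simp
    rw [h]
    refine ((contraction α).map_comp _ _).symm.trans (Eq.trans ?_ ((contraction α).map_comp _ _))
    congr 1
    exact Prod.ext (Subsingleton.elim _ _) (by simp)

variable {j₀ : J} (α : (Functor.const J).obj j₀ ⟶ 𝟭 J)

/-- The family giving a homotopy from evaluation at `j₀` to the identity. -/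
def Fam.contract (t : Fam F Y) : Fam F (Y ⊗ Δ[1]) where
  val k c y := (F.map ((contractionHom α).app
      ((Functor.prod' (toChain (stdSimplex.objEquiv y.2)) c).obj (Fin.last _)))).app k
    (t.val k (Functor.prod' (toChain (stdSimplex.objEquiv y.2)) c ⋙ contraction α) y.1)
  compat {k k'} θ c y := by
    let d := Functor.prod' (toChain (stdSimplex.objEquiv y.2)) c
    refine (NatTrans.naturality_apply (F.map _) θ _).symm.trans ?_
    refine (congrArg ((F.map ((contractionHom α).app (d.obj (Fin.last _)))).app k')
      (t.compat θ (d ⋙ contraction α) y.1)).trans ?_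
    refine (functor_map_app_comp F _ _ _).trans (Eq.trans ?_ (functor_map_app_comp F _ _ _).symm)
    refine ConcreteCategory.congr_hom (congr_app (congrArg F.map ?_) k') _
    exact (contractionHom α).naturality (lastHom θ d)

lemma Fam.contract_val_zero (t : Fam F Y) (k : SimplexCategoryᵒᵖ)
    (c : ComposableArrows J k.unop.len) (y : (Y ⊗ Δ[1] : SSet).obj k)
    (h : toChain (stdSimplex.objEquiv y.2) = (Functor.const _).obj 0) :
    (t.contract α).val k c y = (F.map (α.app (c.obj (Fin.last _)))).app k
      (t.val k ((Functor.const _).obj j₀) y.1) := by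
  change (F.map ((contractionHom α).app
      ((Functor.prod' (toChain (stdSimplex.objEquiv y.2)) c).obj (Fin.last _)))).app k
    (t.val k (Functor.prod' (toChain (stdSimplex.objEquiv y.2)) c ⋙ contraction α) y.1) = _
  rw [h]
  refine t.map_val_congr
    (c := Functor.prod' ((Functor.const (Fin (k.unop.len + 1))).obj (0 : Fin 2)) c ⋙ contraction α)
    (c' := (Functor.const _).obj j₀) (j := c.obj (Fin.last _)) ?_
    ((contractionHom α).app (0, c.obj (Fin.last _))) (α.app (c.obj (Fin.last _))) ?_ y.1
  · refine CategoryTheory.Functor.ext (fun _ ↦ rfl) fun i j f ↦ ?_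
    change (NatTrans.app (𝟙 ((Functor.const J).obj j₀)) _ ≫ 𝟙 j₀ : j₀ ⟶ j₀) =
      𝟙 j₀ ≫ 𝟙 j₀ ≫ 𝟙 j₀
    simp
  · refine heq_of_eq (?_ : (α.app _ ≫ 𝟙 _ : j₀ ⟶ c.obj (Fin.last _)) = α.app _)
    simp

lemma Fam.contract_val_one (t : Fam F Y) (k : SimplexCategoryᵒᵖ)
    (c : ComposableArrows J k.unop.len) (y : (Y ⊗ Δ[1] : SSet).obj k)
    (h : toChain (stdSimplex.objEquiv y.2) = (Functor.const _).obj 1) :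
    (t.contract α).val k c y = t.val k c y.1 := by
  change (F.map ((contractionHom α).app
      ((Functor.prod' (toChain (stdSimplex.objEquiv y.2)) c).obj (Fin.last _)))).app k
    (t.val k (Functor.prod' (toChain (stdSimplex.objEquiv y.2)) c ⋙ contraction α) y.1) = _
  rw [h]
  refine (t.map_val_congr
    (c := Functor.prod' ((Functor.const (Fin (k.unop.len + 1))).obj (1 : Fin 2)) c ⋙ contraction α)
    (c' := c) (j := c.obj (Fin.last _)) ?_
    ((contractionHom α).app (1, c.obj (Fin.last _))) (𝟙 _) ?_ y.1).trans (ConcreteCategory.congr_hom (congr_app (F.map_id _) k) _)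
  · refine CategoryTheory.Functor.ext (fun _ ↦ rfl) fun i j f ↦ ?_
    change (NatTrans.app (𝟙 (𝟭 J)) _ ≫ c.map f : c.obj i ⟶ c.obj j) =
      𝟙 _ ≫ c.map f ≫ 𝟙 _
    simp
  · refine heq_of_eq (?_ : (NatTrans.app (𝟙 (𝟭 J)) _ ≫ 𝟙 _ :
      c.obj (Fin.last _) ⟶ c.obj (Fin.last _)) = 𝟙 _)
    simp

/-- The cone over a diagram given by the value at an initial object. -/
@[simps]
def initialCone (F : J ⥤ SSet.{max u v}) : (Functor.const J).obj (F.obj j₀) ⟶ F where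
  app j := F.map (α.app j)
  naturality i j f := by
    have h := α.naturality f
    replace h := congrArg F.map h
    rw [F.map_comp, F.map_comp] at h
    refine Eq.trans ?_ h
    change 𝟙 _ ≫ _ = F.map (𝟙 _) ≫ _
    rw [F.map_id]

/-- Evaluation of a homotopy limit. -/
def holimEval (F : J ⥤ SSet.{max u v}) (j : J) : holim F ⟶ F.obj j where
  app k := ↾fun y ↦ (Fam.ofHom (𝟙 (holim F))).val k ((Functor.const _).obj j) y
  naturality k k' θ := by
    ext y
    have h := (Fam.ofHom (𝟙 (holim F))).compat θ ((Functor.const _).obj j) y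
    refine Eq.trans ?_ h.symm
    exact (ConcreteCategory.congr_hom (congr_app (F.map_id j) k') _).symm

/-- The homotopy limit of a diagram is equivalent to its value at an initial object. -/
lemma isHomotopyEquiv_toHolim_initialCone (hα : α.app j₀ = 𝟙 _) :
    IsHomotopyEquiv (toHolim (initialCone α F)) := by
  -- One composite is strictly the identity. The other is deformed to the identity by letting each
  -- chain grow out of the constant chain at `j₀`, along `α`.
  refine isHomotopyEquiv_iff.2 ⟨holimEval F j₀, .of_eq ?_,
    ⟨((Fam.ofHom (𝟙 (holim F))).contract α).toHom, Fam.ofHom_injective ?_,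
      Fam.ofHom_injective ?_⟩⟩
  · ext k y
    change (Fam.ofHom (toHolim (initialCone α F))).val k ((Functor.const _).obj j₀) y = y
    rw [Fam.ofHom_toHolim]
    change (F.map (α.app j₀)).app k y = y
    rw [hα, F.map_id]
    rfl
  · rw [Fam.ofHom_comp, Fam.ofHom_comp, Fam.ofHom_toHom, Fam.ofHom_toHolim]
    ext k c y
    exact Fam.contract_val_zero α _ k c _ rfl
  · rw [Fam.ofHom_comp, Fam.ofHom_toHom]
    ext k c y
    exact Fam.contract_val_one α _ k c _ rfl

end Initial

end HolimLemmas
-- `Sext` on simplicial subsets: restriction fibrations and gluing.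
section SextLemmas

open SSet Simplicial modelCategoryQuillen HomotopicalAlgebra

variable (S : SimplexCategoryᵒᵖ ⥤ SSet.{u}) {X : SSet.{u}}

instance kanComplex_Sext [∀ k, KanComplex (S.obj k)] (K : SSet.{u}ᵒᵖ) :
    KanComplex ((Sext S).obj K) :=
  have : ∀ j, KanComplex ((simplexDiagram S K.unop).obj j) :=
    fun _ ↦ inferInstanceAs (KanComplex (S.obj _))
  kanComplex_holim (simplexDiagram S K.unop)

/-- Restriction from a simplicial subset to a smaller one. -/
abbrev SextInc {K L : X.Subcomplex} (h : K ≤ L) :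
    (Sext S).obj (op L.toSSet) ⟶ (Sext S).obj (op K.toSSet) :=
  (Sext S).map (Subcomplex.homOfLE h).op

lemma SextInc_comp {K L M : X.Subcomplex} (h : K ≤ L) (h' : L ≤ M) :
    SextInc S h' ≫ SextInc S h = SextInc S (h.trans h') :=
  ((Sext S).map_comp _ _).symm

lemma SextInc_refl (K : X.Subcomplex) : SextInc S (le_refl K) = 𝟙 _ := rfl

/-- The inclusion of categories of simplices. -/
abbrev elementsInc {K L : X.Subcomplex} (h : K ≤ L) : K.toSSet.Elements ⥤ L.toSSet.Elements :=
  CategoryOfElements.map (Subcomplex.homOfLE h)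

/-- Lift a chain of simplices to a simplicial subset. -/
def liftChain (K : X.Subcomplex) {L : X.Subcomplex} {n : ℕ}
    (c : ComposableArrows L.toSSet.Elements n) (hc : ∀ i, (c.obj i).2.1 ∈ K.obj (c.obj i).1) :
    ComposableArrows K.toSSet.Elements n where
  obj i := ⟨(c.obj i).1, ⟨(c.obj i).2.1, hc i⟩⟩
  map f := ⟨(c.map f).1, by
    have h := (c.map f).2
    replace h := congrArg Subtype.val h
    exact Subtype.ext h⟩
  map_id i := by
    have h := congrArg Subtype.val (c.map_id i)
    exact Subtype.ext h
  map_comp f g := by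
    have h := congrArg Subtype.val (c.map_comp f g)
    exact Subtype.ext h

/-- Arrows in the category of simplices go from a simplex to its restrictions, so the first simplex
of a chain controls the others. This is why a chain of a union lies in a single piece. -/
lemma mem_of_mem_zero {K L : X.Subcomplex} {n : ℕ} (c : ComposableArrows L.toSSet.Elements n)
    (hc : (c.obj 0).2.1 ∈ K.obj (c.obj 0).1) (i) : (c.obj i).2.1 ∈ K.obj (c.obj i).1 := by
  have h := (c.map (homOfLE (Fin.zero_le i))).2
  replace h := congrArg Subtype.val h
  rw [← h]
  exact K.map _ hc

instance {K L : X.Subcomplex} (h : K ≤ L) : Mono (nerveMap (elementsInc h)) := by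
  refine (mono_iff_app_injective _).2 fun k (c : ComposableArrows _ _)
    (d : ComposableArrows _ _) hcd ↦ ?_
  replace hcd : c ⋙ elementsInc h = d ⋙ elementsInc h := hcd
  have hc : c = liftChain K (c ⋙ elementsInc h) (fun i ↦ (c.obj i).2.2) := rfl
  have hd : d = liftChain K (d ⋙ elementsInc h) (fun i ↦ (d.obj i).2.2) := rfl
  rw [hc, hd]
  congr 1

instance fibration_SextInc [∀ k, KanComplex (S.obj k)] {K L : X.Subcomplex} (h : K ≤ L) :
    Fibration (SextInc S h) :=
  have : ∀ j, KanComplex ((simplexDiagram S L.toSSet).obj j) :=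
    fun _ ↦ inferInstanceAs (KanComplex (S.obj _))
  fibration_holimPre (elementsInc h) (simplexDiagram S L.toSSet)

variable {S}

section Glue

variable {B : Type*} {K : B → X.Subcomplex} {L : X.Subcomplex} {Y : SSet.{u}}

lemma exists_mem_of_le_iSup (hL : L ≤ ⨆ b, K b) {k : SimplexCategoryᵒᵖ} {s : X.obj k}
    (hs : s ∈ L.obj k) : ∃ b, s ∈ (K b).obj k := by
  simpa using hL k hs

/-- Maps to `Sext` of a union are determined by their restrictions. -/
lemma Sext_hom_ext (hK : ∀ b, K b ≤ L) (hL : L ≤ ⨆ b, K b)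
    {f g : Y ⟶ (Sext S).obj (op L.toSSet)} (h : ∀ b, f ≫ SextInc S (hK b) = g ≫ SextInc S (hK b)) :
    f = g := by
  refine Fam.ofHom_injective (F := simplexDiagram S L.toSSet) ?_
  ext k c y
  obtain ⟨b, hb⟩ := exists_mem_of_le_iSup hL (c.obj 0).2.2
  have h' := congrArg (Fam.ofHom (F := simplexDiagram S (K b).toSSet)) (h b)
  exact congrArg (fun t : Fam (simplexDiagram S (K b).toSSet) Y ↦
    t.val k (liftChain (K b) c (mem_of_mem_zero c hb)) y) h'

/-- Compatible maps to `Sext` of simplicial subsets can be glued. -/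
lemma exists_Sext_glue (hK : ∀ b, K b ≤ L) (hL : L ≤ ⨆ b, K b)
    (f : ∀ b, Y ⟶ (Sext S).obj (op (K b).toSSet))
    (hf : ∀ b b', f b ≫ SextInc S (inf_le_left : K b ⊓ K b' ≤ K b) =
      f b' ≫ SextInc S (inf_le_right : K b ⊓ K b' ≤ K b')) :
    ∃ g : Y ⟶ (Sext S).obj (op L.toSSet), ∀ b, g ≫ SextInc S (hK b) = f b := by
  have hmem : ∀ (k : ℕ) (c : ComposableArrows L.toSSet.Elements k),
      ∃ b, (c.obj 0).2.1 ∈ (K b).obj (c.obj 0).1 := fun k c ↦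
    exists_mem_of_le_iSup hL (c.obj 0).2.2
  -- A chain and its restriction may be assigned different pieces; agreement on pairwise
  -- intersections (`ht`) makes the choice irrelevant.
  choose β hβ using hmem
  let t : ∀ b, Fam (simplexDiagram S (K b).toSSet) Y := fun b ↦ Fam.ofHom (f b)
  have ht : ∀ (b b') (k : SimplexCategoryᵒᵖ) (c : ComposableArrows L.toSSet.Elements k.unop.len)
      (h : ∀ i, (c.obj i).2.1 ∈ (K b).obj (c.obj i).1)
      (h' : ∀ i, (c.obj i).2.1 ∈ (K b').obj (c.obj i).1) (y : Y.obj k),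
      (show (S.obj (c.obj (Fin.last _)).1).obj k from (t b).val k (liftChain (K b) c h) y) =
        (t b').val k (liftChain (K b') c h') y := by
    intro b b' k c h h' y
    have h'' := congrArg (Fam.ofHom (F := simplexDiagram S (K b ⊓ K b').toSSet)) (hf b b')
    exact congrArg (fun t : Fam (simplexDiagram S (K b ⊓ K b').toSSet) Y ↦
      t.val k (liftChain (K b ⊓ K b') c fun i ↦ ⟨h i, h' i⟩) y) h''
  let T : Fam (simplexDiagram S L.toSSet) Y :=
    { val k c y := (t (β _ c)).val k (liftChain (K (β _ c)) c (mem_of_mem_zero c (hβ _ c))) y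
      compat {k k'} θ c y := by
        refine ((t (β _ c)).compat θ (liftChain (K (β _ c)) c (mem_of_mem_zero c (hβ _ c)))
          y).trans ?_
        refine congrArg ((S.map (lastHom θ c).1).app k') ?_
        exact ht _ _ k' (restr θ c) (fun i ↦ mem_of_mem_zero c (hβ _ c) _) _ _ }
  refine ⟨T.toHom, fun b ↦ Fam.ofHom_injective (F := simplexDiagram S (K b).toSSet) ?_⟩
  refine (Fam.ofHom_holimPre (elementsInc (hK b)) T.toHom).trans ?_
  rw [Fam.ofHom_toHom]
  ext k c y
  exact ht _ b k (c ⋙ elementsInc (hK b)) _ (fun i ↦ (c.obj i).2.2) y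

end Glue

end SextLemmas
-- Local inclusions, excision and inclusion-exclusion.
section Local

open SSet Simplicial modelCategoryQuillen HomotopicalAlgebra

variable (S : SimplexCategoryᵒᵖ ⥤ SSet.{u}) {X : SSet.{u}}

instance : DistribLattice X.Subcomplex :=
  .ofInfSupLe fun A B C k x hx ↦ by
    obtain ⟨h, h' | h'⟩ := hx
    exacts [Or.inl ⟨h, h'⟩, Or.inr ⟨h, h'⟩]

/-- The inclusion `K ≤ L` induces a homotopy equivalence `Sext L ⟶ Sext K`. -/
def Loc (K L : X.Subcomplex) : Prop :=
  ∃ h : K ≤ L, IsHomotopyEquiv (SextInc S h)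

variable {S}

namespace Loc

variable [∀ k, KanComplex (S.obj k)] {K L M A B T : X.Subcomplex}

omit [∀ k, KanComplex (S.obj k)] in
lemma le (h : Loc S K L) : K ≤ L := h.1

omit [∀ k, KanComplex (S.obj k)] in
lemma refl (K : X.Subcomplex) : Loc S K K := ⟨le_rfl, .of_isIso (𝟙 _)⟩

lemma trans (h : Loc S K L) (h' : Loc S L M) : Loc S K M := ⟨h.le.trans h'.le, SextInc_comp S h.le h'.le ▸ h'.2.comp h.2⟩

lemma trans_iff_left (h : Loc S K L) (hM : L ≤ M) : Loc S K M ↔ Loc S L M :=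
  ⟨fun h' ↦ ⟨hM, .of_comp_right h.2 (SextInc_comp S h.le hM ▸ h'.2)⟩, h.trans⟩

/-- Excision. By gluing, `Sext (A ⊔ B)` is the strict fibre product of `Sext A` and `Sext B` over
`Sext (A ⊓ B)`, so restriction to `A` is a base change of the trivial fibration given by `h`. -/
lemma sup (h : Loc S (A ⊓ B) B) : Loc S A (A ⊔ B) := by
  refine ⟨le_sup_left, isHomotopyEquiv_of_rlp ?_⟩
  have hp := h.2.rlp_monomorphisms
  intro U V i hi
  have := hp i hi
  refine ⟨fun {a b} sq ↦ ?_⟩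
  have sq' : CommSq (a ≫ SextInc S (le_sup_right : B ≤ A ⊔ B)) i (SextInc S h.le)
      (b ≫ SextInc S (inf_le_left : A ⊓ B ≤ A)) := ⟨by
    rw [← reassoc_of% sq.w, Category.assoc, SextInc_comp, SextInc_comp]⟩
  have hAB : A ⊔ B ≤ ⨆ b, (cond b A B) := by
    rw [iSup_bool_eq]
    rfl
  have hAB' : ∀ b, cond b A B ≤ A ⊔ B := by
    rintro (_ | _)
    exacts [le_sup_right, le_sup_left]
  let f : ∀ j, V ⟶ (Sext S).obj (op (cond j A B).toSSet) := fun j ↦ Bool.rec sq'.lift b j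
  obtain ⟨g, hg⟩ := exists_Sext_glue (S := S) hAB' hAB f (by
      rintro (_ | _) (_ | _)
      · rfl
      · simpa only [Category.assoc, SextInc_comp] using
            sq'.fac_right =≫ SextInc S (inf_comm B A).le
      · exact sq'.fac_right.symm
      · rfl)
  refine ⟨⟨{ l := g, fac_left := Sext_hom_ext hAB' hAB ?_, fac_right := hg true }⟩⟩
  rintro (_ | _)
  · rw [Category.assoc, hg]
    exact sq'.fac_left
  · rw [Category.assoc, hg]
    exact sq.w.symm

/-- The inclusion is factored through `A ⊔ (B ⊓ T)`. The first stage attaches `A` along `A ⊓ T`. The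
second attaches `B` along `(B ⊓ T) ⊔ (A ⊓ B)`, which is local in `B` by two out of three: it arises
from `B ⊓ T` by attaching `A ⊓ B` along `A ⊓ B ⊓ T`. -/
lemma sup_inf (hA : Loc S (A ⊓ T) A) (hB : Loc S (B ⊓ T) B) (hAB : Loc S (A ⊓ B ⊓ T) (A ⊓ B)) :
    Loc S ((A ⊔ B) ⊓ T) (A ⊔ B) := by
  have h₁ : Loc S ((A ⊓ T) ⊔ (B ⊓ T)) (((A ⊓ T) ⊔ (B ⊓ T)) ⊔ A) := by
    refine Loc.sup ?_
    rwa [inf_sup_right, inf_eq_left.2 (inf_le_left : A ⊓ T ≤ A), inf_assoc B T A, inf_comm T A,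
      ← inf_assoc, sup_eq_left.2 (inf_le_inf_right T inf_le_right)]
  have h₂ : Loc S (B ⊓ T) ((B ⊓ T) ⊔ (A ⊓ B)) := by
    refine Loc.sup ?_
    rwa [inf_comm, ← inf_assoc, inf_eq_left.2 (inf_le_right : A ⊓ B ≤ B)]
  have h₃ : Loc S ((A ⊔ (B ⊓ T)) ⊓ B) B := by
    rw [inf_sup_right, inf_eq_left.2 (inf_le_left : B ⊓ T ≤ B), sup_comm]
    exact (h₂.trans_iff_left (sup_le inf_le_left inf_le_right)).1 hB
  have h₄ : A ⊔ (B ⊓ T) ⊔ B = A ⊔ B := by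
    rw [sup_assoc, sup_eq_right.2 (inf_le_left : B ⊓ T ≤ B)]
  rw [inf_sup_right]
  rw [sup_right_comm, sup_eq_right.2 (inf_le_left : A ⊓ T ≤ A)] at h₁
  exact h₁.trans (h₄ ▸ h₃.sup)

end Loc

lemma IsHomotopyEquiv.of_arrow_iso {X Y X' Y' : SSet.{u}} [KanComplex X] [KanComplex Y]
    [KanComplex X'] [KanComplex Y'] {f : X ⟶ Y} {f' : X' ⟶ Y'} (e : X ⟶ X') (e' : Y ⟶ Y') [IsIso e]
    [IsIso e'] (h : f ≫ e' = e ≫ f') : IsHomotopyEquiv f ↔ IsHomotopyEquiv f' := by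
  rw [← (IsHomotopyEquiv.of_isIso e).comp_iff_right, ← h, (IsHomotopyEquiv.of_isIso e').comp_iff_left]

/-- The map from a simplicial subset to its image. -/
def toImage {Y : SSet.{u}} (f : X ⟶ Y) (K : X.Subcomplex) : K.toSSet ⟶ (K.image f).toSSet where
  app k := ↾fun x ↦ ⟨f.app k x.1, ⟨x.1, x.2, rfl⟩⟩
  naturality k k' θ := by
    ext x
    have h := NatTrans.naturality_apply f θ x.1
    exact Subtype.ext h

instance {Y : SSet.{u}} (f : X ⟶ Y) [Mono f] (K : X.Subcomplex) : IsIso (toImage f K) := by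
  rw [NatTrans.isIso_iff_isIso_app]
  intro k
  rw [isIso_iff_bijective]
  refine ⟨fun x y h ↦ Subtype.ext ((mono_iff_app_injective f).1 inferInstance k
    (congrArg Subtype.val h)), ?_⟩
  rintro ⟨_, x, hx, rfl⟩
  exact ⟨⟨x, hx⟩, rfl⟩

/-- A monomorphism is an isomorphism onto its image, compatibly with subcomplexes. This carries
locality between a simplex and a face of a larger one. -/
lemma Loc.image_iff [∀ k, KanComplex (S.obj k)] {Y : SSet.{u}} (f : X ⟶ Y) [Mono f]
    {K L : X.Subcomplex} (hKL : K ≤ L) : Loc S (K.image f) (L.image f) ↔ Loc S K L := by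
  have h : K.image f ≤ L.image f := fun k x ⟨y, hy, hyx⟩ ↦ ⟨y, hKL _ hy, hyx⟩
  have h' : IsHomotopyEquiv (SextInc S h) ↔ IsHomotopyEquiv (SextInc S hKL) :=
    IsHomotopyEquiv.of_arrow_iso ((Sext S).map (toImage f L).op) ((Sext S).map (toImage f K).op)
      (by rw [← Functor.map_comp, ← Functor.map_comp]; rfl)
  exact ⟨fun H ↦ ⟨hKL, h'.1 H.2⟩, fun H ↦ ⟨h, h'.2 H.2⟩⟩

/-- The canonical maps from the simplex of dimension `n` in the category of simplices of `Δ[n]`. -/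
def fromTopSimplex (n : ℕ) : (Functor.const (⊤ : (Δ[n] : SSet.{u}).Subcomplex).toSSet.Elements).obj
    ⟨op ⦋n⦌, ⟨stdSimplex.objEquiv.symm (𝟙 _), trivial⟩⟩ ⟶ 𝟭 _ where
  app σ := ⟨(stdSimplex.objEquiv σ.2.1).op, Subtype.ext (by
    have h : stdSimplex.objEquiv σ.2.1 ≫ 𝟙 _ = stdSimplex.objEquiv σ.2.1 := Category.comp_id _
    exact stdSimplex.objEquiv.injective h)⟩
  naturality σ τ f := by
    refine Subtype.ext ?_
    have h := congrArg (fun ρ : (⊤ : (Δ[n] : SSet.{u}).Subcomplex).toSSet.obj τ.1 ↦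
      (stdSimplex.objEquiv ρ.1).op) f.2
    refine (Category.id_comp _).trans h.symm

/-- The top simplex is an initial object of the category of simplices of `Δ[n]`, so `S_n` is
equivalent to `Sext` of the full simplex; two out of three does the rest. -/
lemma isHomotopyEquiv_restrict_iff [∀ k, KanComplex (S.obj k)] {n : ℕ}
    (K : (Δ[n] : SSet.{u}).Subcomplex) : IsHomotopyEquiv (restrict S K) ↔ Loc S K ⊤ := by
  have h : restrict S K = restrict S ⊤ ≫ SextInc S (le_top : K ≤ ⊤) := by
    refine Fam.ofHom_injective (F := simplexDiagram S K.toSSet) ?_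
    rfl
  have h₀ : IsHomotopyEquiv (restrict S (⊤ : (Δ[n] : SSet.{u}).Subcomplex)) := by
    have h := isHomotopyEquiv_toHolim_initialCone (fromTopSimplex.{u} n)
      (F := simplexDiagram S (⊤ : (Δ[n] : SSet.{u}).Subcomplex).toSSet)
      (Subtype.ext (by rfl))
    exact h
  rw [h, h₀.comp_iff_right]
  exact ⟨fun h ↦ ⟨le_top, h⟩, fun h ↦ h.2⟩

end Local
-- Chains below an element, with and without an added top.
section Collapse

open SSet Simplicial modelCategoryQuillen HomotopicalAlgebra CartesianMonoidalCategory

lemma exists_relative_homotopy_lift_zero {A X E B : SSet.{u}} (i : A ⟶ X) [Mono i] (p : E ⟶ B)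
    [Fibration p] (f : X ⟶ E) (g : A ⊗ Δ[1] ⟶ E) (h : X ⊗ Δ[1] ⟶ B) (hfg : i ≫ f = ι₀ ≫ g)
    (hf : f ≫ p = ι₀ ≫ h) (hg : g ≫ p = i ▷ _ ≫ h) :
    ∃ l : X ⊗ Δ[1] ⟶ E, ι₀ ≫ l = f ∧ i ▷ _ ≫ l = g ∧ l ≫ p = h := by
  obtain ⟨l, hl, hl', hlp⟩ := exists_extension i (anodyneExtensions_δ 1) p (fst _ _ ≫ f) g h
    (by rw [whiskerRight_fst_assoc, hfg]; erw [whiskerLeft_δ_one]; simp)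
    (by rw [Category.assoc, hf]; erw [whiskerLeft_δ_one]; rw [Category.assoc]) hg
  refine ⟨l, ?_, hl', hlp⟩
  have h2 : (fst X Δ[0] ≫ ι₀) ≫ l = fst X Δ[0] ≫ f := by rw [← hl, ← whiskerLeft_δ_one]
  simpa using congrArg (fun k ↦ lift (𝟙 X) (SSet.const (stdSimplex.obj₀Equiv.symm 0)) ≫ k) h2

/-- The inclusion of a strong deformation retract is an anodyne extension. -/
lemma anodyneExtensions_of_retract {A B : SSet.{u}} (j : A ⟶ B) [Mono j] (r : B ⟶ A)
    (h : B ⊗ Δ[1] ⟶ B) (h₀ : ι₀ ≫ h = r ≫ j) (h₁ : ι₁ ≫ h = 𝟙 B)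
    (hA : j ▷ Δ[1] ≫ h = fst _ _ ≫ j) : anodyneExtensions j := by
  intro E D p hp
  rw [← HomotopicalAlgebra.fibration_iff] at hp
  have hr : j ≫ r = 𝟙 A := by
    rw [← cancel_mono j, Category.assoc, ← h₀, ← ι₀_comp_assoc, hA]
    simp
  refine ⟨fun {a b} sq ↦ ?_⟩
  obtain ⟨l, -, hl, hlp⟩ := exists_relative_homotopy_lift_zero j p (r ≫ a) (fst _ _ ≫ a) (h ≫ b)
    (by rw [reassoc_of% hr]; simp) (by rw [Category.assoc, sq.w, reassoc_of% h₀])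
    (by rw [Category.assoc, sq.w, reassoc_of% hA])
  refine ⟨⟨{ l := ι₁ ≫ l, fac_left := ?_, fac_right := ?_ }⟩⟩
  · rw [← ι₁_comp_assoc, hl]
    simp
  · rw [Category.assoc, hlp, reassoc_of% h₁]

variable {P : Type u} [PartialOrder P]

/-- Constructor for chains in partially ordered sets. -/
def chainOfMonotone {Q : Type*} [Preorder Q] {n : ℕ} (f : Fin (n + 1) → Q) (hf : Monotone f) :
    ComposableArrows Q n := hf.functor

lemma chain_le {Q : Type*} [Preorder Q] {n : ℕ} (c : ComposableArrows Q n) {i j : Fin (n + 1)}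
    (h : i ≤ j) : c.obj i ≤ c.obj j := leOfHom (c.map (homOfLE h))

/-- The chains of elements below `A`. -/
def below (A : P) : (nerve (WithTop P)).Subcomplex where
  obj k := Set.ofPred fun d : ComposableArrows (WithTop P) k.unop.len ↦ ∀ i, d.obj i ≤ A
  map _ _ hd _ := hd _

/-- The chains of elements below `A` and the top element. -/
def belowTop (A : P) : (nerve (WithTop P)).Subcomplex where
  obj k := Set.ofPred fun d : ComposableArrows (WithTop P) k.unop.len ↦
    ∀ i, d.obj i = ⊤ ∨ d.obj i ≤ A
  map _ _ hd _ := hd _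

lemma below_le_belowTop (A : P) : below A ≤ belowTop A := fun _ _ hd i ↦ Or.inr (hd i)

lemma below_mono {A B : P} (h : A ≤ B) : below A ≤ below B :=
  fun _ _ hd i ↦ (hd i).trans (WithTop.coe_le_coe.2 h)

lemma belowTop_mono {A B : P} (h : A ≤ B) : belowTop A ≤ belowTop B :=
  fun _ _ hd i ↦ (hd i).imp id fun h' ↦ h'.trans (WithTop.coe_le_coe.2 h)

open Classical in
/-- Send the top element to `A`. -/
noncomputable def collapseTop (A : P) (x : WithTop P) : WithTop P := if x = ⊤ then A else x

lemma collapseTop_of_le {A : P} {x : WithTop P} (h : x ≤ A) : collapseTop A x = x :=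
  if_neg fun hx ↦ by simp [hx] at h

lemma collapseTop_le {A : P} {x : WithTop P} (h : x = ⊤ ∨ x ≤ A) : collapseTop A x ≤ A := by
  rw [collapseTop]
  split_ifs with hx
  exacts [le_rfl, h.resolve_left hx]

lemma collapseTop_le_self (A : P) (x : WithTop P) : collapseTop A x ≤ x := by
  rw [collapseTop]
  split_ifs with hx
  exacts [hx ▸ le_top, le_rfl]

lemma collapseTop_mono {A : P} {x y : WithTop P} (hx : x = ⊤ ∨ x ≤ A) (h : x ≤ y) :
    collapseTop A x ≤ collapseTop A y := by
  by_cases hy : y = ⊤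
  · rw [hy, collapseTop.eq_def A ⊤, if_pos rfl]
    exact collapseTop_le hx
  · rw [collapseTop.eq_def A y, if_neg hy]
    exact (collapseTop_le_self A x).trans h

/-- The retraction onto the chains below `A`. -/
noncomputable def belowRetraction (A : P) : (belowTop A).toSSet ⟶ (below A).toSSet where
  app k := ↾fun d ↦ ⟨chainOfMonotone
    (fun i ↦ collapseTop A (Functor.obj (C := Fin (k.unop.len + 1)) d.1 i))
    fun i _ h ↦ collapseTop_mono (d.2 i) (chain_le (n := k.unop.len) d.1 h),
    fun i ↦ collapseTop_le (d.2 i)⟩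
  naturality _ _ _ := rfl

lemma eq_zero_of_le_zero {x y : Fin 2} (h : x ≤ y) (hy : y = 0) : x = 0 := by omega

open Classical in
/-- The deformation to the chains below `A`. -/
noncomputable def belowHomotopy (A : P) : (belowTop A).toSSet ⊗ Δ[1] ⟶ (belowTop A).toSSet where
  app k := ↾fun d ↦ ⟨chainOfMonotone (fun i ↦ if stdSimplex.objEquiv d.2 i = 0 then
      collapseTop A (Functor.obj (C := Fin (k.unop.len + 1)) d.1.1 i)
      else (Functor.obj (C := Fin (k.unop.len + 1)) d.1.1 i)) fun i j h ↦ by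
      have h₀ := chain_le (n := k.unop.len) d.1.1 h
      have h₁ := (stdSimplex.objEquiv d.2).toOrderHom.monotone h
      dsimp only
      split_ifs with hi hj hj
      · exact collapseTop_mono (d.1.2 i) h₀
      · exact (collapseTop_le_self A _).trans h₀
      · exact (hi (eq_zero_of_le_zero h₁ hj)).elim
      · exact h₀, fun i ↦ by
        change (if _ then _ else _) = _ ∨ (if _ then _ else _) ≤ _
        split_ifs
        exacts [Or.inr (collapseTop_le (d.1.2 i)), d.1.2 i]⟩
  naturality _ _ _ := rfl

/-- On the vertices that occur, sending `⊤` to `A` is monotone and lies below the identity, so it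
gives a strong deformation retraction. -/
lemma anodyneExtensions_below (A : P) :
    anodyneExtensions (Subcomplex.homOfLE (below_le_belowTop A)) := by
  refine anodyneExtensions_of_retract _ (belowRetraction A) (belowHomotopy A) ?_ ?_ ?_
  · ext k d
    refine Subtype.ext (composableArrows_ext fun i ↦ ?_)
    exact if_pos (e := Functor.obj (C := Fin (k.unop.len + 1)) d.1 i)
      (show (0 : Fin 2) = 0 from rfl)
  · ext k d
    refine Subtype.ext (composableArrows_ext fun i ↦ ?_)
    exact if_neg (t := collapseTop A (Functor.obj (C := Fin (k.unop.len + 1)) d.1 i))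
      (show ¬ (1 : Fin 2) = 0 by decide)
  · ext k d
    refine Subtype.ext (composableArrows_ext fun i ↦ ?_)
    exact (if_congr Iff.rfl (collapseTop_of_le (d.1.2 i)) rfl).trans (ite_self _)

/-- The chain in `P` given by a chain in `WithTop P`. -/
def untopChain {n : ℕ} (d : ComposableArrows (WithTop P) n) (h : ∀ i, d.obj i ≠ ⊤) :
    ComposableArrows P n :=
  chainOfMonotone (fun i ↦ (d.obj i).untop (h i)) fun i j hij ↦ by
    rw [← WithTop.coe_le_coe, WithTop.coe_untop, WithTop.coe_untop]
    exact chain_le d hij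

lemma ne_top_of_mem_below {A : P} {x : WithTop P} (h : x ≤ A) : x ≠ ⊤ := by
  rintro rfl
  simp at h

open Classical in
/-- The chain in `WithTop P` which is constant on one part and equal to `c` on the other part. -/
noncomputable def mixChain {n : ℕ} (c : ComposableArrows P n) (e : ComposableArrows (Fin 2) n) :
    ComposableArrows (WithTop P) n :=
  chainOfMonotone (fun i ↦ if e.obj i = 0 then (c.obj i : WithTop P) else ⊤) fun i j hij ↦ by
    dsimp only
    split_ifs with hi hj hj
    · exact WithTop.coe_le_coe.2 (chain_le c hij)
    · exact le_top
    · exact (hi (eq_zero_of_le_zero (chain_le e hij) hj)).elim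
    · exact le_rfl

lemma mixChain_mem {k : SimplexCategoryᵒᵖ} (c : ComposableArrows P k.unop.len)
    (e : ComposableArrows (Fin 2) k.unop.len) :
    mixChain c e ∈ (belowTop (c.obj (Fin.last _))).obj k := by
  intro i
  change (if _ then _ else _) = _ ∨ (if _ then _ else _) ≤ _
  split_ifs
  exacts [Or.inr (WithTop.coe_le_coe.2 (chain_le c (Fin.le_last i))), Or.inl rfl]

lemma mixChain_zero {n : ℕ} (c : ComposableArrows P n) (e : ComposableArrows (Fin 2) n)
    (he : ∀ i, e.obj i = 0) : ∀ i, (mixChain c e).obj i = c.obj i := fun i ↦ if_pos (he i)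

lemma mixChain_one {n : ℕ} (c : ComposableArrows P n) (e : ComposableArrows (Fin 2) n)
    (he : ∀ i, e.obj i = 1) : ∀ i, (mixChain c e).obj i = ⊤ := fun i ↦
  if_neg (by rw [he i]; decide)

variable {F : P ⥤ SSet.{u}} {Y : SSet.{u}}

/-- The maps given by a family on the chains below an element. -/
def Fam.below (t : Fam F Y) (A : P) : Y ⊗ (HigherHall.below A).toSSet ⟶ F.obj A where
  app k := ↾fun x ↦ (F.map (homOfLE (by
      have h := x.2.2 (Fin.last _)
      rw [← WithTop.coe_le_coe]
      refine le_of_eq_of_le ?_ h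
      exact WithTop.coe_untop _ (ne_top_of_mem_below h)))).app k
    (t.val k (untopChain (n := k.unop.len) x.2.1 fun i ↦ ne_top_of_mem_below (x.2.2 i)) x.1)
  naturality k k' θ := by
    ext x
    refine Eq.trans ?_ (NatTrans.naturality_apply (F.map _) θ _)
    have h := t.compat θ (untopChain (n := k.unop.len) x.2.1
      fun i ↦ ne_top_of_mem_below (x.2.2 i)) x.1
    refine Eq.trans ?_ (congrArg ((F.map _).app k') h.symm)
    exact Eq.trans (by rfl) (functor_map_app_comp F _ _ _).symm

lemma Fam.below_comp_map (t : Fam F Y) {A B : P} (h : A ≤ B) :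
    t.below A ≫ F.map (homOfLE h) = Y ◁ Subcomplex.homOfLE (below_mono h) ≫ t.below B := by
  ext k x
  exact functor_map_app_comp F _ _ _

end Collapse
-- `Sext` of a union as a homotopy limit over a finite poset.
section UnionLimit

open SSet Simplicial modelCategoryQuillen HomotopicalAlgebra CartesianMonoidalCategory

variable (S : SimplexCategoryᵒᵖ ⥤ SSet.{u}) {X : SSet.{u}} {P : Type u} [PartialOrder P]
  {K : P → X.Subcomplex} (hK : Antitone K)

/-- The diagram of the values of `Sext` on a family of simplicial subsets. -/
abbrev SextDiagram : P ⥤ SSet.{u} where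
  obj a := (Sext S).obj (op (K a).toSSet)
  map f := SextInc S (hK (leOfHom f))
  map_id a := SextInc_refl S (K a)
  map_comp _ _ := (SextInc_comp S _ _).symm

/-- The canonical cone over the diagram of the values of `Sext`. -/
abbrev SextCone {L : X.Subcomplex} (hL : ∀ a, K a ≤ L) :
    (Functor.const P).obj ((Sext S).obj (op L.toSSet)) ⟶ SextDiagram S hK where
  app a := SextInc S (hL a)
  naturality a b f := by
    change 𝟙 _ ≫ SextInc S _ = SextInc S _ ≫ SextInc S _
    rw [Category.id_comp, SextInc_comp]

variable {S hK}

lemma toHolim_comp_holimEval {J : Type u} [Category.{v} J] {F : J ⥤ SSet.{max u v}}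
    {Y : SSet.{max u v}} (c : (Functor.const J).obj Y ⟶ F) (j : J) :
    toHolim c ≫ holimEval F j = c.app j := by
  ext k y
  have h := congrArg (fun t ↦ t.val k ((Functor.const _).obj j) y) (Fam.ofHom_toHolim c)
  exact h

/-- Evaluation at `a` recovers the restriction to `K a`, and these restrictions jointly determine a
map into `Sext` of the union. Being a monomorphism allows relative extension along this map below.
-/
instance mono_toHolim_SextCone : Mono (toHolim (SextCone S hK (le_iSup K))) where
  right_cancellation {Z} f g h := by
    refine Sext_hom_ext (le_iSup K) le_rfl fun a ↦ ?_
    have h' := h =≫ holimEval _ a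
    rw [Category.assoc, Category.assoc, toHolim_comp_holimEval] at h'
    exact h'

/-- The canonical family on the homotopy limit. -/
abbrev univFam (F : P ⥤ SSet.{u}) : Fam F (holim F) := Fam.ofHom (𝟙 (holim F))

lemma toHolim_whiskerRight_below {F : P ⥤ SSet.{u}} {Y : SSet.{u}}
    (c : (Functor.const P).obj Y ⟶ F) (A : P) :
    toHolim c ▷ _ ≫ (univFam F).below A = fst _ _ ≫ c.app A := by
  ext k x
  let d := untopChain (n := k.unop.len) x.2.1 fun i ↦ ne_top_of_mem_below (x.2.2 i)
  have hd : d.obj (Fin.last _) ≤ A := by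
    rw [← WithTop.coe_le_coe]
    exact le_of_eq_of_le (WithTop.coe_untop _ _) (x.2.2 (Fin.last _))
  have h := congrArg (fun t ↦ t.val k d x.1) (Fam.ofHom_toHolim c)
  refine (congrArg ((F.map (homOfLE hd)).app k) h).trans ?_
  have h' := congr_app (c.naturality (homOfLE hd)) k
  exact (ConcreteCategory.congr_hom h' x.1).symm

/-- Compatible partial extensions of the canonical family to the chains in `WithTop P`. -/
structure IsExtendedOn (U : Set P) (e : ∀ A, holim (SextDiagram S hK) ⊗ (belowTop A).toSSet ⟶
    (SextDiagram S hK).obj A) : Prop where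
  natural {A B : P} (h : A ≤ B) : A ∈ U → B ∈ U → e A ≫ SextInc S (hK h) =
    _ ◁ Subcomplex.homOfLE (belowTop_mono h) ≫ e B
  below {A : P} : A ∈ U →
    _ ◁ Subcomplex.homOfLE (below_le_belowTop A) ≫ e A = (univFam _).below A
  cone {A : P} : A ∈ U →
    toHolim (SextCone S hK (le_iSup K)) ▷ _ ≫ e A = fst _ _ ≫ SextInc S (le_iSup K A)

/-- The data already chosen for `B > A` glue to a map into `Sext` of the union `M` of the smaller
pieces, as `hjoin` covers intersections by pieces further up. The value at `A` is a lift through the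
fibration from `Sext (K A)` to `Sext M`, relative to chains below `A` (anodyne) and to `Sext` of the
whole union (a monomorphism). -/
lemma exists_isExtendedOn_insert [∀ k, KanComplex (S.obj k)]
    (hjoin : ∀ a b : P, ∃ c, a ≤ c ∧ b ≤ c ∧ K a ⊓ K b ≤ K c) {U : Set P} (A : P)
    (hA : A ∉ U) (hAU : ∀ B, A < B → B ∈ U) (hU : ∀ B ∈ U, ¬ B ≤ A)
    {e : ∀ A, holim (SextDiagram S hK) ⊗ (belowTop A).toSSet ⟶ (SextDiagram S hK).obj A}
    (he : IsExtendedOn U e) : ∃ e' : ∀ A, holim (SextDiagram S hK) ⊗ (belowTop A).toSSet ⟶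
      (SextDiagram S hK).obj A, IsExtendedOn (insert A U) e' := by
  classical
  let M : X.Subcomplex := ⨆ B : {B : P // A < B}, K B.1
  have hM : ∀ B : {B : P // A < B}, K B.1 ≤ M := fun B ↦ le_iSup (fun B : {B : P // A < B} ↦ K B.1) B
  have hMA : M ≤ K A := iSup_le fun B ↦ hK B.2.le
  obtain ⟨h, hh⟩ := exists_Sext_glue (S := S) hM le_rfl
    (fun B ↦ _ ◁ Subcomplex.homOfLE (belowTop_mono B.2.le) ≫ e B.1) (by
      intro B B'
      obtain ⟨C, hBC, hBC', hC⟩ := hjoin B.1 B'.1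
      have hCU := hAU C (B.2.trans_le hBC)
      rw [← SextInc_comp S hC (hK hBC), ← SextInc_comp S hC (hK hBC'), Category.assoc,
        Category.assoc, reassoc_of% he.natural hBC (hAU _ B.2) hCU,
        reassoc_of% he.natural hBC' (hAU _ B'.2) hCU]
      rfl)
  obtain ⟨l, hl₁, hl₂, hl₃⟩ := exists_extension (toHolim (SextCone S hK (le_iSup K)))
    (anodyneExtensions_below A) (SextInc S hMA) ((univFam _).below A)
    (fst _ _ ≫ SextInc S (le_iSup K A)) h (by
      rw [toHolim_whiskerRight_below, whiskerLeft_fst_assoc]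
      rfl) (by
      refine Sext_hom_ext hM le_rfl fun B ↦ ?_
      rw [Category.assoc, SextInc_comp, Category.assoc, hh]
      have h₁ := (univFam (SextDiagram S hK)).below_comp_map B.2.le
      refine h₁.trans ?_
      rw [← he.below (hAU _ B.2)]
      rfl) (by
      refine Sext_hom_ext hM le_rfl fun B ↦ ?_
      rw [Category.assoc, Category.assoc, SextInc_comp, SextInc_comp, Category.assoc, hh,
        ← whisker_exchange_assoc, he.cone (hAU _ B.2)]
      rw [whiskerLeft_fst_assoc])
  have hne : ∀ B ∈ U, B ≠ A := fun B hB h ↦ hA (h ▸ hB)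
  refine ⟨Function.update e A l, ⟨?_, ?_, ?_⟩⟩
  · rintro B C hBC (rfl | hB) (rfl | hC)
    · rw [Function.update_self]
      exact (Category.comp_id _).trans
        ((MonoidalCategory.whiskerLeft_id _ _ =≫ l).trans (Category.id_comp _)).symm
    · rw [Function.update_self, Function.update_of_ne (hne C hC)]
      have hBC' : B < C := lt_of_le_of_ne hBC (hne C hC).symm
      have := hh ⟨C, hBC'⟩
      rw [← hl₃, Category.assoc, SextInc_comp] at this
      exact this
    · exact (hU B hB hBC).elim
    · rw [Function.update_of_ne (hne C hC), Function.update_of_ne (hne B hB)]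
      exact he.natural hBC hB hC
  · rintro B (rfl | hB)
    · rw [Function.update_self]
      exact hl₁
    · rw [Function.update_of_ne (hne B hB)]
      exact he.below hB
  · rintro B (rfl | hB)
    · rw [Function.update_self]
      exact hl₂
    · rw [Function.update_of_ne (hne B hB)]
      exact he.cone hB

/-- Larger elements come first: a minimal element of the upper set is removed and its value is
chosen last. -/
lemma exists_isExtendedOn [∀ k, KanComplex (S.obj k)] [Finite P]
    (hjoin : ∀ a b : P, ∃ c, a ≤ c ∧ b ≤ c ∧ K a ⊓ K b ≤ K c) (U : Set P) (hU : IsUpperSet U) :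
    ∃ e : ∀ A, holim (SextDiagram S hK) ⊗ (belowTop A).toSSet ⟶ (SextDiagram S hK).obj A,
      IsExtendedOn U e := by
  induction' h : U.ncard with n ih generalizing U
  · obtain rfl : U = ∅ := (Set.ncard_eq_zero U.toFinite).1 h
    exact ⟨fun A ↦ fst _ _ ≫ holimEval _ A, by constructor <;> simp⟩
  · obtain ⟨A, hA⟩ := U.toFinite.exists_minimal (Set.nonempty_of_ncard_ne_zero (by omega))
    have hU' : IsUpperSet (U \ {A}) := fun B C hBC hB ↦
      ⟨hU hBC hB.1, fun hC ↦ hB.2 (le_antisymm (hBC.trans_eq hC) (hA.2 hB.1 (hBC.trans_eq hC)))⟩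
    obtain ⟨e, he⟩ := ih (U \ {A}) hU' (by
      have := Set.ncard_sdiff_singleton_add_one hA.1
      omega)
    obtain ⟨e', he'⟩ := exists_isExtendedOn_insert hjoin A
      (U := U \ {A}) (by simp) (fun B hB ↦ ⟨hU hB.le hA.1, hB.ne'⟩) (fun B hB hBA ↦ hB.2 (le_antisymm hBA (hA.2 hB.1 hBA))) he
    rw [Set.insert_sdiff_singleton, Set.insert_eq_of_mem hA.1] at he'
    exact ⟨e', he'⟩

/-- `Sext` of a union of simplicial subsets is a homotopy limit. -/
lemma isHomotopyEquiv_toHolim_SextCone [∀ k, KanComplex (S.obj k)] [Finite P]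
    (hjoin : ∀ a b : P, ∃ c, a ≤ c ∧ b ≤ c ∧ K a ⊓ K b ≤ K c) :
    IsHomotopyEquiv (toHolim (SextCone S hK (le_iSup K))) := by
  obtain ⟨e, he⟩ := exists_isExtendedOn (hK := hK) (S := S) hjoin Set.univ isUpperSet_univ
  -- At the added top the extended family is strictly compatible in `A`, so it glues to a map `g`
  -- back to `Sext` of the union.
  let topVertex : ∀ A : P, holim (SextDiagram S hK) ⟶
      holim (SextDiagram S hK) ⊗ (belowTop A).toSSet := fun A ↦
    { app k := ↾fun y ↦ (y, ⟨chainOfMonotone (fun _ ↦ ⊤) monotone_const, fun _ ↦ Or.inl rfl⟩)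
      naturality _ _ _ := rfl }
  have htop : ∀ {A B : P} (h : A ≤ B), (topVertex A ≫ e A) ≫ SextInc S (hK h) =
      topVertex B ≫ e B := by
    intro A B h
    rw [Category.assoc, he.natural h trivial trivial]
    rfl
  obtain ⟨g, hg⟩ := exists_Sext_glue (S := S) (le_iSup K) le_rfl (fun A ↦ topVertex A ≫ e A) (by
    intro A B
    obtain ⟨C, hAC, hBC, hC⟩ := hjoin A B
    rw [← SextInc_comp S hC (hK hAC), ← SextInc_comp S hC (hK hBC), ← Category.assoc,
      ← Category.assoc, htop hAC, htop hBC])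
  refine isHomotopyEquiv_iff.2 ⟨g, .of_eq (Sext_hom_ext (le_iSup K) le_rfl fun A ↦ ?_),
    Homotopic.symm ?_⟩
  · have h : toHolim (SextCone S hK (le_iSup K)) ≫ topVertex A = 
        lift (𝟙 _) (toHolim (SextCone S hK (le_iSup K)) ≫ topVertex A ≫ snd _ _) ≫
          toHolim (SextCone S hK (le_iSup K)) ▷ _ := rfl
    rw [Category.assoc, hg, reassoc_of% h, he.cone trivial]
    simp
  -- Moving a chain vertex by vertex to the added top is a homotopy from the identity, at time 0, to
  -- `g` followed by the canonical map, at time 1.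
  · let T : Fam (SextDiagram S hK) (holim (SextDiagram S hK) ⊗ Δ[1]) :=
      { val k c y := (e (c.obj (Fin.last _))).app k
          (y.1, ⟨mixChain c (toChain (stdSimplex.objEquiv y.2)), mixChain_mem _ _⟩)
        compat {k k'} θ c y := by
          refine (NatTrans.naturality_apply (e (c.obj (Fin.last _))) θ _).symm.trans ?_
          have h := congr_app (he.natural (leOfHom (lastHom θ c)) trivial trivial) k'
          exact (ConcreteCategory.congr_hom h
            (show (holim (SextDiagram S hK)).obj k' × (belowTop _).toSSet.obj k' from
              (_, ⟨mixChain (restr θ c) (restr θ (toChain (stdSimplex.objEquiv y.2))),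
                mixChain_mem _ _⟩))).symm }
    refine ⟨T.toHom, Fam.ofHom_injective ?_, Fam.ofHom_injective ?_⟩
    · rw [Fam.ofHom_comp, Fam.ofHom_toHom]
      ext k c y
      have h₀ := mixChain_zero c ((Functor.const _).obj 0) fun _ ↦ rfl
      have h₁ : ∀ i, (mixChain c ((Functor.const _).obj 0)).obj i ≠ ⊤ := fun i ↦ by
        rw [h₀]
        exact WithTop.coe_ne_top
      have h₂ : untopChain (mixChain c ((Functor.const _).obj 0)) h₁ = c :=
        composableArrows_ext fun i ↦ WithTop.coe_injective ((WithTop.coe_untop _ (h₁ i)).trans (h₀ i))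
      have h := congr_app (he.below (A := c.obj (Fin.last _)) trivial) k
      refine (ConcreteCategory.congr_hom h
        (show (holim (SextDiagram S hK)).obj k × (below _).toSSet.obj k from
          (y, ⟨mixChain c ((Functor.const _).obj 0), fun i ↦ (h₀ i).trans_le
            (WithTop.coe_le_coe.2 (chain_le c (Fin.le_last i)))⟩))).trans ?_
      refine ((univFam _).map_val_congr h₂ (j := c.obj (Fin.last _))
        (eqToHom (congrArg (fun d ↦ d.obj (Fin.last _)) h₂)) (𝟙 _)
        (Subsingleton.helim (by rw [h₂]) _ _) y).trans ?_
      exact functor_map_app_self (SextDiagram S hK) _ ((univFam (SextDiagram S hK)).val k c y)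
    · rw [Fam.ofHom_comp, Fam.ofHom_toHom, Fam.ofHom_comp, Fam.ofHom_toHolim]
      ext k c y
      have h := congr_app (hg (c.obj (Fin.last _))) k
      refine Eq.trans ?_ (ConcreteCategory.congr_hom h y).symm
      refine congrArg (fun d ↦ (e (c.obj (Fin.last _))).app k (y, d)) (Subtype.ext ?_)
      exact composableArrows_ext (mixChain_one c ((Functor.const _).obj 1) fun _ ↦ rfl)

end UnionLimit
-- Pullback cubes of values of `Sext`.
section Cubes

open SSet Simplicial HomotopicalAlgebra

instance : Finite Two.{u} := by
  refine Finite.of_injective (β := Prop) (fun x ↦ x = .zero) ?_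
  rintro (_ | _) (_ | _) h <;> simp_all

instance (m : ℕ) : Finite (Vertex.{u} m) := inferInstanceAs (Finite (Fin m → Two.{u}))

/-- A natural isomorphism of diagrams induces an isomorphism of homotopy limits. -/
def holimIso {J : Type u} [Category.{v} J] {F G : J ⥤ SSet.{max u v}} (e : F ≅ G) :
    holim F ≅ holim G :=
  Functor.isoWhiskerLeft _ (yoneda.mapIso e)

lemma toHolim_comp_holimIso_hom {J : Type u} [Category.{v} J] {F G : J ⥤ SSet.{max u v}}
    (e : F ≅ G) {Y : SSet.{max u v}} (c : (Functor.const J).obj Y ⟶ F) :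
    toHolim c ≫ (holimIso e).hom = toHolim (c ≫ e.hom) := by
  ext q x
  exact (Category.assoc _ _ _).trans (congrArg _ (Category.assoc _ _ _))

lemma comp_toHolim {J : Type u} [Category.{v} J] {F : J ⥤ SSet.{max u v}}
    {Y Z : SSet.{max u v}} (f : Y ⟶ Z) (c : (Functor.const J).obj Z ⟶ F) :
    f ≫ toHolim c = toHolim ((Functor.const J).map f ≫ c) := by
  refine Fam.ofHom_injective ?_
  rw [Fam.ofHom_comp, Fam.ofHom_toHolim, Fam.ofHom_toHolim]
  rfl

lemma Cube.IsPullback.iff_of_iso {m : ℕ} {Q Q' : Cube.{u} SSet.{u} m} (e : Q ≅ Q')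
    [∀ a, KanComplex (Q.obj a)] [∀ a, KanComplex (Q'.obj a)] : Q.IsPullback ↔ Q'.IsPullback := by
  have h : ∀ a, KanComplex (Q.punctured.obj a) := fun a ↦ inferInstanceAs (KanComplex (Q.obj a))
  have h' : ∀ a, KanComplex (Q'.punctured.obj a) := fun a ↦ inferInstanceAs (KanComplex (Q'.obj a))
  refine IsHomotopyEquiv.of_arrow_iso (e.hom.app _)
    (holimIso (F := Q.punctured) (G := Q'.punctured) (Functor.isoWhiskerLeft _ e)).hom ?_
  rw [Cube.comparison, Cube.comparison, toHolim_comp_holimIso_hom, comp_toHolim]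
  congr 1
  ext a : 2
  exact e.hom.naturality _

variable {S : SimplexCategoryᵒᵖ ⥤ SSet.{u}} {X : SSet.{u}}

/-- The comparison map factors as restriction to the union of the non-initial pieces, followed by
the equivalence of that union with the homotopy limit. -/
lemma isPullback_SextDiagram_iff [∀ k, KanComplex (S.obj k)] {m : ℕ}
    {K : Vertex.{u} m → X.Subcomplex} (hK : Antitone K)
    (hjoin : ∀ a b, ∃ c, a ≤ c ∧ b ≤ c ∧ K a ⊓ K b ≤ K c) :
    Cube.IsPullback (SextDiagram S hK) ↔
      Loc S (⨆ a : Punctured.{u} m, K a.1) (K (Vertex.init m)) := by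
  let K' : Punctured.{u} m → X.Subcomplex := fun a ↦ K a.1
  have hK' : Antitone K' := fun a b h ↦ hK h
  have hL : ⨆ a, K' a ≤ K (Vertex.init m) := iSup_le fun a ↦ hK a.1.init_le
  -- An upper bound of a non-initial vertex is non-initial, so puncturing the cube preserves the
  -- covering hypothesis.
  have h := isHomotopyEquiv_toHolim_SextCone (S := S) (hK := hK') (by
    intro a b
    obtain ⟨c, hac, hbc, hc⟩ := hjoin a.1 b.1
    exact ⟨⟨c, fun h ↦ a.2 (le_antisymm (hac.trans h.le) a.1.init_le)⟩, hac, hbc, hc⟩)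
  have h' : Cube.comparison (SextDiagram S hK) =
      SextInc S hL ≫ toHolim (SextCone S hK' (le_iSup K')) := by
    rw [comp_toHolim]
    refine congrArg toHolim ?_
    ext a : 2
    exact (SextInc_comp S (le_iSup K' a) hL).symm
  have hKan : KanComplex (holim (SextDiagram S hK')) :=
    kanComplex_holim _ 
  rw [Cube.IsPullback, h']
  refine (IsHomotopyEquiv.comp_iff_left h).trans ⟨fun H ↦ ⟨hL, H⟩, fun H ↦ H.2⟩

end Cubes
-- Subcomplexes of a simplex given by lower sets of vertex sets.
section Polygons

open SSet Simplicial HomotopicalAlgebra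

variable {n : ℕ}

/-- The set of vertices of a simplex of `Δ[n]`. -/
def vertices {k : SimplexCategoryᵒᵖ} (s : (Δ[n] : SSet.{u}).obj k) : Set (Fin (n + 1)) :=
  Set.range (stdSimplex.objEquiv s).toOrderHom

/-- The simplicial subset of `Δ[n]` given by a family of sets of vertices. -/
def sub (𝓕 : LowerSet (Set (Fin (n + 1)))) : (Δ[n] : SSet.{u}).Subcomplex where
  obj k := Set.ofPred fun s ↦ vertices s ∈ 𝓕
  map θ s hs := 𝓕.lower (by rintro _ ⟨i, rfl⟩; exact ⟨θ.unop.toOrderHom i, rfl⟩) hs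

lemma sub_inf (𝓕 𝓖 : LowerSet (Set (Fin (n + 1)))) : sub.{u} (𝓕 ⊓ 𝓖) = sub 𝓕 ⊓ sub 𝓖 := rfl

lemma sub_top : sub.{u} (⊤ : LowerSet (Set (Fin (n + 1)))) = ⊤ := rfl

/-- The family of all subsets of the members of a list. -/
def listUnion (l : List (Set (Fin (n + 1)))) : LowerSet (Set (Fin (n + 1))) :=
  l.foldr (fun Q 𝓕 ↦ LowerSet.Iic Q ⊔ 𝓕) ⊥

lemma listUnion_nil : listUnion ([] : List (Set (Fin (n + 1)))) = ⊥ := rfl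

lemma listUnion_cons (Q : Set (Fin (n + 1))) (l : List (Set (Fin (n + 1)))) :
    listUnion (Q :: l) = LowerSet.Iic Q ⊔ listUnion l := rfl

lemma mem_listUnion {l : List (Set (Fin (n + 1)))} {F : Set (Fin (n + 1))} :
    F ∈ listUnion l ↔ ∃ Q ∈ l, F ⊆ Q := by
  induction l with
  | nil => simp [listUnion_nil]
  | cons Q l ih => simp [listUnion_cons, ih]

lemma Iic_inf_listUnion (Q : Set (Fin (n + 1))) (l : List (Set (Fin (n + 1)))) :
    LowerSet.Iic Q ⊓ listUnion l = listUnion (l.map (Q ∩ ·)) := by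
  ext F
  simp only [LowerSet.coe_inf, Set.mem_inter_iff, SetLike.mem_coe, LowerSet.mem_Iic_iff,
    mem_listUnion, List.mem_map, exists_exists_and_eq_and, Set.subset_inter_iff]
  tauto

variable {S : SimplexCategoryᵒᵖ ⥤ SSet.{u}} [∀ k, KanComplex (S.obj k)]

/-- Inclusion-exclusion, by induction on the length. A member `Q` meets the union of the others in a
union of equally many sets `Q ∩ Q'`, good again, so the same induction hypothesis serves for both.
-/
lemma loc_listUnion {good : Set (Fin (n + 1)) → Prop}
    (hinter : ∀ Q Q', good Q → good Q' → good (Q ∩ Q')) {𝓣 : LowerSet (Set (Fin (n + 1)))}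
    (hgood : ∀ Q, good Q → Loc S (sub (LowerSet.Iic Q ⊓ 𝓣)) (sub (LowerSet.Iic Q)))
    (l : List (Set (Fin (n + 1)))) (hl : ∀ Q ∈ l, good Q) :
    Loc S (sub (listUnion l ⊓ 𝓣)) (sub (listUnion l)) := by
  induction h : l.length generalizing l with
  | zero =>
    obtain rfl := List.length_eq_zero_iff.1 h
    rw [listUnion_nil, bot_inf_eq]
    exact .refl _
  | succ k ih =>
    obtain ⟨Q, l, rfl⟩ := List.exists_cons_of_length_eq_add_one h
    have h' : l.length = k := by simpa using h
    refine Loc.sup_inf (A := sub (LowerSet.Iic Q)) (B := sub (listUnion l)) (T := sub 𝓣)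
      (hgood Q (hl Q (by simp))) (ih l (fun Q' hQ' ↦ hl Q' (by simp [hQ'])) h') ?_
    rw [← sub_inf, ← sub_inf, Iic_inf_listUnion]
    refine ih _ (fun Q' hQ' ↦ ?_) (by simpa using h')
    obtain ⟨Q'', hQ'', rfl⟩ := List.mem_map.1 hQ'
    exact hinter _ _ (hl Q (by simp)) (hl Q'' (by simp [hQ'']))

lemma loc_inf_of_cover {good : Set (Fin (n + 1)) → Prop}
    (hinter : ∀ Q Q', good Q → good Q' → good (Q ∩ Q')) {𝓕 𝓣 : LowerSet (Set (Fin (n + 1)))}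
    (hgood : ∀ Q ∈ 𝓕, good Q → Loc S (sub (LowerSet.Iic Q ⊓ 𝓣)) (sub (LowerSet.Iic Q)))
    (hcover : ∀ F ∈ 𝓕, ∃ Q ∈ 𝓕, F ⊆ Q ∧ good Q) : Loc S (sub (𝓕 ⊓ 𝓣)) (sub 𝓕) := by
  have hfin : {Q | Q ∈ 𝓕 ∧ good Q}.Finite := Set.toFinite _
  let l := hfin.toFinset.toList
  have hl : ∀ Q, Q ∈ l ↔ Q ∈ 𝓕 ∧ good Q := by simp [l]
  have h : 𝓕 = listUnion l := by
    ext F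
    simp only [SetLike.mem_coe, mem_listUnion, hl]
    constructor
    · intro hF
      obtain ⟨Q, hQ, hFQ, hQ'⟩ := hcover F hF
      exact ⟨Q, ⟨hQ, hQ'⟩, hFQ⟩
    · rintro ⟨Q, hQ, hFQ⟩
      exact 𝓕.lower hFQ hQ.1
  have := loc_listUnion (S := S) (good := fun Q ↦ Q ∈ 𝓕 ∧ good Q) (𝓣 := 𝓣)
    (fun Q Q' h h' ↦ ⟨𝓕.lower Set.inter_subset_left h.1, hinter _ _ h.2 h'.2⟩)
    (fun Q hQ ↦ hgood Q hQ.1 hQ.2) l (fun Q hQ ↦ (hl Q).1 hQ)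
  rwa [← h] at this

/-- The set `Q` has points strictly on both sides of the line through `x` and `y`. -/
def Separates (x y : Fin (n + 1)) (Q : Set (Fin (n + 1))) : Prop :=
  ∃ a ∈ Q, ∃ b ∈ Q, (x < a ∧ a < y) ∧ (b < x ∨ y < b)

/-- The sets of vertices on one of the sides of the line through `x` and `y`. -/
def sides (x y : Fin (n + 1)) : LowerSet (Set (Fin (n + 1))) where
  carrier := Set.ofPred fun Q ↦ ¬ Separates x y Q
  lower' _ _ h hQ := fun ⟨a, ha, b, hb, hab⟩ ↦ hQ ⟨a, h ha, b, h hb, hab⟩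

lemma mem_sides {x y : Fin (n + 1)} {Q : Set (Fin (n + 1))} :
    Q ∈ sides x y ↔ ¬ Separates x y Q := Iff.rfl

/-- The pair `x`, `y` is a diagonal of the polygon. -/
def IsDiagonal (x y : Fin (n + 1)) : Prop :=
  (x : ℕ) + 1 < y ∧ ¬ ((x : ℕ) = 0 ∧ (y : ℕ) = n)

lemma isDiagonal_iff (x y : Fin (n + 1)) : IsDiagonal x y ↔ Separates x y Set.univ := by
  constructor
  · rintro ⟨h₁, h₂⟩
    have hx : (x : ℕ) + 1 < n + 1 := by omega
    have ha : x < ⟨x + 1, hx⟩ ∧ (⟨x + 1, hx⟩ : Fin (n + 1)) < y := by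
      simp only [Fin.lt_def]
      omega
    by_cases h : (x : ℕ) = 0
    · refine ⟨⟨x + 1, hx⟩, trivial, Fin.last n, trivial, ha, Or.inr ?_⟩
      simp only [Fin.lt_def, Fin.val_last]
      omega
    · refine ⟨⟨x + 1, hx⟩, trivial, 0, trivial, ha, Or.inl ?_⟩
      simp only [Fin.lt_def, Fin.val_zero]
      omega
  · rintro ⟨a, -, b, -, h₁, h₂⟩
    constructor <;> simp only [Fin.lt_def] at h₁ h₂ <;> omega

variable (S) in
/-- The 2-Segal condition for a diagonal. -/
def DiagonalLoc (x y : Fin (n + 1)) : Prop := Loc S (sub (sides x y)) (⊤ : (Δ[n] : SSet.{u}).Subcomplex)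

/-- `Q` contains `x` and `y` if it has points strictly on both sides of the line through them. -/
def CutBy (x y : Fin (n + 1)) (Q : Set (Fin (n + 1))) : Prop :=
  Separates x y Q → x ∈ Q ∧ y ∈ Q

/-- Stability under intersection is what inclusion-exclusion needs; the sets that `x`, `y` do not
separate have to be admitted for it to hold. -/
lemma CutBy.inter {x y : Fin (n + 1)} {Q Q' : Set (Fin (n + 1))} (h : CutBy x y Q)
    (h' : CutBy x y Q') : CutBy x y (Q ∩ Q') := by
  rintro ⟨a, ha, b, hb, hab⟩
  have h₁ := h ⟨a, ha.1, b, hb.1, hab⟩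
  have h₂ := h' ⟨a, ha.2, b, hb.2, hab⟩
  exact ⟨⟨h₁.1, h₂.1⟩, ⟨h₁.2, h₂.2⟩⟩

lemma vertices_map {m : ℕ} (f : Fin (m + 1) ↪o Fin (n + 1)) {k : SimplexCategoryᵒᵖ}
    (s : (Δ[m] : SSet.{u}).obj k) :
    vertices ((SSet.stdSimplex.map (SimplexCategory.Hom.mk f.toOrderHom)).app k s) = f '' vertices s := by
  rw [vertices, vertices, ← Set.range_comp]
  rfl

lemma image_sub {m : ℕ} (f : Fin (m + 1) ↪o Fin (n + 1)) (𝓕 : LowerSet (Set (Fin (m + 1))))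
    (𝓖 : LowerSet (Set (Fin (n + 1)))) (h : ∀ F, F ∈ 𝓖 ↔ ∃ F' ∈ 𝓕, f '' F' = F) :
    (sub.{u} 𝓕).image (SSet.stdSimplex.map (SimplexCategory.Hom.mk f.toOrderHom)) = sub 𝓖 := by
  ext k s
  constructor
  · rintro ⟨s, hs, rfl⟩
    exact (h _).2 ⟨_, hs, (vertices_map f s).symm⟩
  · intro hs
    obtain ⟨F', hF', hF⟩ := (h _).1 hs
    have hmem : ∀ i, ∃ j, f j = (stdSimplex.objEquiv s).toOrderHom i ∧ j ∈ F' := by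
      intro i
      obtain ⟨j, hj, hj'⟩ := hF.symm.le ⟨i, rfl⟩
      exact ⟨j, hj', hj⟩
    choose g hg hg' using hmem
    have hgm : Monotone g := fun i j hij ↦ by
      rw [← f.le_iff_le, hg, hg]
      exact (stdSimplex.objEquiv s).toOrderHom.monotone hij
    refine ⟨stdSimplex.objEquiv.symm (SimplexCategory.Hom.mk ⟨g, hgm⟩), 𝓕.lower ?_ hF', ?_⟩
    · rintro _ ⟨i, rfl⟩
      exact hg' i
    · refine stdSimplex.objEquiv.injective ?_
      ext i : 3
      exact hg i

instance mono_stdSimplex_map {m : ℕ} (f : Fin (m + 1) ↪o Fin (n + 1)) :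
    Mono (SSet.stdSimplex.{u}.map (SimplexCategory.Hom.mk f.toOrderHom)) := by
  refine (mono_iff_app_injective _).2 fun k s t h ↦ ?_
  refine stdSimplex.objEquiv.injective ?_
  ext i : 3
  have h' := congrArg (fun r ↦ (stdSimplex.objEquiv r).toOrderHom i) h
  exact f.injective h'

/-- If `Q` is separated, it contains `x` and `y`, which form a diagonal of the smaller polygon `Q`.
The increasing enumeration of `Q` identifies the claim with the diagonal condition there. Otherwise
the two complexes coincide. -/
lemma loc_Iic_inf_sides {x y : Fin (n + 1)} {Q : Set (Fin (n + 1))} (hQ : CutBy x y Q)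
    (hS : ∀ m, m + 1 = Q.ncard → ∀ x y : Fin (m + 1), IsDiagonal x y → DiagonalLoc S x y) :
    Loc S (sub (LowerSet.Iic Q ⊓ sides x y)) (sub (LowerSet.Iic Q)) := by
  by_cases h : Separates x y Q
  swap
  · rw [inf_eq_left.2 (fun F hF ↦ (sides x y).lower hF h)]
    exact .refl _
  obtain ⟨m, hm⟩ : ∃ m, m + 1 = Q.ncard := by
    obtain ⟨a, ha, -⟩ := h
    have := (Set.ncard_pos (Set.toFinite Q)).2 ⟨a, ha⟩
    exact ⟨Q.ncard - 1, by omega⟩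
  classical
  let f : Fin (m + 1) ↪o Fin (n + 1) :=
    Q.toFinset.orderEmbOfFin (by rw [← Set.ncard_eq_toFinset_card', hm])
  have hf : Set.range f = Q := by simp [f]
  obtain ⟨x', hx'⟩ : x ∈ Set.range f := hf ▸ (hQ h).1
  obtain ⟨y', hy'⟩ : y ∈ Set.range f := hf ▸ (hQ h).2
  have hsep : ∀ F : Set (Fin (m + 1)), Separates x' y' F ↔ Separates x y (f '' F) := by
    intro F
    simp only [Separates, Set.exists_mem_image, ← hx', ← hy', f.lt_iff_lt]
  have hdiag : IsDiagonal x' y' := by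
    rw [isDiagonal_iff, hsep, Set.image_univ, hf]
    exact h
  have := hS m hm x' y' hdiag
  rw [DiagonalLoc, ← Loc.image_iff (SSet.stdSimplex.map (SimplexCategory.Hom.mk f.toOrderHom)) le_top,
    ← sub_top, image_sub f (sides x' y') (LowerSet.Iic Q ⊓ sides x y),
    image_sub f ⊤ (LowerSet.Iic Q)] at this
  · exact this
  · intro F
    constructor
    · intro hF
      refine ⟨f ⁻¹' F, trivial, Set.image_preimage_eq_of_subset (hf ▸ hF)⟩
    · rintro ⟨F', -, rfl⟩
      exact (Set.image_subset_range f F').trans hf.le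
  · intro F
    constructor
    · intro hF
      have h' : f '' (f ⁻¹' F) = F := Set.image_preimage_eq_of_subset (hf ▸ hF.1)
      refine ⟨f ⁻¹' F, ?_, h'⟩
      rw [mem_sides, hsep, h']
      exact hF.2
    · rintro ⟨F', hF', rfl⟩
      refine ⟨(Set.image_subset_range f F').trans hf.le, ?_⟩
      rw [mem_sides, hsep] at hF'
      exact hF'

end Polygons
-- Polygonal decompositions, single diagonals and the parity complexes.
section Decompositions

open SSet Simplicial HomotopicalAlgebra

variable {n : ℕ} {S : SimplexCategoryᵒᵖ ⥤ SSet.{u}} [∀ k, KanComplex (S.obj k)]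

variable (S) in
/-- The 2-Segal condition for all the diagonals of the `(n+1)`-gon. -/
def AllDiagonalsLoc (n : ℕ) : Prop := ∀ x y : Fin (n + 1), IsDiagonal x y → DiagonalLoc S x y

/-- The sets of vertices that are not separated by any of the given diagonals. -/
def unseparated (D : Set (Fin (n + 1) × Fin (n + 1))) : LowerSet (Set (Fin (n + 1))) where
  carrier := Set.ofPred fun Q ↦ ∀ d ∈ D, Q ∈ sides d.1 d.2
  lower' _ _ h hQ d hd := (sides d.1 d.2).lower h (hQ d hd)

lemma mem_unseparated {D : Set (Fin (n + 1) × Fin (n + 1))} {Q : Set (Fin (n + 1))} :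
    Q ∈ unseparated D ↔ ∀ d ∈ D, ¬ Separates d.1 d.2 Q := Iff.rfl

lemma unseparated_insert (D : Set (Fin (n + 1) × Fin (n + 1))) (d : Fin (n + 1) × Fin (n + 1)) :
    unseparated (insert d D) = unseparated D ⊓ sides d.1 d.2 := by
  ext Q
  simp only [SetLike.mem_coe, mem_unseparated, Set.mem_insert_iff, forall_eq_or_imp,
    LowerSet.coe_inf, Set.mem_inter_iff, mem_sides]
  exact and_comm

/-- The lines through two pairs of points cross. -/
def Crossing (d e : Fin (n + 1) × Fin (n + 1)) : Prop := d.1 < e.1 ∧ e.1 < d.2 ∧ d.2 < e.2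

/-- `F` lies on one closed side of `d`. If an endpoint of `e` were strictly on the other side,
non-crossing would put all of `e` on that side, and `F` could not have points strictly on both sides
of `e`. -/
lemma not_separates_union {d e : Fin (n + 1) × Fin (n + 1)} (h : ¬ Crossing d e)
    (h' : ¬ Crossing e d) {F : Set (Fin (n + 1))} (hF : ¬ Separates d.1 d.2 F)
    (hF' : Separates e.1 e.2 F) : ¬ Separates d.1 d.2 (F ∪ {e.1, e.2}) := by
  obtain ⟨d₁, d₂⟩ := d
  obtain ⟨e₁, e₂⟩ := e
  obtain ⟨p, hp, q, hq, hpq⟩ := hF'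
  rintro ⟨a, ha, b, hb, hab⟩
  have H : ∀ a ∈ F, ∀ b ∈ F, ¬ ((d₁ < a ∧ a < d₂) ∧ (b < d₁ ∨ d₂ < b)) :=
    fun a ha b hb hab ↦ hF ⟨a, ha, b, hb, hab⟩
  simp only [Crossing] at *
  have h₁ := H p hp q hq
  have h₂ := H q hq p hp
  have h₃ := H p hp p hp
  rcases ha with ha | rfl | rfl
  · have h₄ := H a ha p hp
    have h₅ := H a ha q hq
    rcases hb with hb | rfl | rfl
    · exact H a ha b hb hab
    · omega
    · omega
  · rcases hb with hb | rfl | rfl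
    · have h₄ := H p hp b hb
      have h₅ := H q hq b hb
      omega
    · omega
    · omega
  · rcases hb with hb | rfl | rfl
    · have h₄ := H p hp b hb
      have h₅ := H q hq b hb
      omega
    · omega
    · omega

/-- Adding the endpoints of `e` to each set separated by `e` gives a cover by sets that `e` cuts
along a diagonal of their own. -/
lemma loc_unseparated_insert {D : Set (Fin (n + 1) × Fin (n + 1))} {e : Fin (n + 1) × Fin (n + 1)}
    (h : ∀ d ∈ D, ¬ Crossing d e ∧ ¬ Crossing e d)
    (hS : ∀ Q ∈ unseparated D, ∀ m, m + 1 = Q.ncard → AllDiagonalsLoc S m) :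
    Loc S (sub (unseparated (insert e D))) (sub (unseparated D)) := by
  rw [unseparated_insert]
  refine loc_inf_of_cover (fun _ _ h h' ↦ CutBy.inter (x := e.1) (y := e.2) h h')
    (fun Q hQ hQ' ↦ loc_Iic_inf_sides hQ' (hS Q hQ)) fun F hF ↦ ?_
  by_cases hF' : Separates e.1 e.2 F
  · exact ⟨F ∪ {e.1, e.2}, fun d hd ↦ not_separates_union (h d hd).1 (h d hd).2 (hF d hd) hF',
      Set.subset_union_left, fun _ ↦ ⟨by simp, by simp⟩⟩
  · exact ⟨F, hF, subset_rfl, fun h ↦ (hF' h).elim⟩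

lemma unseparated_empty : unseparated (∅ : Set (Fin (n + 1) × Fin (n + 1))) = ⊤ := by
  ext Q
  simp [mem_unseparated]

lemma unseparated_singleton (d : Fin (n + 1) × Fin (n + 1)) :
    unseparated {d} = sides d.1 d.2 := by
  ext Q
  simp [mem_unseparated, mem_sides]

lemma loc_unseparated (hS : ∀ m, AllDiagonalsLoc S m) (D : Set (Fin (n + 1) × Fin (n + 1)))
    (hD : ∀ d ∈ D, ∀ e ∈ D, ¬ Crossing d e) : Loc S (sub (unseparated D)) ⊤ := by
  induction D, D.toFinite using Set.Finite.induction_on with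
  | empty =>
    rw [unseparated_empty, sub_top]
    exact .refl _
  | insert _ _ ih =>
    refine (loc_unseparated_insert (fun d hd ↦ ⟨hD d (.inr hd) _ (.inl rfl),
      hD _ (.inl rfl) d (.inr hd)⟩) fun _ _ m _ ↦ hS m).trans
      (ih fun d hd e he ↦ hD d (.inr hd) e (.inr he))

/-- The polygons are the maximal unseparated sets, and by finiteness every unseparated set lies in
one. -/
lemma complex_eq_sub (P : PolygonalDecomposition n) :
    P.complex = sub.{u} (unseparated P.diagonals) := by
  have hP : ∀ Q : Finset (Fin (n + 1)), P.Unseparated Q ↔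
      (Q : Set (Fin (n + 1))) ∈ unseparated P.diagonals := by
    exact fun Q ↦ ⟨fun h d hd ⟨a, ha, b, hb, hab⟩ ↦ h d hd a ha b hb hab,
      fun h d hd a ha b hb hab ↦ h d hd ⟨a, ha, b, hb, hab⟩⟩
  have hface : ∀ (Q : Finset (Fin (n + 1))) k (s : (Δ[n] : SSet.{u}).obj k),
      s ∈ (stdSimplex.face Q).obj k ↔ vertices s ⊆ Q := by
    intro Q k s
    change Finset.image (stdSimplex.objEquiv s).toOrderHom ⊤ ≤ Q ↔ _
    simp [vertices, Set.range_subset_iff, Finset.image_subset_iff]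
  ext k s
  simp only [PolygonalDecomposition.complex, Subfunctor.iSup_obj, Set.mem_iUnion, hface]
  constructor
  · rintro ⟨Q, hQ, hs⟩
    exact (unseparated P.diagonals).lower hs ((hP Q).1 hQ.1)
  · intro hs
    obtain ⟨Q, hQ, hQ'⟩ := (Set.toFinite {Q | P.Unseparated Q}).exists_le_maximal
      (a := (vertices s).toFinite.toFinset) ((hP _).2 (by
        rw [Set.Finite.coe_toFinset]
        exact hs))
    exact ⟨Q, hQ', by simpa using hQ⟩

lemma isTwoSegal_iff : IsTwoSegal S ↔ ∀ n, AllDiagonalsLoc S n := by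
  constructor
  · intro h n x y hxy
    let P : PolygonalDecomposition n :=
      { diagonals := {(x, y)}
        isDiagonal := by
          rintro _ rfl
          exact hxy
        noncrossing := by
          rintro _ rfl _ rfl h
          exact h.1.false }
    have hn : 3 ≤ n := by
      obtain ⟨h₁, h₂⟩ := hxy
      omega
    have := h n hn P
    rwa [isHomotopyEquiv_restrict_iff, complex_eq_sub, unseparated_singleton] at this
  · intro h n _ P
    rw [isHomotopyEquiv_restrict_iff, complex_eq_sub]
    exact loc_unseparated h _ P.noncrossing

/-- Cutting along both diagonals is local in cutting along either one, because the pieces of a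
single cut have fewer vertices. Two out of three then passes from `d` to `e`. -/
lemma IsDiagonal.of_noncrossing (hS : ∀ m < n, AllDiagonalsLoc S m)
    {d e : Fin (n + 1) × Fin (n + 1)} (hd : IsDiagonal d.1 d.2) (he : IsDiagonal e.1 e.2)
    (h : ¬ Crossing d e) (h' : ¬ Crossing e d) (hL : DiagonalLoc S d.1 d.2) :
    DiagonalLoc S e.1 e.2 := by
  have key : ∀ {d e : Fin (n + 1) × Fin (n + 1)}, IsDiagonal d.1 d.2 → ¬ Crossing d e →
      ¬ Crossing e d → Loc S (sub (sides d.1 d.2 ⊓ sides e.1 e.2)) (sub (sides d.1 d.2)) := by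
    intro d e hd h h'
    have := loc_unseparated_insert (S := S) (D := {d}) (e := e) (by simp [h, h']) (by
      intro Q hQ m hm
      refine hS m ?_
      have hne : Q ≠ Set.univ := by
        rintro rfl
        exact hQ d rfl ((isDiagonal_iff _ _).1 hd)
      have := Set.ncard_lt_card hne
      simp at this
      omega)
    rwa [unseparated_insert, unseparated_singleton] at this
  have h₁ := (key hd h h').trans hL
  have h₂ := key he h' h
  rw [inf_comm] at h₂
  exact (h₂.trans_iff_left le_top).1 h₁

/-- The sets of vertices that do not contain all the vertices with a given parity. -/
def missing (n ε : ℕ) : LowerSet (Set (Fin (n + 1))) where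
  carrier := Set.ofPred fun Q ↦ ∃ i : Fin (n + 1), (i : ℕ) % 2 = ε ∧ i ∉ Q
  lower' _ _ h := fun ⟨i, hi, hQ⟩ ↦ ⟨i, hi, fun hi' ↦ hQ (h hi')⟩

/-- `missing n ε` is covered by facets, which are smaller polygons. Cutting each along `(x, y)` is
local and leaves `sides x y`, so both complexes are local in the simplex or neither is. -/
lemma loc_missing_top_iff {ε : ℕ} (hS : ∀ m < n, AllDiagonalsLoc S m) {x y : Fin (n + 1)}
    (hx : (x : ℕ) % 2 ≠ ε) (hy : (y : ℕ) % 2 ≠ ε) (hxy : sides x y ≤ missing n ε) :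
    Loc S (sub (missing n ε)) ⊤ ↔ DiagonalLoc S x y := by
  have : Loc S (sub (missing n ε ⊓ sides x y)) (sub (missing n ε)) := by
    refine loc_inf_of_cover (fun _ _ h h' ↦ CutBy.inter (x := x) (y := y) h h')
      (fun Q hQ hQ' ↦ loc_Iic_inf_sides hQ' fun m hm ↦ hS m ?_) ?_
    · obtain ⟨i, -, hi⟩ := hQ
      have := Set.ncard_lt_card (s := Q) (fun h ↦ hi (h ▸ trivial))
      simp at this
      omega
    · rintro F ⟨i, hi, hF⟩
      -- The facet opposite `i` contains `x` and `y`, since these have the other parity.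
      refine ⟨{i}ᶜ, ⟨i, hi, by simp⟩, by simpa using hF, fun _ ↦ ⟨?_, ?_⟩⟩
      · rintro rfl
        exact hx hi
      · rintro rfl
        exact hy hi
  rw [inf_eq_right.2 hxy] at this
  exact (this.trans_iff_left le_top).symm

/-- A set with all vertices of parity `ε` contains `x + 1`, strictly inside the short diagonal, and
the given `i` outside it, so it is separated. -/
lemma sides_le_missing {ε : ℕ} {x y : Fin (n + 1)} (hx : x.1 % 2 ≠ ε) (hxy : x.1 + 2 = y.1)
    (hε : ε ≤ 1) (h : ∃ i : Fin (n + 1), i.1 % 2 = ε ∧ (i < x ∨ y < i)) :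
    sides x y ≤ missing n ε := by
  intro F hF
  by_contra hF'
  have h' : ∀ i : Fin (n + 1), (i : ℕ) % 2 = ε → i ∈ F := fun i hi ↦ by
    by_contra hiF
    exact hF' ⟨i, hi, hiF⟩
  obtain ⟨i, hi, hi'⟩ := h
  refine hF ⟨⟨x + 1, by omega⟩, h' _ (by simp only; omega), i, h' i hi, ⟨?_, ?_⟩, hi'⟩
  all_goals simp only [Fin.lt_def]; omega

lemma allDiagonalsLoc_iff : (∀ n, AllDiagonalsLoc S n) ↔ ∀ n, 3 ≤ n →
    Loc S (sub (missing n 0)) ⊤ ∧ Loc S (sub (missing n 1)) ⊤ := by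
  have key₀ : ∀ n (hn : 3 ≤ n), (∀ m < n, AllDiagonalsLoc S m) →
      (Loc S (sub (missing n 0)) ⊤ ↔ DiagonalLoc S (n := n) ⟨1, by omega⟩ ⟨3, by omega⟩) :=
    fun n hn hS ↦ loc_missing_top_iff hS (by simp) (by simp)
      (sides_le_missing (by simp) (by simp) (by simp) ⟨0, by simp, by simp [Fin.lt_def]⟩)
  have key₁ : ∀ n (hn : 3 ≤ n), (∀ m < n, AllDiagonalsLoc S m) →
      (Loc S (sub (missing n 1)) ⊤ ↔ DiagonalLoc S (n := n) ⟨0, by omega⟩ ⟨2, by omega⟩) :=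
    fun n hn hS ↦ loc_missing_top_iff hS (by simp) (by simp)
      (sides_le_missing (by simp) (by simp) (by simp) ⟨⟨3, by omega⟩, by simp, by simp [Fin.lt_def]⟩)
  constructor
  · exact fun h n hn ↦ ⟨(key₀ n hn fun m _ ↦ h m).2 (h n _ _ ⟨by simp, by simp⟩),
      (key₁ n hn fun m _ ↦ h m).2 (h n _ _ ⟨by simp, by simp; omega⟩)⟩
  · intro h n
    induction n using Nat.strong_induction_on with
    | _ n ih =>
    intro x y hxy
    have hn : 3 ≤ n := by
      obtain ⟨h₁, h₂⟩ := hxy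
      omega
    have h₁ := (key₀ n hn ih).1 (h n hn).1
    have h₂ := (key₁ n hn ih).1 (h n hn).2
    -- The diagonal `(0, 2)` is crossed only by diagonals from 1 to a vertex beyond 2.
    have step : ∀ {x y : Fin (n + 1)}, IsDiagonal x y → (x.1 ≠ 1 ∨ y.1 ≤ 2) →
        DiagonalLoc S x y := by
      intro x y hxy hx
      refine IsDiagonal.of_noncrossing ih (d := (⟨0, by omega⟩, ⟨2, by omega⟩)) (e := (x, y))
        ⟨by simp, by simp; omega⟩ hxy ?_ ?_ h₂
      all_goals simp only [Crossing, Fin.lt_def]; omega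
    by_cases hx : x.1 ≠ 1 ∨ y.1 ≤ 2
    · exact step hxy hx
    · obtain ⟨h₃, h₄⟩ := hxy
      by_cases hy : y.1 = 3
      · have hx' : x = ⟨1, by omega⟩ := Fin.ext (by simp only; omega)
        have hy' : y = ⟨3, by omega⟩ := Fin.ext hy
        rw [hx', hy']
        exact h₁
      -- For `y > 3` the diagonal `(2, y)` crosses neither `(0, 2)` nor `(1, y)` and links the two.
      · have h₅ : IsDiagonal (⟨2, by omega⟩ : Fin (n + 1)) y := ⟨by simp only; omega, by simp⟩
        refine IsDiagonal.of_noncrossing ih (d := (⟨2, by omega⟩, y)) (e := (x, y))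
          h₅ ⟨h₃, h₄⟩ ?_ ?_ (step h₅ (by simp))
        all_goals simp only [Crossing, Fin.lt_def]; omega

end Decompositions
-- Corner cubes of the associativity cube as cubes of subcomplexes.
section Corners

variable {m : ℕ}

lemma Two.eq_zero_of_le {a b : Two.{u}} (h : a ≤ b) (hb : b = .zero) : a = .zero :=
  h.resolve_right fun h' ↦ by cases hb.symm.trans h'

lemma Two.eq_one_of_le {a b : Two.{u}} (h : a ≤ b) (ha : a = .one) : b = .one :=
  h.resolve_left fun h' ↦ by cases ha.symm.trans h'

lemma Two.ne_zero_iff {a : Two.{u}} : a ≠ .zero ↔ a = .one := by cases a <;> simp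

/-- The quotient map to the ordered set of blocks. -/
noncomputable def toBlock (b : Vertex.{u} m) : Fin (m + 1) →o {x : Fin (m + 1) // IsBlockStart b x} where
  toFun x := ⟨blockStart b x, (blockStart_spec b x).1⟩
  monotone' _ _ h := blockStart_mono b h

/-- The inclusion of the smallest elements of the blocks. -/
def ofBlock (b : Vertex.{u} m) : {x : Fin (m + 1) // IsBlockStart b x} →o Fin (m + 1) where
  toFun x := x.1
  monotone' _ _ h := h

lemma toBlock_ofBlock (b : Vertex.{u} m) (x : {x : Fin (m + 1) // IsBlockStart b x}) :
    toBlock b (ofBlock b x) = x := Subtype.ext (blockStart_eq b x.2)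

lemma isBlockStart_succ {b : Vertex.{u} m} {d : Fin m} : IsBlockStart b d.succ ↔ b d = .zero := by
  constructor
  · exact fun h ↦ h d rfl
  · intro h i hi
    rwa [← Fin.succ_injective _ hi]

lemma blockStart_succ {b : Vertex.{u} m} {d : Fin m} (h : b d = .one) :
    blockStart b d.succ = blockStart b d.castSucc := by
  refine le_antisymm (le_blockStart b (blockStart_spec b _).1 ?_)
    (blockStart_mono b (Fin.castSucc_lt_succ).le)
  have h₁ := (blockStart_spec b d.succ).2
  rcases h₁.lt_or_eq with h₂ | h₂
  · exact Fin.le_castSucc_iff.2 h₂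
  · have h₃ := (blockStart_spec b d.succ).1
    rw [h₂, isBlockStart_succ, h] at h₃
    cases h₃

lemma apply_blockStart {b : Vertex.{u} m} {T : Type*} (φ : Fin (m + 1) → T)
    (h : ∀ d : Fin m, b d = .one → φ d.castSucc = φ d.succ) (x : Fin (m + 1)) :
    φ (blockStart b x) = φ x := by
  induction x using Fin.induction with
  | zero => rw [Fin.le_zero_iff.1 (blockStart_spec b 0).2]
  | succ d ih =>
    by_cases hd : b d = .zero
    · rw [blockStart_eq b (isBlockStart_succ.2 hd)]
    · replace hd := Two.ne_zero_iff.1 hd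
      rw [blockStart_succ hd, ih, h d hd]

variable {n : ℕ}

/-- The condition imposed on a chain by the direction `d` of the corner at `v`. -/
def CornerCond (v : Vertex.{u} m) (d : Fin m) (s : ComposableArrows (Aug.{u} (Fin (m + 1))) n) :
    Prop :=
  (v d = .one → ∀ i, s.obj i d.castSucc = s.obj i d.succ) ∧
    (v d = .zero → (∀ i, s.obj i d.succ = .one) ∨ ∀ i, s.obj i d.castSucc = .zero)

/-- The simplicial subsets of the augmentation that appear in the corner cube at `v`. -/
def cornerComplex (v a : Vertex.{u} m) : (aug.{u} (Fin (m + 1))).Subcomplex where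
  obj k := Set.ofPred fun s : ComposableArrows (Aug.{u} (Fin (m + 1))) k.unop.len ↦
    ∀ d, a d = .one → CornerCond v d s
  map _ _ hs d hd := ⟨fun h _ ↦ (hs d hd).1 h _, fun h ↦ ((hs d hd).2 h).imp
    (fun h' _ ↦ h' _) fun h' _ ↦ h' _⟩

lemma cornerComplex_antitone (v : Vertex.{u} m) : Antitone (cornerComplex v) :=
  fun _ _ h _ _ hs d hd ↦ hs d (Two.eq_one_of_le (h d) hd)

lemma src_cornerMap_eq_one {v a : Vertex.{u} m} {d : Fin m} :
    (cornerMap v a).src d = .one ↔ a d = .one ∧ v d = .one := by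
  simp only [Position.src, cornerMap]
  cases a d <;> cases v d <;> simp [Two.toLeg, Leg.src]

lemma tgt_cornerMap_eq_zero {v a : Vertex.{u} m} {d : Fin m} :
    (cornerMap v a).tgt d = .zero ↔ a d = .one ∧ v d = .zero := by
  simp only [Position.tgt, cornerMap]
  cases a d <;> cases v d <;> simp [Two.toLeg, Leg.tgt]

/-- The chains in the augmentation of the set of blocks as chains in the augmentation of the
initial set. -/
noncomputable abbrev ofBlocks (b : Vertex.{u} m) :
    aug.{u} {x : Fin (m + 1) // IsBlockStart b x} ⟶ aug.{u} (Fin (m + 1)) :=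
  augMap (toBlock b)

/-- `H_comb` of the map between the sets of blocks. -/
noncomputable abbrev blockHcomb (b c : Vertex.{u} m) : (aug.{u} {x : Fin (m + 1) // IsBlockStart b x}).Subcomplex :=
  Hcomb.{u} (blockMap b c)

/-- A direction with `v d = 1` is merged at the source, so both neighbours lie in one block. With `v
d = 0` it stays unmerged at the target, so the fibre over `y` lies entirely to one side of the gap,
and the other side is constant. -/
lemma ofBlocks_mem_cornerComplex {v a : Vertex.{u} m}
    (s : ComposableArrows (Aug.{u} {x : Fin (m + 1) // IsBlockStart (cornerMap v a).src x}) n)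
    (y : {x : Fin (m + 1) // IsBlockStart (cornerMap v a).tgt x})
    (hy : ∀ i, s.obj i ∈ fibreVertices (blockMap (cornerMap v a).src (cornerMap v a).tgt) y)
    (d : Fin m) (hd : a d = .one) :
    (v d = .one → ∀ i, s.obj i (toBlock _ d.castSucc) = s.obj i (toBlock _ d.succ)) ∧
    (v d = .zero → (∀ i, s.obj i (toBlock _ d.succ) = .one) ∨
      ∀ i, s.obj i (toBlock _ d.castSucc) = .zero) := by
  have hblock : ∀ x, (blockMap (cornerMap v a).src (cornerMap v a).tgt (toBlock _ x)).1 =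
      blockStart (cornerMap v a).tgt x := fun x ↦
    blockStart_blockStart (Position.src_le_tgt _) x
  constructor
  · intro hv i
    refine congrArg (s.obj i) (Subtype.ext ?_)
    exact (blockStart_succ (src_cornerMap_eq_one.2 ⟨hd, hv⟩)).symm
  · intro hv
    have hstart := isBlockStart_succ.2 (tgt_cornerMap_eq_zero.2 ⟨hd, hv⟩)
    rcases le_or_gt y.1 d.castSucc with h | h
    · refine Or.inl fun i ↦ (hy i (toBlock _ d.succ)).2 ?_
      rw [← Subtype.coe_lt_coe, hblock, blockStart_eq _ hstart]
      exact Fin.le_castSucc_iff.1 h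
    · refine Or.inr fun i ↦ (hy i (toBlock _ d.castSucc)).1 ?_
      rw [← Subtype.coe_lt_coe, hblock]
      exact (blockStart_spec _ _).2.trans_lt h

/-- Converse of the preceding lemma: the conditions at the separate gaps are combined into one fibre
that works for the whole chain. -/
lemma exists_fibre {v a : Vertex.{u} m} (s : ComposableArrows (Aug.{u} (Fin (m + 1))) n)
    (hs : ∀ d, a d = .one → CornerCond v d s) :
    ∃ y : {x : Fin (m + 1) // IsBlockStart (cornerMap v a).tgt x},
      ∀ i, (s.obj i).comp (ofBlock _) ∈
        fibreVertices (blockMap (cornerMap v a).src (cornerMap v a).tgt) y := by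
  -- `y` is the last target block before which the chain is constantly `0`; the block of 0 qualifies
  -- vacuously. At a later block the gap condition fails in its `0` alternative, hence gives `1`
  -- from there on.
  obtain ⟨y, hy⟩ := (Set.toFinite {y : Fin (m + 1) | IsBlockStart (cornerMap v a).tgt y ∧
    ∀ d : Fin m, y = d.succ → ∀ i, s.obj i d.castSucc = .zero}).exists_maximal
      ⟨0, fun i hi ↦ (Fin.succ_ne_zero i hi.symm).elim,
        fun d hd ↦ (Fin.succ_ne_zero d hd.symm).elim⟩
  refine ⟨⟨y, hy.1.1⟩, fun i x ↦ ⟨fun hx ↦ ?_, fun hx ↦ ?_⟩⟩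
  · have hxy : x.1 < y := by
      by_contra h
      exact hx.not_ge (le_blockStart _ hy.1.1 (not_lt.1 h))
    obtain ⟨d, rfl⟩ := Fin.exists_succ_eq.2 (Fin.ne_zero_of_lt hxy)
    exact Two.eq_zero_of_le ((s.obj i).monotone (Fin.le_castSucc_iff.2 hxy)) (hy.1.2 d rfl i)
  · have hz := blockStart_spec (cornerMap v a).tgt x.1
    set z := blockStart (cornerMap v a).tgt x.1
    have hyz : y < z := hx
    have hz' : ¬ ∀ d : Fin m, z = d.succ → ∀ i, s.obj i d.castSucc = .zero := fun h ↦
      hyz.not_ge (hy.2 ⟨hz.1, h⟩ hyz.le)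
    push Not at hz'
    obtain ⟨d, hd, j, hj⟩ := hz'
    have hz₁ := hz.1
    rw [hd, isBlockStart_succ, tgt_cornerMap_eq_zero] at hz₁
    rcases (hs d hz₁.1).2 hz₁.2 with h | h
    · exact Two.eq_one_of_le ((s.obj i).monotone (hd ▸ hz.2)) (h i)
    · exact (hj (h j)).elim

/-- The isomorphisms between the corner cube at `v` and the cube of the simplicial sets
`cornerComplex`. -/
noncomputable def cornerMapHom (v a : Vertex.{u} m) :
    (blockHcomb (cornerMap v a).src (cornerMap v a).tgt).toSSet ⟶ (cornerComplex v a).toSSet where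
  app k := ↾fun s ↦ ⟨(ofBlocks _).app k s.1, fun d hd ↦ by
    obtain h | ⟨y, hy⟩ := s.2
    · exact (h.false (toBlock _ 0)).elim
    · exact ofBlocks_mem_cornerComplex _ y hy d hd⟩
  naturality _ _ _ := rfl

instance (v a : Vertex.{u} m) : IsIso (cornerMapHom v a) := by
  rw [NatTrans.isIso_iff_isIso_app]
  intro k
  rw [isIso_iff_bijective]
  constructor
  · intro s t h
    have h' : ∀ (i : Fin (k.unop.len + 1)) (x : Fin (m + 1)),
        Functor.obj (C := Fin (k.unop.len + 1)) s.1 i (toBlock _ x) =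
          Functor.obj (C := Fin (k.unop.len + 1)) t.1 i (toBlock _ x) := by
      intro i x
      have := congrArg (fun r : (cornerComplex v a).toSSet.obj k ↦
        Functor.obj (C := Fin (k.unop.len + 1)) r.1 i x) h
      exact this
    refine Subtype.ext (composableArrows_ext fun i ↦ OrderHom.ext _ _ (funext fun x ↦ ?_))
    rw [← toBlock_ofBlock _ x]
    exact h' i _
  · rintro ⟨s, hs⟩
    obtain ⟨y, hy⟩ := exists_fibre s hs
    refine ⟨⟨(augMap (ofBlock _)).app k s, Or.inr ⟨y, hy⟩⟩, Subtype.ext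
      (composableArrows_ext fun i ↦ OrderHom.ext _ _ (funext fun x ↦ ?_))⟩
    refine apply_blockStart (b := (cornerMap v a).src)
      (Functor.obj (C := Fin (k.unop.len + 1)) (D := Aug.{u} (Fin (m + 1))) s i) (fun d hd ↦ ?_) x
    rw [src_cornerMap_eq_one] at hd
    exact (hs d hd.1).1 hd.2 i

variable (S : SimplexCategoryᵒᵖ ⥤ SSet.{u})

/-- The corner cubes of the associativity cube. -/
noncomputable def cornerIso (v : Vertex.{u} m) :
    SextDiagram S (cornerComplex_antitone v) ≅ (HgeoCube S (assocCube m)).corner v :=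
  NatIso.ofComponents (fun a ↦ (Sext S).mapIso (asIso (cornerMapHom v a)).op) (by
    intro a b f
    refine ((Sext S).map_comp _ _).symm.trans (Eq.trans (congrArg _ ?_) ((Sext S).map_comp _ _))
    apply Quiver.Hom.unop_inj
    ext k s
    refine Subtype.ext (composableArrows_ext fun i ↦ OrderHom.ext _ _ (funext fun x ↦ ?_))
    refine congrArg (Functor.obj (C := Fin (k.unop.len + 1))
      (D := Aug.{u} {x : Fin (m + 1) // IsBlockStart (cornerMap v b).src x}) s.1 i) (Subtype.ext ?_)
    exact (blockStart_blockStart (Position.src_mono (cornerMap_mono v (leOfHom f))) x).symm)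

end Corners
-- The augmentation as a standard simplex; parity of the alternating corners.
section Cuts

open SSet Simplicial

variable {m : ℕ}

/-- The monotone map to `0 → 1` which sends exactly the last `j` elements to `1`. -/
def cut (j : Fin (m + 2)) : Aug.{u} (Fin (m + 1)) where
  toFun x := if m + 1 ≤ (x : ℕ) + j then .one else .zero
  monotone' x y h := by
    by_cases hx : m + 1 ≤ (x : ℕ) + j
    · have hy : m + 1 ≤ (y : ℕ) + j := by rw [Fin.le_def] at h; omega
      simp only [if_pos hx, if_pos hy, le_refl]
    · simp only [if_neg hx]
      exact Or.inl rfl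

lemma cut_eq_one {j : Fin (m + 2)} {x : Fin (m + 1)} :
    cut.{u} j x = .one ↔ m + 1 ≤ (x : ℕ) + j := by
  change (if m + 1 ≤ (x : ℕ) + j then Two.one else Two.zero) = _ ↔ _
  split_ifs with h <;> simp [h]

lemma cut_eq_zero {j : Fin (m + 2)} {x : Fin (m + 1)} :
    cut.{u} j x = .zero ↔ (x : ℕ) + j ≤ m := by
  change (if m + 1 ≤ (x : ℕ) + j then Two.one else Two.zero) = _ ↔ _
  split_ifs with h <;> simp only [false_iff, true_iff] <;> omega

/-- Only the cut `j = m - d` jumps between the neighbours `d` and `d + 1`. Thus gap `d` corresponds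
to vertex `m - d`, with the order reversed. -/
lemma cut_castSucc_eq_succ {j : Fin (m + 2)} {d : Fin m} :
    cut.{u} j d.castSucc = cut j d.succ ↔ (j : ℕ) + d ≠ m := by
  have h : cut.{u} j d.castSucc = cut j d.succ ↔
      (cut.{u} j d.castSucc = .one ↔ cut.{u} j d.succ = .one) := by
    cases cut.{u} j d.castSucc <;> cases cut.{u} j d.succ <;> simp
  rw [h, cut_eq_one, cut_eq_one, Fin.val_castSucc, Fin.val_succ]
  omega

lemma cut_mono : Monotone (cut.{u} (m := m)) := by
  intro i j h x
  rw [Fin.le_def] at h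
  by_cases hx : m + 1 ≤ (x : ℕ) + i
  · exact Or.inr (cut_eq_one.2 (by omega))
  · exact Or.inl (cut_eq_zero.2 (by omega))

lemma cut_injective : Function.Injective (cut.{u} (m := m)) := by
  suffices ∀ i j : Fin (m + 2), i < j → cut.{u} i ≠ cut j by
    intro i j h
    rcases lt_trichotomy i j with hij | hij | hij
    · exact (this i j hij h).elim
    · exact hij
    · exact (this j i hij h.symm).elim
  intro i j hij h
  rw [Fin.lt_def] at hij
  have h' := congrArg (fun φ : Aug.{u} (Fin (m + 1)) ↦ φ ⟨m + 1 - j, by omega⟩) h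
  have h₁ : cut.{u} j ⟨m + 1 - j, by omega⟩ = .one := cut_eq_one.2 (by dsimp only; omega)
  have h₂ := cut_eq_one.1 (h'.trans h₁)
  dsimp only at h₂
  omega

lemma cut_surjective : Function.Surjective (cut.{u} (m := m)) := by
  classical
  intro ψ
  by_cases h : ∃ x : ℕ, ∃ hx : x < m + 1, ψ ⟨x, hx⟩ = .one
  · obtain ⟨hx, hψ⟩ := Nat.find_spec h
    have hmin := fun y (hy : y < Nat.find h) ↦ Nat.find_min h hy
    set x := Nat.find h
    refine ⟨⟨m + 1 - x, by omega⟩, OrderHom.ext _ _ (funext fun y ↦ ?_)⟩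
    by_cases hy : x ≤ (y : ℕ)
    · rw [cut_eq_one.2 (by dsimp only; omega)]
      exact (Two.eq_one_of_le (ψ.monotone (show (⟨x, hx⟩ : Fin (m + 1)) ≤ y from hy)) hψ).symm
    · rw [cut_eq_zero.2 (by dsimp only; omega)]
      by_contra h'
      exact hmin y (by omega) ⟨y.2, Two.ne_zero_iff.1 (Ne.symm h')⟩
  · refine ⟨0, OrderHom.ext _ _ (funext fun y ↦ ?_)⟩
    rw [cut_eq_zero.2 (by rw [Fin.val_zero]; omega)]
    by_contra h'
    exact h ⟨y, y.2, Two.ne_zero_iff.1 (Ne.symm h')⟩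

lemma le_of_cut_le {i j : Fin (m + 2)} (h : cut.{u} i ≤ cut j) : i ≤ j := by
  by_contra hij
  exact hij (cut_injective (le_antisymm h (cut_mono (le_of_not_ge hij)))).le

/-- The augmentation of `{0, …, m}` is the standard simplex of dimension `m + 1`. -/
def cutMap (m : ℕ) : Δ[m + 1] ⟶ aug.{u} (Fin (m + 1)) where
  app _ := ↾fun s ↦ chainOfMonotone (fun i ↦ cut ((stdSimplex.objEquiv s).toOrderHom i))
    fun _ _ h ↦ cut_mono ((stdSimplex.objEquiv s).toOrderHom.monotone h)
  naturality _ _ _ := rfl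

instance (m : ℕ) : Mono (cutMap.{u} m) := by
  rw [mono_iff_app_injective]
  intro _ s t h
  apply stdSimplex.objEquiv.injective
  ext i : 3
  have := congrArg (fun r : (aug.{u} (Fin (m + 1))).obj _ ↦
    Functor.obj (C := Fin (_ + 1)) r i) h
  exact cut_injective this

lemma cutMap_surjective {k : SimplexCategoryᵒᵖ} (s : (aug.{u} (Fin (m + 1))).obj k) :
    ∃ t, (cutMap m).app k t = s := by
  choose f hf using fun i : Fin (k.unop.len + 1) ↦
    cut_surjective (Functor.obj (C := Fin (k.unop.len + 1)) (D := Aug.{u} (Fin (m + 1))) s i)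
  refine ⟨stdSimplex.objEquiv.symm (SimplexCategory.Hom.mk ⟨f, fun i j h ↦ le_of_cut_le ?_⟩),
    composableArrows_ext fun i ↦ hf i⟩
  rw [hf, hf]
  exact chain_le (Q := Aug.{u} (Fin (m + 1))) s h

/-- The condition on sets of vertices of `Δ[m + 1]` that corresponds to `CornerCond`. -/
def CutCond (v : Vertex.{u} m) (d : Fin m) (F : Set (Fin (m + 2))) : Prop :=
  (v d = .one → ∀ j ∈ F, (j : ℕ) + d ≠ m) ∧
    (v d = .zero → (∀ j ∈ F, m ≤ (j : ℕ) + d) ∨ ∀ j ∈ F, (j : ℕ) + d ≤ m)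

lemma cornerCond_cutMap {v : Vertex.{u} m} {d : Fin m} {k : SimplexCategoryᵒᵖ}
    (s : (Δ[m + 1] : SSet.{u}).obj k) :
    CornerCond v d ((cutMap m).app k s) ↔ CutCond v d (vertices s) := by
  have h : CornerCond v d ((cutMap m).app k s) ↔
      (v d = .one → ∀ i, cut.{u} ((stdSimplex.objEquiv s).toOrderHom i) d.castSucc =
        cut ((stdSimplex.objEquiv s).toOrderHom i) d.succ) ∧
      (v d = .zero → (∀ i, cut.{u} ((stdSimplex.objEquiv s).toOrderHom i) d.succ = .one) ∨
        ∀ i, cut.{u} ((stdSimplex.objEquiv s).toOrderHom i) d.castSucc = .zero) := Iff.rfl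
  rw [h, CutCond, vertices]
  simp only [Set.forall_mem_range, cut_castSucc_eq_succ, cut_eq_one, cut_eq_zero, Fin.val_succ,
    Fin.val_castSucc]
  have h₁ : ∀ j : ℕ, m + 1 ≤ (d : ℕ) + 1 + j ↔ m ≤ j + d := fun j ↦ by omega
  have h₂ : ∀ j : ℕ, (d : ℕ) + j ≤ m ↔ j + d ≤ m := fun j ↦ by omega
  simp only [h₁, h₂]

lemma altOne_eq_one {d : Fin m} : altOne.{u} m d = .one ↔ (d : ℕ) % 2 = 0 := by
  simp [altOne, Nat.even_iff]

lemma altOne_eq_zero {d : Fin m} : altOne.{u} m d = .zero ↔ (d : ℕ) % 2 = 1 := by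
  simp [altOne, Nat.even_iff]

lemma altZero_eq_one {d : Fin m} : altZero.{u} m d = .one ↔ (d : ℕ) % 2 = 1 := by
  simp [altZero, Nat.even_iff]

lemma altZero_eq_zero {d : Fin m} : altZero.{u} m d = .zero ↔ (d : ℕ) % 2 = 0 := by
  simp [altZero, Nat.even_iff]

/-- Even `d` asks to omit `m - d`. Odd `d` asks to lie weakly on one side of `m - d`, which omits a
neighbour of `m - d`. In both cases the omitted vertex has the parity of `m`. -/
lemma exists_cutCond_altOne (hm : 1 ≤ m) {F : Set (Fin (m + 2))} :
    (∃ d, CutCond (altOne.{u} m) d F) ↔ F ∈ missing (m + 1) (m % 2) := by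
  simp only [CutCond, altOne_eq_one, altOne_eq_zero]
  constructor
  · rintro ⟨d, h₁, h₂⟩
    by_cases hd : (d : ℕ) % 2 = 0
    · exact ⟨⟨m - d, by omega⟩, by dsimp only; omega, fun hF ↦ h₁ hd _ hF (by dsimp only; omega)⟩
    · rcases h₂ (by omega) with h | h
      · refine ⟨⟨m - d - 1, by omega⟩, by dsimp only; omega, fun hF ↦ ?_⟩
        have := h _ hF
        dsimp only at this
        omega
      · refine ⟨⟨m - d + 1, by omega⟩, by dsimp only; omega, fun hF ↦ ?_⟩
        have := h _ hF
        dsimp only at this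
        omega
  · rintro ⟨i, hi, hF⟩
    have hne : ∀ j ∈ F, (j : ℕ) ≠ i := fun j hj h ↦ hF (Fin.ext h ▸ hj)
    -- Vertex 0 corresponds to no gap, since `d < m`; omitting it is the one-sided condition at
    -- vertex 1, that is `d = m - 1`.
    by_cases h₀ : (i : ℕ) = 0
    · refine ⟨⟨m - 1, by omega⟩, fun h ↦ ?_, fun h ↦ Or.inl fun j hj ↦ ?_⟩
      · dsimp only at h
        omega
      · have := hne j hj
        dsimp only
        omega
    · refine ⟨⟨m - i, by omega⟩, fun h j hj ↦ ?_, fun h ↦ ?_⟩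
      · have := hne j hj
        dsimp only
        omega
      · dsimp only at h
        omega

lemma exists_cutCond_altZero (hm : 1 ≤ m) {F : Set (Fin (m + 2))} :
    (∃ d, CutCond (altZero.{u} m) d F) ↔ F ∈ missing (m + 1) ((m + 1) % 2) := by
  simp only [CutCond, altZero_eq_one, altZero_eq_zero]
  constructor
  · rintro ⟨d, h₁, h₂⟩
    by_cases hd : (d : ℕ) % 2 = 1
    · exact ⟨⟨m - d, by omega⟩, by dsimp only; omega, fun hF ↦ h₁ hd _ hF (by dsimp only; omega)⟩
    · rcases h₂ (by omega) with h | h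
      · refine ⟨⟨m - d - 1, by omega⟩, by dsimp only; omega, fun hF ↦ ?_⟩
        have := h _ hF
        dsimp only at this
        omega
      · refine ⟨⟨m - d + 1, by omega⟩, by dsimp only; omega, fun hF ↦ ?_⟩
        have := h _ hF
        dsimp only at this
        omega
  · rintro ⟨i, hi, hF⟩
    have hne : ∀ j ∈ F, (j : ℕ) ≠ i := fun j hj h ↦ hF (Fin.ext h ▸ hj)
    by_cases h₀ : (i : ℕ) = 0
    · refine ⟨⟨m - 1, by omega⟩, fun h ↦ ?_, fun h ↦ Or.inl fun j hj ↦ ?_⟩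
      · dsimp only at h
        omega
      · have := hne j hj
        dsimp only
        omega
    -- Here the last vertex also has the relevant parity; omitting it means lying below vertex `m`,
    -- that is `d = 0`.
    · by_cases h₁ : (i : ℕ) = m + 1
      · refine ⟨⟨0, by omega⟩, fun h ↦ ?_, fun h ↦ Or.inr fun j hj ↦ ?_⟩
        · dsimp only at h
          omega
        · have := hne j hj
          dsimp only
          omega
      · refine ⟨⟨m - i, by omega⟩, fun h j hj ↦ ?_, fun h ↦ ?_⟩
        · have := hne j hj
          dsimp only
          omega
        · dsimp only at h
          omega

lemma cornerComplex_init (v : Vertex.{u} m) : cornerComplex v (Vertex.init m) = ⊤ := by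
  ext k s
  refine iff_of_true (fun d hd ↦ ?_) trivial
  cases hd

/-- Conditions accumulate along the cube, so the union over the non-initial vertices is already
attained at vertices with a single coordinate `1`. -/
lemma mem_iSup_cornerComplex {v : Vertex.{u} m} {k : SimplexCategoryᵒᵖ}
    {s : (aug.{u} (Fin (m + 1))).obj k} :
    s ∈ (⨆ a : Punctured.{u} m, cornerComplex v a.1).obj k ↔ ∃ d, CornerCond v d s := by
  classical
  simp only [Subfunctor.iSup_obj, Set.mem_iUnion]
  constructor
  · rintro ⟨a, ha⟩
    obtain ⟨d, hd⟩ := Function.ne_iff.1 a.2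
    exact ⟨d, ha d (Two.ne_zero_iff.1 hd)⟩
  · rintro ⟨d, hd⟩
    have h : (fun i ↦ if i = d then .one else .zero : Vertex.{u} m) ≠ Vertex.init m :=
      fun h ↦ by simpa [Vertex.init] using congrFun h d
    refine ⟨⟨_, h⟩, fun i hi ↦ ?_⟩
    by_cases hid : i = d
    · rwa [hid]
    · simp [hid] at hi

variable {S : SimplexCategoryᵒᵖ ⥤ SSet.{u}} [∀ k, KanComplex (S.obj k)]

lemma corner_isPullback_iff (v : Vertex.{u} m) :
    ((HgeoCube S (assocCube m)).corner v).IsPullback ↔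
      Loc S (⨆ a : Punctured.{u} m, cornerComplex v a.1) ⊤ := by
  classical
  have (a : Vertex m) : KanComplex (((HgeoCube S (assocCube m)).corner v).obj a) :=
    inferInstanceAs (KanComplex ((Sext S).obj _))
  have (a : Vertex m) : KanComplex ((SextDiagram S (cornerComplex_antitone v)).obj a) :=
    inferInstanceAs (KanComplex ((Sext S).obj _))
  rw [← Cube.IsPullback.iff_of_iso (cornerIso S v), isPullback_SextDiagram_iff, cornerComplex_init]
  intro a b
  -- Intersecting two pieces imposes both sets of conditions, which is the piece at the
  -- coordinatewise maximum.
  refine ⟨fun i ↦ if a i = .one ∨ b i = .one then .one else .zero, fun i ↦ ?_, fun i ↦ ?_, ?_⟩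
  · by_cases h : a i = .one
    · exact Or.inr (if_pos (Or.inl h))
    · exact Or.inl (by_contra fun h' ↦ h (Two.ne_zero_iff.1 h'))
  · by_cases h : b i = .one
    · exact Or.inr (if_pos (Or.inr h))
    · exact Or.inl (by_contra fun h' ↦ h (Two.ne_zero_iff.1 h'))
  · intro k s hs d hd
    by_cases h : a d = .one ∨ b d = .one
    · exact h.elim (hs.1 d) (hs.2 d)
    · simp [h] at hd

lemma corner_isPullback_iff_loc {v : Vertex.{u} m} {𝓕 : LowerSet (Set (Fin (m + 2)))}
    (h : ∀ F, (∃ d, CutCond v d F) ↔ F ∈ 𝓕) :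
    ((HgeoCube S (assocCube m)).corner v).IsPullback ↔ Loc S (sub 𝓕) ⊤ := by
  have h₁ : (sub 𝓕).image (cutMap m) = ⨆ a : Punctured.{u} m, cornerComplex v a.1 := by
    ext k s
    rw [mem_iSup_cornerComplex]
    constructor
    · rintro ⟨t, ht, rfl⟩
      obtain ⟨d, hd⟩ := (h _).2 ht
      exact ⟨d, (cornerCond_cutMap t).2 hd⟩
    · rintro ⟨d, hd⟩
      obtain ⟨t, rfl⟩ := cutMap_surjective s
      exact ⟨t, (h _).1 ⟨d, (cornerCond_cutMap t).1 hd⟩, rfl⟩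
  have h₂ : (⊤ : (Δ[m + 1] : SSet.{u}).Subcomplex).image (cutMap m) = ⊤ := by
    ext k s
    obtain ⟨t, ht⟩ := cutMap_surjective s
    exact iff_of_true ⟨t, trivial, ht⟩ trivial
  rw [corner_isPullback_iff, ← Loc.image_iff (cutMap m) le_top, h₁, h₂]

lemma commutes_assocCube_iff (hm : 1 ≤ m) :
    (HgeoCube S (assocCube m)).Commutes ↔ Loc S (sub (missing (m + 1) 0)) ⊤ ∧
      Loc S (sub (missing (m + 1) 1)) ⊤ := by
  rw [CorrCube.Commutes, corner_isPullback_iff_loc fun _ ↦ exists_cutCond_altOne hm,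
    corner_isPullback_iff_loc fun _ ↦ exists_cutCond_altZero hm]
  rcases Nat.mod_two_eq_zero_or_one m with h | h
  · rw [h, show (m + 1) % 2 = 1 by omega]
  · rw [h, show (m + 1) % 2 = 0 by omega, and_comm]

end Cuts
end HigherHall

theorem mainTheorem1 (S : SimplexCategoryᵒᵖ ⥤ SSet.{u})
    (hS : ∀ k : SimplexCategoryᵒᵖ, SSet.KanComplex (S.obj k)) :
    HigherHall.IsTwoSegal S ↔
      ∀ n : ℕ, 3 ≤ n →
        (HigherHall.HgeoCube S (HigherHall.assocCube (n - 1))).Commutes := by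
  rw [HigherHall.isTwoSegal_iff, HigherHall.allDiagonalsLoc_iff]
  refine forall₂_congr fun n hn ↦ ?_
  -- The cube of dimension `m = n - 1` starts at a set with `n` elements, whose augmentation is
  -- `Δ[n]`; so the conditions match for each `n` separately.
  obtain ⟨m, rfl⟩ := Nat.exists_eq_add_of_le' (show 1 ≤ n by omega)
  exact (HigherHall.commutes_assocCube_iff (by omega)).symm
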